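/- Let $M>0$, $v_0>0$, and consider the Schwarzschild exterior $\{(v,r,\omega): v\in\mathbb R,\ r\ge 2M,\ \omega\in\mathbb S^2\}$ with metric $g=-D\,dv^2+2\,dv\,dr+r^2d\omega^2$, $D(r)=1-\frac{2M}{r}$; the event horizon is $\mathcal H^+=\{r=2M\}$ and $T=\partial_v$ (in $(v,r)$-coordinates) is the stationary Killing field. Let $2M<r_{\mathcal H}<4M<R$ and let $\Sigma_0=\{v=v_{\Sigma_0}(r)\}$, $v_{\Sigma_0}(r)=v_0+\int_{2M}^r h$, with $h$ piecewise smooth, $h=0$ for $r\le r_{\mathcal H}$, $h=2/D$ for $r\ge R$, and $0<h<2/D$ for $r_{\mathcal H}<r<R$. Thus $\Sigma_0$ is ingoing null for $r\le r_{\mathcal H}$, strictly spacelike in between, and outgoing null for $r\geq R$. Let $u=v-2r^*$, $\frac{dr^*}{dr}=\frac1D$, with the additive constant of $r^*$ such that the outgoing part of $\Sigma_0$ is $N_0^{\mathcal I}=\{u=0,\ r\ge R\}$. In double null coordinates $(u,v)$, $\partial_u=-\frac D2\partial_r$ and $L=\partial_v$; in $(u,r)$-coordinates $\partial_r=\frac2D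 L$. Let $N$ be a smooth, time-invariant, spherically symmetric, strictly timelike vector field with $N=T-\partial_r$ (in $(v,r)$-coordinates) for $r\le r_{\mathcal H}$ and $N=T$ for $r\ge R$. Let $\epsilon_\phi>0$, $I_0^{(\mathrm{past})}[\phi]\in\mathbb R$, and let $\phi$ be a spherically symmetric solution of $\Box_g\phi=0$ that is smooth on $\{v\ge v_0,\ r\ge 2M\}$, up to and including $\{v=v_0\}$ and $\mathcal H^+$, and satisfies $$\partial_u(r\phi)(u,v_0)=\frac{2I_0^{(\mathrm{past})}[\phi]}{(1+u)^2}+\mathcal O_4\big(|1+u|^{-2-\epsilon_\phi}\big)\qquad(u<0,\ u\neq-1),\qquad \lim_{u\to-\infty}r\phi(u,v)=0\quad\text{for all } v\ge v_0 .$$ Here $\mathcal O_4(|1+u|^{-q})$ stands for a function $f$ with $|\partial_u^jf|\le C|1+u|^{-q-j}$ for $0\le j\le4$ and a constant $C$. Then the following hold. 1. For all $v\ge v_0$, at fixed $v$, $\lim_{r\to\infty}r^2\partial_r(r\phi)(v,r)=-I_0^{(\mathrm{past})}[\phi]$ (with $\partial_r$ in $(v,r)$-coordinates). 2. The limit $I_0^{\frac{\log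 r}{r^3}}[\phi]:=\lim_{r\to\infty}\frac{r^3}{\log r}\partial_r(r\phi)(u,r)$ (with $\partial_r$ in $(u,r)$-coordinates) exists for every $u\in\mathbb R$, is independent of $u$, and equals $-2M I_0^{(\mathrm{past})}[\phi]$. 3. There are constants $J\in\mathbb R$, $P>0$ and $\beta\in(0,\min(\epsilon_\phi,1))$ such that for all $r\ge R$ $$\Big|\partial_r(r\phi)|_{N_0^{\mathcal I}}(r)-I_0^{\frac{\log r}{r^3}}[\phi]\frac{\log r}{r^3}-\frac J{r^3}\Big|\le P\,r^{-3-\beta}.$$ 4. For every $\epsilon>0$, $\ \widetilde E^{\epsilon}_{0,I_0^{\log}=0;1}[\phi]+\int_{\Sigma_0}J^N[N^2\phi]\cdot n_{\Sigma_0}\,d\mu_{\Sigma_0}<\infty$, where, with $\psi=r\phi$, $J^V[f]=\mathbf T[f](V,\cdot)$, $\mathbf T_{\mu\nu}[f]=\partial_\mu f\,\partial_\nu f-\frac12g_{\mu\nu}\partial^\xi f\,\partial_\xi f$, with $\partial_r$ in $(u,r)$-coordinates, $$\begin{aligned}\widetilde E^{\epsilon}_{0,I_0^{\log}=0;1}[\phi]=&\sum_{i\le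 8}\int_{\Sigma_0}J^N[T^i\phi]\cdot n_{\Sigma_0}d\mu_{\Sigma_0}+\sum_{i\le1}\int_{\Sigma_0}J^N[NT^i\phi]\cdot n_{\Sigma_0}d\mu_{\Sigma_0}+\int_{R}^\infty r^{7-\epsilon}(\partial_r^2\psi)^2dr\\&+\sum_{i\le2}\int_R^\infty r^{5-\epsilon}(\partial_rT^i\psi)^2+r^{4-\epsilon}(\partial_rT^{1+i}\psi)^2+r^{3-\epsilon}(\partial_rT^{2+i}\psi)^2+r^2(\partial_rT^{3+i}\psi)^2+r(\partial_rT^{4+i}\psi)^2\,dr\\&+\sum_{i\le3}\int_R^\infty r^{4-\epsilon}(\partial_rT^i\psi)^2dr+\sum_{i\le1}\int_R^\infty r^{6-\epsilon}(\partial_r^2T^i\psi)^2dr,\end{aligned}$$ the $r$-integrals being along $N_0^{\mathcal I}$. On the spacelike part of $\Sigma_0$, $n_{\Sigma_0}$ is the future unit normal and $d\mu_{\Sigma_0}$ the induced volume form; on the ingoing and outgoing null parts, $n_{\Sigma_0}=\partial_u$, $d\mu_{\Sigma_0}=r^2d\omega\,du$, and $n_{\Sigma_0}=L$, $d\mu_{\Sigma_0}=r^2d\omega\,dv$,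 respectively. In particular, $\phi$ satisfies, for every $\epsilon\in(0,\beta)$, the conditions on data on $\Sigma_0$ (finiteness of $I_0^{\frac{\log r}{r^3}}[\phi]$, the expansion in 3 with $\beta\in(\epsilon,1)$, and finiteness of the energies in 4) under which the late-time asymptotics of solutions with $I_0^{\log}[\phi]=0$ are stated. -/

import Mathlib

open Set Filter Topology MeasureTheory
open scoped ContDiff ENNReal

/-! Spherically symmetric functions on the Schwarzschild exterior are written as functions of
`p = (v, r)`, where `(v, r)` are ingoing Eddington-Finkelstein coordinates; `p.1 = v`, `p.2 = r`.
The metric is `-D(r) dv² + 2 dv dr + r² dω²`. A spherically symmetric vector field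
`X = X¹ ∂_v + X² ∂_r` is a function `p ↦ (X¹, X²)`. -/

namespace Schwarzschild

/-- `h` is smooth on `(a, b)` up to finitely many break points: between two consecutive points of a
finite set containing `a` and `b` it agrees with a smooth function on the line. -/
def PiecewiseSmoothOn (h : ℝ → ℝ) (a b : ℝ) : Prop :=
  ∃ s : Finset ℝ, a ∈ s ∧ b ∈ s ∧ ∀ x ∈ s, ∀ y ∈ s, x < y → (∀ z ∈ s, ¬ (x < z ∧ z < y)) →
    ∃ g : ℝ → ℝ, ContDiff ℝ ∞ g ∧ ∀ r ∈ Ioo x y, h r = g r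

/-- A Schwarzschild exterior of mass `M > 0`, with a spacelike-null hypersurface
`Σ₀ = {v = v₀ + ∫_{2M}^r h}` and a red-shift vector field `N = Nv(r) ∂_v + Nr(r) ∂_r`. -/
structure Setting where
  /-- the mass -/
  M : ℝ
  M_pos : 0 < M
  /-- `{v = v₀}` is the ingoing cone on which data are posed; `Σ₀` starts on it -/
  v₀ : ℝ
  v₀_pos : 0 < v₀
  /-- `Σ₀` is ingoing null for `r ≤ rH` -/
  rH : ℝ
  /-- `Σ₀` is outgoing null for `r ≥ R` -/
  R : ℝ
  two_M_lt_rH : 2 * M < rH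
  rH_lt : rH < 4 * M
  lt_R : 4 * M < R
  /-- the slope `dv/dr` of `Σ₀` -/
  h : ℝ → ℝ
  h_inner : ∀ r, 2 * M ≤ r → r ≤ rH → h r = 0
  h_outer : ∀ r, R ≤ r → h r = 2 / (1 - 2 * M / r)
  h_piecewise : PiecewiseSmoothOn h rH R
  /-- strict spacelikeness of the middle part: the induced metric is
  `h (2 - D h) dr² + r² dω²` -/
  h_spacelike : ∀ r, rH < r → r < R → 0 < h r ∧ (1 - 2 * M / r) * h r < 2
  /-- the `∂_v`-component of `N` -/
  Nv : ℝ → ℝ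
  /-- the `∂_r`-component of `N` -/
  Nr : ℝ → ℝ
  Nv_smooth : ContDiff ℝ ∞ Nv
  Nr_smooth : ContDiff ℝ ∞ Nr
  /-- `N = T - Y` for `r ≤ rH`, where `T = ∂_v` and `Y = ∂_r + h ∂_v = ∂_r` -/
  N_inner : ∀ r, r ≤ rH → Nv r = 1 ∧ Nr r = -1
  /-- `N = T` for `r ≥ R` -/
  N_outer : ∀ r, R ≤ r → Nv r = 1 ∧ Nr r = 0
  /-- `g(N, N) < 0` -/
  N_timelike : ∀ r, rH < r → r < R → -(1 - 2 * M / r) * Nv r ^ 2 + 2 * Nv r * Nr r < 0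

noncomputable section

/-- The radiation field `r φ`. -/
def rad (φ : ℝ × ℝ → ℝ) : ℝ × ℝ → ℝ := fun p => p.2 * φ p

namespace Setting

variable (S : Setting)

/-- `D(r) = 1 - 2M/r`. -/
def D (r : ℝ) : ℝ := 1 - 2 * S.M / r

/-- The future domain `{v ≥ v₀, r ≥ 2M}` of the cone `{v = v₀}`, horizon included. -/
def dom : Set (ℝ × ℝ) := Ici S.v₀ ×ˢ Ici (2 * S.M)

/-- The value of `v` on `Σ₀` at radius `r`. -/
def vSigma (r : ℝ) : ℝ := S.v₀ + ∫ s in (2 * S.M)..r, S.h s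

/-- The tortoise coordinate, `dr*/dr = 1/D`. Its additive constant is chosen so that the outgoing
null part of `Σ₀` is `{u = 0, r ≥ R}`. (Used for `r > 2M` only.) -/
def rstar (r : ℝ) : ℝ := S.vSigma S.R / 2 + ∫ s in S.R..r, (S.D s)⁻¹

/-- The retarded time `u = v - 2 r*`. -/
def u (p : ℝ × ℝ) : ℝ := p.1 - 2 * S.rstar p.2

/-- `X f`, the derivative of the function `f` on the domain along the vector field `X`
(one-sided at the boundary of the domain). -/
def along (X : ℝ × ℝ → ℝ × ℝ) (f : ℝ × ℝ → ℝ) : ℝ × ℝ → ℝ :=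
  fun p => fderivWithin ℝ f S.dom p (X p)

/-- The stationary Killing field `T = ∂_v` in `(v, r)`-coordinates. -/
def T : (ℝ × ℝ → ℝ) → (ℝ × ℝ → ℝ) := S.along fun _ => (1, 0)

/-- `∂_r` in `(v, r)`-coordinates, i.e. at fixed `v`. -/
def drIn : (ℝ × ℝ → ℝ) → (ℝ × ℝ → ℝ) := S.along fun _ => (0, 1)

/-- `∂_u` in double null coordinates `(u, v)`, which is `-(D/2) ∂_r` in `(v, r)`-coordinates. -/
def Lbar : (ℝ × ℝ → ℝ) → (ℝ × ℝ → ℝ) := S.along fun p => (0, -(S.D p.2 / 2))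

/-- `∂_r` in `(u, r)`-coordinates, i.e. at fixed `u`. It equals `(2/D) L`, where
`L = ∂_v + (D/2) ∂_r` (in `(v, r)`-coordinates) is the double null `∂_v`. -/
def drOut : (ℝ × ℝ → ℝ) → (ℝ × ℝ → ℝ) := S.along fun p => (2 / S.D p.2, 1)

/-- The derivative along the red-shift vector field `N`. -/
def N : (ℝ × ℝ → ℝ) → (ℝ × ℝ → ℝ) := S.along fun p => (S.Nv p.2, S.Nr p.2)

/-- The wave operator on spherically symmetric functions,
`□f = |g|^{-1/2} ∂_μ (|g|^{1/2} g^{μν} ∂_ν f)` with `g^{vv} = 0`, `g^{vr} = 1`, `g^{rr} = D`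
and `|g|^{1/2} = r² sin θ`. -/
def box (f : ℝ × ℝ → ℝ) (p : ℝ × ℝ) : ℝ :=
  (p.2 ^ 2)⁻¹ * (S.T (fun q => q.2 ^ 2 * S.drIn f q) p
    + S.drIn (fun q => q.2 ^ 2 * (S.T f q + S.D q.2 * S.drIn f q)) p)

/-- The metric on spherically symmetric vectors at radius `r`. -/
def metric (r : ℝ) (X Y : ℝ × ℝ) : ℝ :=
  -S.D r * X.1 * Y.1 + X.1 * Y.2 + X.2 * Y.1

/-- The energy-momentum tensor `T[f](X, Y) = X f · Y f - ½ g(X, Y) g⁻¹(df, df)` at `p`. -/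
def emTensor (f : ℝ × ℝ → ℝ) (p X Y : ℝ × ℝ) : ℝ :=
  fderivWithin ℝ f S.dom p X * fderivWithin ℝ f S.dom p Y
    - 1 / 2 * S.metric p.2 X Y * (2 * S.T f p * S.drIn f p + S.D p.2 * S.drIn f p ^ 2)

/-- The normal of `Σ₀`, scaled such that `n dμ = normal · r² dr dω` on every part of `Σ₀`.
It is `h ∂_v + (D h - 1) ∂_r`.
On the spacelike part it is orthogonal to the tangent `∂_r + h ∂_v` and has
`g(normal, normal) = -h (2 - D h)`, so that it is `√(h (2 - D h))` times the future unit normal,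
while `dμ = √(h (2 - D h)) r² dr dω`.
For `h = 0` it is `(2/D) ∂_u`, with `|du| = (2/D) dr`; for `h = 2/D` it is `(2/D) L`,
with `dv = (2/D) dr`. -/
def normal (r : ℝ) : ℝ × ℝ := (S.h r, S.D r * S.h r - 1)

/-- `∫_{Σ₀} J^N[f] · n dμ`. The integrand is non-negative. -/
def fluxN (f : ℝ × ℝ → ℝ) : ℝ≥0∞ :=
  ∫⁻ r in Ici (2 * S.M), ENNReal.ofReal
    (4 * Real.pi * r ^ 2 * S.emTensor f (S.vSigma r, r) (S.Nv r, S.Nr r) (S.normal r))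

/-- `∫ r^q f² dr` over the outgoing null part `{u = 0, r ≥ R}` of `Σ₀`. -/
def outerNorm (q : ℝ) (f : ℝ × ℝ → ℝ) : ℝ≥0∞ :=
  ∫⁻ r in Ici S.R, ENNReal.ofReal (r ^ q * f (S.vSigma r, r) ^ 2)

/-- `E^N_k[φ]`. -/
def energyN (k : ℕ) (φ : ℝ × ℝ → ℝ) : ℝ≥0∞ :=
  ∑ i ∈ Finset.range (k + 1), S.fluxN (S.T^[i] φ)

/-- `E^ε_{0, I₀ = 0; k}[φ]`, which is also `E^ε_{0, I₀^log = 0; k}[φ]`. -/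
def energy (ε : ℝ) (k : ℕ) (φ : ℝ × ℝ → ℝ) : ℝ≥0∞ :=
  S.energyN (5 + 3 * k) φ
    + S.outerNorm (5 + 2 * k - ε) (S.drOut^[1 + k] (rad φ))
    + ∑ i ∈ Finset.range (2 * k + 1),
        (S.outerNorm (5 - ε) (S.drOut (S.T^[i] (rad φ)))
          + S.outerNorm (4 - ε) (S.drOut (S.T^[1 + i] (rad φ)))
          + S.outerNorm (3 - ε) (S.drOut (S.T^[2 + i] (rad φ)))
          + S.outerNorm 2 (S.drOut (S.T^[3 + i] (rad φ)))
          + S.outerNorm 1 (S.drOut (S.T^[4 + i] (rad φ))))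
    + ∑ m ∈ Finset.range (k + 1), ∑ i ∈ Finset.range (2 * (k - m) + min k 1 + 1),
        S.outerNorm (4 + 2 * m - ε) (S.drOut^[1 + m] (S.T^[i] (rad φ)))

/-- `Ẽ^ε_{0, I₀ = 0; k}[φ]`, which is also `Ẽ^ε_{0, I₀^log = 0; k}[φ]`. -/
def energyTilde (ε : ℝ) (k : ℕ) (φ : ℝ × ℝ → ℝ) : ℝ≥0∞ :=
  S.energy ε k φ + ∑ i ∈ Finset.range (k + 1), S.fluxN (S.N (S.T^[i] φ))

/-- The limit of `f(r) ∂_r(rφ)` towards future null infinity along the outgoing cone of retarded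
time `u₁` exists and equals `ℓ` (modified Newman-Penrose constant). -/
def HasNPConstant (f : ℝ → ℝ) (φ : ℝ × ℝ → ℝ) (u₁ ℓ : ℝ) : Prop :=
  Tendsto (fun r => f r * S.drOut (rad φ) (u₁ + 2 * S.rstar r, r)) atTop (𝓝 ℓ)

/-- `F = O_k(|1 + u|^{-q})` along the part `u < 0` of the ingoing cone `{v = v₀}`, together with the
first `k` derivatives in `u`; `u = -1`, where `|1 + u|^{-q}` is infinite, is left out. -/
def BigOOnCone (k : ℕ) (q : ℝ) (F : ℝ × ℝ → ℝ) : Prop :=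
  ∃ C : ℝ, ∀ j ≤ k, ∀ r, 2 * S.M < r → S.u (S.v₀, r) < 0 → S.u (S.v₀, r) ≠ -1 →
    |S.Lbar^[j] F (S.v₀, r)| ≤ C * |1 + S.u (S.v₀, r)| ^ (-q - j)

/-- `φ` is a smooth spherically symmetric solution of `□φ = 0` on `{v ≥ v₀}`, up to and including
the event horizon `{r = 2M}`, without incoming radiation from past null infinity and with
`∂_u(rφ) = 2 I / (1+u)² + O_4(|1+u|^{-2-εφ})` for `u < 0` on the cone `{v = v₀}`.
At fixed `v`, `u → -∞` is the same as `r → ∞`. -/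
structure IsScatteringSolution (φ : ℝ × ℝ → ℝ) (I εφ : ℝ) : Prop where
  smooth : ContDiffOn ℝ ∞ φ S.dom
  wave : ∀ p ∈ S.dom, S.box φ p = 0
  data : S.BigOOnCone 4 (2 + εφ) fun p => S.Lbar (rad φ) p - 2 * I / (1 + S.u p) ^ 2
  noIncoming : ∀ v, S.v₀ ≤ v → Tendsto (fun r => rad φ (v, r)) atTop (𝓝 0)

end Setting

end

end Schwarzschild

/-!
The radiation field `ψ = rφ` satisfies `∂_r (L ψ) = M r⁻³ ψ` along the ingoing cones and
`∂_r (∂_u ψ) = -M r⁻³ ψ` along the outgoing ones. In the past of a cone `{u = u₁}` write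
`delay = 1 + u₁ - u`, which is at most a multiple of `r`. The second equation changes `∂_u ψ` by
`O(delay⁻²) sup |ψ|` from its value on the initial cone, and integrating `∂_u ψ` from past null
infinity, where `ψ` vanishes, shows with Grönwall's inequality that `ψ` is bounded, then that
`ψ = O(delay⁻¹)`, and then that `ψ = 2 I / delay + O(delay^{-1-δ})`.

The first equation, integrated from past null infinity, now determines `L ψ`. On `{u = u₁}` the
integral of `r⁻³ · 2 I / delay` along the ingoing cones behaves like `r⁻³ log r`; its coefficient is
isolated by the combination `3 L ψ + (2 r - delay) L L ψ + M I / r³`, which decays faster and is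
essentially `r⁻² ∂_r (r³ L ψ + M I log r)`. Commuting the first equation with `L` gives one more
power of decay in `r` for each further `L`, and `T = L + ∂_u` turns these bounds into the finiteness
of the energies.
-/

namespace Schwarzschild

section RealAnalysis

/-! ### Real analysis -/

variable {α : Type*} {s : Set α} {f f' b B B' F G : ℝ → ℝ} {a x y : ℝ}

lemma abs_sub_le_of_abs_deriv_right_le (hxy : x ≤ y) (hf : ContinuousOn f (Icc x y))
    (hf' : ∀ z ∈ Ico x y, HasDerivWithinAt f (f' z) (Ici z) z)
    (hB : ∀ z ∈ Icc x y, HasDerivAt B (B' z) z) (h : ∀ z ∈ Icc x y, |f' z| ≤ B' z) :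
    |f y - f x| ≤ B y - B x := by
  have hBc : ContinuousOn B (Icc x y) := fun z hz => (hB z hz).continuousAt.continuousWithinAt
  exact image_norm_le_of_norm_deriv_right_le_deriv_boundary' (hf.sub continuousOn_const)
    (fun z hz => (hf' z hz).sub_const (f x)) (by simp) (hBc.sub continuousOn_const)
    (fun z hz => ((hB z (Ico_subset_Icc_self hz)).sub_const (B x)).hasDerivWithinAt)
    (fun z hz => h z (Ico_subset_Icc_self hz)) (right_mem_Icc.2 hxy)

lemma abs_le_of_tendsto_zero (hf : Tendsto f atTop (𝓝 0)) (hb : ∀ y, a ≤ y → 0 ≤ b y)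
    (h : ∀ y, a ≤ y → |f y - f a| ≤ b a - b y) : |f a| ≤ b a := by
  have hlim : Tendsto (fun y => |f y - f a|) atTop (𝓝 |f a|) := by
    simpa using (hf.sub_const (f a)).abs
  refine le_of_tendsto hlim ?_
  filter_upwards [Ici_mem_atTop a] with y hy
  linarith [h y hy, hb y hy]

lemma exists_tendsto_of_abs_sub_le (hb : Tendsto b atTop (𝓝 0))
    (h : ∀ x y, a ≤ x → x ≤ y → |f y - f x| ≤ b x - b y) :
    ∃ l, Tendsto f atTop (𝓝 l) ∧ ∀ x, a ≤ x → |f x - l| ≤ b x := by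
  have hb0 (x : ℝ) (hx : a ≤ x) : 0 ≤ b x := le_of_tendsto hb <| by
    filter_upwards [Ici_mem_atTop x] with y hy
    linarith [(abs_nonneg _).trans (h x y hx hy)]
  have hC : CauchySeq fun x => f (max a x) := by
    refine cauchySeq_of_le_tendsto_0' (fun x => b (max a x)) (fun x y hxy => ?_)
      (hb.comp (tendsto_atTop_mono (le_max_right a) tendsto_id))
    rw [dist_comm, Real.dist_eq]
    linarith [h _ _ (le_max_left a x) (max_le_max_left a hxy), hb0 _ (le_max_left a y)]
  obtain ⟨l, hl⟩ := cauchySeq_tendsto_of_complete hC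
  have hfl : Tendsto f atTop (𝓝 l) := hl.congr' <| by
    filter_upwards [Ici_mem_atTop a] with x hx
    rw [max_eq_right hx]
  refine ⟨l, hfl, fun x hx => ?_⟩
  have hlim : Tendsto (fun y => |f y - f x|) atTop (𝓝 |l - f x|) := (hfl.sub_const _).abs
  rw [abs_sub_comm]
  refine le_of_tendsto hlim ?_
  filter_upwards [Ici_mem_atTop x] with y hy
  linarith [h x y hx hy, hb0 y (hx.trans hy)]

lemma abs_le_of_bootstrap {f w : α → ℝ} {A C : ℝ} (hw : ∀ x ∈ s, 0 < w x)
    (hA : ∀ x ∈ s, |f x| ≤ A * w x)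
    (hstep : ∀ B ≥ 0, (∀ x ∈ s, |f x| ≤ B * w x) → ∀ x ∈ s, |f x| ≤ (C + B / 2) * w x) :
    ∀ x ∈ s, |f x| ≤ 2 * C * w x := by
  intro x hx
  set σ := sSup ((fun y => |f y| / w y) '' s)
  have hbdd : BddAbove ((fun y => |f y| / w y) '' s) := by
    refine ⟨A, ?_⟩
    rintro _ ⟨y, hy, rfl⟩
    exact (div_le_iff₀ (hw y hy)).2 (hA y hy)
  have hle (y : α) (hy : y ∈ s) : |f y| / w y ≤ σ := le_csSup hbdd (mem_image_of_mem _ hy)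
  have hσ0 : 0 ≤ σ := (div_nonneg (abs_nonneg _) (hw x hx).le).trans (hle x hx)
  have himproved : σ ≤ C + σ / 2 := by
    refine csSup_le ⟨_, mem_image_of_mem _ hx⟩ ?_
    rintro _ ⟨y, hy, rfl⟩
    exact (div_le_iff₀ (hw y hy)).2
      (hstep σ hσ0 (fun z hz => (div_le_iff₀ (hw z hz)).1 (hle z hz)) y hy)
  exact (div_le_iff₀ (hw x hx)).1 ((hle x hx).trans (by linarith))

lemma exists_abs_le_mul_of_isBigO (hF : ContinuousOn F (Ici a)) (hG : ContinuousOn G (Ici a))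
    (hpos : ∀ x ∈ Ici a, 0 < G x) (h : F =O[atTop] G) :
    ∃ C, 0 ≤ C ∧ ∀ x ∈ Ici a, |F x| ≤ C * G x := by
  obtain ⟨C₁, hC₁, hb₁⟩ := h.exists_nonneg
  obtain ⟨b, hb⟩ := eventually_atTop.1 hb₁.bound
  obtain ⟨C₂, hC₂⟩ := isCompact_Icc.exists_bound_of_continuousOn
    ((hF.div hG fun x hx => (hpos x hx).ne').mono (Icc_subset_Ici_self : Icc a b ⊆ Ici a))
  refine ⟨max C₁ C₂, hC₁.trans (le_max_left _ _), fun x hx => ?_⟩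
  have hGx := hpos x hx
  rcases le_total b x with hbx | hxb
  · calc |F x| ≤ C₁ * ‖G x‖ := hb x hbx
      _ = C₁ * G x := by rw [Real.norm_of_nonneg hGx.le]
      _ ≤ _ := by gcongr; exact le_max_left _ _
  · have hdiv : |F x / G x| ≤ C₂ := hC₂ x ⟨hx, hxb⟩
    rw [abs_div, abs_of_pos hGx, div_le_iff₀ hGx] at hdiv
    exact hdiv.trans (by gcongr; exact le_max_right _ _)

lemma hasDerivAt_neg_div_sq (c : ℝ) (hx : x ≠ 0) :
    HasDerivAt (fun x => -(c / (2 * x ^ 2))) (c / x ^ 3) x := by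
  have h := ((hasDerivAt_const x c).div ((hasDerivAt_pow 2 x).const_mul 2) (by positivity)).neg
  refine h.congr_deriv ?_
  push_cast
  field_simp
  ring

lemma hasDerivAt_const_div (c : ℝ) (hx : x ≠ 0) :
    HasDerivAt (fun x => c / x) (-(c / x ^ 2)) x := by
  simpa [div_eq_mul_inv] using (hasDerivAt_inv hx).const_mul c

lemma hasDerivAt_mul_rpow_neg (c : ℝ) {η : ℝ} (hη : η ≠ 0) (hx : x ≠ 0) :
    HasDerivAt (fun x => c / η * x ^ (-η)) (-(c * x ^ (-η - 1))) x :=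
  ((Real.hasDerivAt_rpow_const (p := -η) (Or.inl hx)).const_mul (c / η)).congr_deriv
    (by field_simp)

lemma hasDerivAt_const_div_pow (c : ℝ) (n : ℕ) (hx : x ≠ 0) :
    HasDerivAt (fun x => c / x ^ n) (-(n * c) / x ^ (n + 1)) x := by
  have h := ((hasDerivAt_pow n x).inv (pow_ne_zero n hx)).const_mul c
  simp only [Pi.inv_apply, ← div_eq_mul_inv] at h
  refine h.congr_deriv ?_
  rcases n with - | n
  · simp
  · rw [Nat.add_sub_cancel]
    field_simp
    ring

lemma rpow_le_const_mul_rpow {q q' : ℝ} (ha : 0 < a) (hax : a ≤ x) (hq : q ≤ q') :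
    x ^ q ≤ a ^ (q - q') * x ^ q' := by
  have hx : 0 < x := ha.trans_le hax
  calc x ^ q = x ^ (q - q') * x ^ q' := by rw [← Real.rpow_add hx]; ring_nf
    _ ≤ _ := by
      gcongr ?_ * _
      exact Real.rpow_le_rpow_of_nonpos ha hax (by linarith)

lemma abs_one_div_sq_sub_le {c d : ℝ} (hd : 0 < d) (hc : 2 * |c| ≤ d) :
    |1 / (c - d) ^ 2 - 1 / d ^ 2| ≤ 12 * |c| / d ^ 3 := by
  obtain ⟨hc₁, hc₂⟩ := abs_le.1 (show |c| ≤ d / 2 by linarith)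
  have hsq : (d / 2) ^ 2 ≤ (c - d) ^ 2 := by nlinarith
  have hne : c - d ≠ 0 := by linarith
  calc |1 / (c - d) ^ 2 - 1 / d ^ 2| = |c * (2 * d - c) / ((c - d) ^ 2 * d ^ 2)| := by
        congr 1; field_simp; ring
    _ = |c| * |2 * d - c| / ((c - d) ^ 2 * d ^ 2) := by
        rw [abs_div, abs_mul, abs_of_nonneg (by positivity : 0 ≤ (c - d) ^ 2 * d ^ 2)]
    _ ≤ |c| * (3 * d) / ((d / 2) ^ 2 * d ^ 2) := by
        gcongr
        rw [abs_of_nonneg (by linarith)]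
        linarith
    _ = 12 * |c| / d ^ 3 := by field_simp; ring

lemma lintegral_Ioi_ofReal_lt_top_of_le_rpow {F : ℝ → ℝ} {a C s : ℝ} (ha : 0 < a) (hs : s < -1)
    (h : ∀ r, a < r → F r ≤ C * r ^ s) : ∫⁻ r in Ioi a, ENNReal.ofReal (F r) < ⊤ :=
  (setLIntegral_mono' measurableSet_Ioi fun r hr => ENNReal.ofReal_le_ofReal (h r hr)).trans_lt
    ((integrableOn_Ioi_rpow_of_lt hs ha).const_mul C).lintegral_lt_top

lemma abs_mul_of_pos_left {k : ℝ} (hk : 0 < k) (y : ℝ) : |k * y| = k * |y| := by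
  rw [abs_mul, abs_of_pos hk]

lemma PiecewiseSmoothOn.exists_finset_continuousOn {h : ℝ → ℝ} {a b : ℝ}
    (hh : PiecewiseSmoothOn h a b) : ∃ s : Finset ℝ, ContinuousOn h (Ioo a b \ s) := by
  obtain ⟨s, ha, hb, hs⟩ := hh
  refine ⟨s, fun z hz => ContinuousAt.continuousWithinAt ?_⟩
  have hl : (s.filter (· < z)).Nonempty := ⟨a, Finset.mem_filter.2 ⟨ha, hz.1.1⟩⟩
  have hu : (s.filter (z < ·)).Nonempty := ⟨b, Finset.mem_filter.2 ⟨hb, hz.1.2⟩⟩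
  obtain ⟨hxs, hxz⟩ := Finset.mem_filter.1 (Finset.max'_mem _ hl)
  obtain ⟨hys, hzy⟩ := Finset.mem_filter.1 (Finset.min'_mem _ hu)
  obtain ⟨g, hg, hgh⟩ := hs _ hxs _ hys (hxz.trans hzy) fun t ht ⟨hxt, hty⟩ => by
    rcases lt_trichotomy t z with htz | rfl | hzt
    · exact (Finset.le_max' _ t (Finset.mem_filter.2 ⟨ht, htz⟩)).not_gt hxt
    · exact hz.2 ht
    · exact (Finset.min'_le _ t (Finset.mem_filter.2 ⟨ht, hzt⟩)).not_gt hty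
  refine hg.continuous.continuousAt.congr ?_
  filter_upwards [Ioo_mem_nhds hxz hzy] with t ht
  exact (hgh t ht).symm

lemma PiecewiseSmoothOn.aestronglyMeasurable {h : ℝ → ℝ} {a b : ℝ} (hh : PiecewiseSmoothOn h a b) :
    AEStronglyMeasurable h (volume.restrict (Ioo a b)) := by
  obtain ⟨s, hs⟩ := hh.exists_finset_continuousOn
  have hae : (Ioo a b \ s : Set ℝ) =ᵐ[volume] Ioo a b :=
    sdiff_null_ae_eq_self (s.finite_toSet.measure_zero _)
  rw [← Measure.restrict_congr_set hae]
  exact hs.aestronglyMeasurable (measurableSet_Ioo.diff s.measurableSet)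

end RealAnalysis

noncomputable section

namespace Setting

section Calculus

/-! ### Calculus on the exterior of the horizon -/

variable (S : Setting)

/-- The part `{v ≥ v₀, r > 2M}` of the domain outside the horizon. The analysis takes place here,
because `L` and `∂_u` are related to `∂_r` by factors `D` and `1 / D`. -/
def exterior : Set (ℝ × ℝ) := Ici S.v₀ ×ˢ Ioi (2 * S.M)

/-- Smoothness outside the horizon, up to the boundary `{v = v₀}`. -/
abbrev IsSmooth (f : ℝ × ℝ → ℝ) : Prop := ContDiffOn ℝ ∞ f S.exterior

/-- The double null derivative `L = ∂_v + (D/2) ∂_r`, written in `(v, r)`-coordinates. -/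
def L : (ℝ × ℝ → ℝ) → (ℝ × ℝ → ℝ) := S.along fun p => (1, S.D p.2 / 2)

variable {S} {f g : ℝ × ℝ → ℝ} {p : ℝ × ℝ} {X : ℝ × ℝ → ℝ × ℝ} {k : ℝ → ℝ} {k' r : ℝ}

lemma exterior_subset_dom : S.exterior ⊆ S.dom := prod_mono subset_rfl Ioi_subset_Ici_self

lemma uniqueDiffOn_exterior : UniqueDiffOn ℝ S.exterior :=
  (uniqueDiffOn_Ici _).prod (uniqueDiffOn_Ioi _)

lemma uniqueDiffOn_dom : UniqueDiffOn ℝ S.dom := (uniqueDiffOn_Ici _).prod (uniqueDiffOn_Ici _)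

lemma mem_closure_interior_exterior (hp : p ∈ S.exterior) :
    p ∈ closure (interior S.exterior) := by
  rw [exterior, interior_prod_eq, interior_Ici, interior_Ioi, closure_prod_eq, closure_Ioi,
    closure_Ioi]
  exact ⟨hp.1, Ioi_subset_Ici_self hp.2⟩

lemma dom_eventuallyEq_exterior (hp : p ∈ S.exterior) : S.dom =ᶠ[𝓝 p] S.exterior := by
  have h : ∀ᶠ q : ℝ × ℝ in 𝓝 p, 2 * S.M < q.2 :=
    continuous_snd.continuousAt.eventually (lt_mem_nhds hp.2)
  filter_upwards [h] with q hq
  exact propext ⟨fun hd => ⟨hd.1, hq⟩, fun hd => exterior_subset_dom hd⟩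

lemma pos_of_two_M_le (hr : 2 * S.M ≤ r) : 0 < r := by linarith [S.M_pos]

lemma pos_of_two_M_lt (hr : 2 * S.M < r) : 0 < r := pos_of_two_M_le hr.le

lemma pos_of_mem (hp : p ∈ S.exterior) : 0 < p.2 := pos_of_two_M_lt hp.2

lemma D_pos (hr : 2 * S.M < r) : 0 < S.D r :=
  sub_pos.2 ((div_lt_one (pos_of_two_M_lt hr)).2 hr)

lemma D_le_one (hr : 0 < r) : S.D r ≤ 1 := by
  have : 0 ≤ 2 * S.M / r := by have := S.M_pos; positivity
  simpa [D] using this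

lemma hasDerivAt_D (hr : r ≠ 0) : HasDerivAt S.D (2 * S.M / r ^ 2) r := by
  have h := ((hasDerivAt_inv hr).const_mul (2 * S.M)).const_sub 1
  exact h.congr_deriv (by ring)

lemma contDiffOn_D : ContDiffOn ℝ ∞ S.D (Ioi (2 * S.M)) :=
  contDiffOn_const.sub (contDiffOn_const.div contDiffOn_id fun _ hr => (pos_of_two_M_lt hr).ne')

lemma contDiffOn_const_div_pow (c : ℝ) (n : ℕ) :
    ContDiffOn ℝ ∞ (fun r => c / r ^ n) (Ioi (2 * S.M)) :=
  contDiffOn_const.div (by fun_prop) fun _ hr => pow_ne_zero _ (pos_of_two_M_lt hr).ne'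

lemma along_eq_fderivWithin_exterior (hp : p ∈ S.exterior) :
    S.along X f p = fderivWithin ℝ f S.exterior p (X p) := by
  rw [along, fderivWithin_congr_set (dom_eventuallyEq_exterior hp)]

lemma along_eq (X : ℝ × ℝ → ℝ × ℝ) (f : ℝ × ℝ → ℝ) (p : ℝ × ℝ) :
    S.along X f p = (X p).1 * S.T f p + (X p).2 * S.drIn f p := by
  have h : X p = (X p).1 • ((1 : ℝ), (0 : ℝ)) + (X p).2 • ((0 : ℝ), (1 : ℝ)) := by
    ext <;> simp
  simp only [T, drIn, along]
  conv_lhs => rw [h]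
  rw [map_add, map_smul, map_smul, smul_eq_mul, smul_eq_mul]

lemma L_eq (f : ℝ × ℝ → ℝ) (p : ℝ × ℝ) : S.L f p = S.T f p + S.D p.2 / 2 * S.drIn f p := by
  rw [L, along_eq, one_mul]

lemma Lbar_eq (f : ℝ × ℝ → ℝ) (p : ℝ × ℝ) : S.Lbar f p = -(S.D p.2 / 2) * S.drIn f p := by
  rw [Lbar, along_eq, zero_mul, zero_add]

lemma L_eq_T_sub_Lbar (f : ℝ × ℝ → ℝ) (p : ℝ × ℝ) : S.L f p = S.T f p - S.Lbar f p := by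
  rw [L_eq, Lbar_eq]; ring

lemma T_eq_L_add_Lbar (f : ℝ × ℝ → ℝ) (p : ℝ × ℝ) : S.T f p = S.L f p + S.Lbar f p := by
  rw [L_eq_T_sub_Lbar]; ring

lemma drOut_eq_L (hp : p ∈ S.exterior) : S.drOut f p = 2 / S.D p.2 * S.L f p := by
  rw [drOut, along_eq, L_eq]
  have := (D_pos hp.2).ne'
  field_simp

lemma drIn_eq_Lbar (hp : p ∈ S.exterior) : S.drIn f p = -(2 / S.D p.2) * S.Lbar f p := by
  rw [Lbar_eq]
  have := (D_pos hp.2).ne'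
  field_simp

lemma along_congr (h : EqOn f g S.exterior) : EqOn (S.along X f) (S.along X g) S.exterior := by
  intro p hp
  rw [along_eq_fderivWithin_exterior hp, along_eq_fderivWithin_exterior hp,
    fderivWithin_congr h (h hp)]

lemma IsSmooth.differentiableWithinAt (hf : S.IsSmooth f) (hp : p ∈ S.exterior) :
    DifferentiableWithinAt ℝ f S.exterior p :=
  (ContDiffOn.differentiableOn hf (by simp)) p hp

lemma along_add (hf : S.IsSmooth f) (hg : S.IsSmooth g) (hp : p ∈ S.exterior) :
    S.along X (fun q => f q + g q) p = S.along X f p + S.along X g p := by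
  simp only [along_eq_fderivWithin_exterior hp]
  rw [fderivWithin_fun_add (uniqueDiffOn_exterior p hp) (hf.differentiableWithinAt hp)
    (hg.differentiableWithinAt hp)]
  rfl

lemma along_sub (hf : S.IsSmooth f) (hg : S.IsSmooth g) (hp : p ∈ S.exterior) :
    S.along X (fun q => f q - g q) p = S.along X f p - S.along X g p := by
  simp only [along_eq_fderivWithin_exterior hp]
  rw [fderivWithin_fun_sub (uniqueDiffOn_exterior p hp) (hf.differentiableWithinAt hp)
    (hg.differentiableWithinAt hp)]
  rfl

lemma along_mul (hf : S.IsSmooth f) (hg : S.IsSmooth g) (hp : p ∈ S.exterior) :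
    S.along X (fun q => f q * g q) p = S.along X f p * g p + f p * S.along X g p := by
  simp only [along_eq_fderivWithin_exterior hp]
  rw [fderivWithin_fun_mul (uniqueDiffOn_exterior p hp) (hf.differentiableWithinAt hp)
    (hg.differentiableWithinAt hp)]
  simp only [add_apply, smul_apply, smul_eq_mul]
  ring

lemma drIn_add (hf : S.IsSmooth f) (hg : S.IsSmooth g) (hp : p ∈ S.exterior) :
    S.drIn (fun q => f q + g q) p = S.drIn f p + S.drIn g p := along_add hf hg hp

lemma drIn_sub (hf : S.IsSmooth f) (hg : S.IsSmooth g) (hp : p ∈ S.exterior) :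
    S.drIn (fun q => f q - g q) p = S.drIn f p - S.drIn g p := along_sub hf hg hp

lemma along_radial (hp : p ∈ S.exterior) (hk : HasDerivAt k k' p.2) :
    S.along X (fun q => k q.2) p = (X p).2 * k' := by
  have h := (hk.hasFDerivAt.comp p hasFDerivAt_snd).hasFDerivWithinAt (s := S.exterior)
  rw [along_eq_fderivWithin_exterior hp]
  change fderivWithin ℝ (k ∘ Prod.snd) S.exterior p (X p) = _
  rw [h.fderivWithin (uniqueDiffOn_exterior p hp)]
  simp [mul_comm]

lemma isSmooth_radial (hk : ContDiffOn ℝ ∞ k (Ioi (2 * S.M))) : S.IsSmooth fun p => k p.2 :=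
  hk.comp contDiffOn_snd fun _ hp => hp.2

lemma along_radial_mul (hk : ContDiffOn ℝ ∞ k (Ioi (2 * S.M))) (hg : S.IsSmooth g)
    (hp : p ∈ S.exterior) (hk' : HasDerivAt k k' p.2) :
    S.along X (fun q => k q.2 * g q) p = (X p).2 * k' * g p + k p.2 * S.along X g p := by
  rw [along_mul (isSmooth_radial hk) hg hp, along_radial hp hk']

lemma T_radial_mul (hk : ContDiffOn ℝ ∞ k (Ioi (2 * S.M))) (hg : S.IsSmooth g)
    (hp : p ∈ S.exterior) : S.T (fun q => k q.2 * g q) p = k p.2 * S.T g p := by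
  have hd : HasDerivAt k (deriv k p.2) p.2 :=
    ((hk.differentiableOn (by simp)).differentiableAt (Ioi_mem_nhds hp.2)).hasDerivAt
  rw [T, along_radial_mul hk hg hp hd, zero_mul, zero_mul, zero_add]

lemma drIn_radial_mul (hk : ContDiffOn ℝ ∞ k (Ioi (2 * S.M)))
    (hg : S.IsSmooth g) (hp : p ∈ S.exterior) (hk' : HasDerivAt k k' p.2) :
    S.drIn (fun q => k q.2 * g q) p = k' * g p + k p.2 * S.drIn g p := by
  rw [drIn, along_radial_mul hk hg hp hk', one_mul]

lemma IsSmooth.along (hX : ContDiffOn ℝ ∞ X S.exterior) (hf : S.IsSmooth f) :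
    S.IsSmooth (S.along X f) :=
  ((hf.fderivWithin uniqueDiffOn_exterior (by simp)).clm_apply hX).congr
    fun _ hp => along_eq_fderivWithin_exterior hp

lemma IsSmooth.T (hf : S.IsSmooth f) : S.IsSmooth (S.T f) := hf.along contDiffOn_const

lemma IsSmooth.drIn (hf : S.IsSmooth f) : S.IsSmooth (S.drIn f) := hf.along contDiffOn_const

lemma IsSmooth.L (hf : S.IsSmooth f) : S.IsSmooth (S.L f) :=
  hf.along (contDiffOn_const.prodMk ((isSmooth_radial contDiffOn_D).div_const 2))

lemma IsSmooth.Lbar (hf : S.IsSmooth f) : S.IsSmooth (S.Lbar f) :=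
  hf.along (contDiffOn_const.prodMk ((isSmooth_radial contDiffOn_D).div_const 2).neg)

lemma IsSmooth.rad (hf : S.IsSmooth f) : S.IsSmooth (rad f) := contDiffOn_snd.mul hf

lemma IsSmooth.iterate_L (hf : S.IsSmooth f) (n : ℕ) : S.IsSmooth (S.L^[n] f) := by
  induction n with
  | zero => exact hf
  | succ n ih => rw [Function.iterate_succ_apply']; exact ih.L

lemma IsSmooth.iterate_T (hf : S.IsSmooth f) (n : ℕ) : S.IsSmooth (S.T^[n] f) := by
  induction n with
  | zero => exact hf
  | succ n ih => rw [Function.iterate_succ_apply']; exact ih.T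

lemma T_drIn (hf : S.IsSmooth f) (hp : p ∈ S.exterior) :
    S.T (S.drIn f) p = S.drIn (S.T f) p := by
  have hsymm : IsSymmSndFDerivWithinAt ℝ f S.exterior p :=
    (hf p hp).isSymmSndFDerivWithinAt (by simpa using ENat.LEInfty.out) uniqueDiffOn_exterior
      (mem_closure_interior_exterior hp) hp
  have hdiff : DifferentiableWithinAt ℝ (fderivWithin ℝ f S.exterior) S.exterior p :=
    ((hf.fderivWithin uniqueDiffOn_exterior (m := ∞) (by simp)).differentiableOn (by simp)) p hp
  have hsnd (a b : ℝ × ℝ) : S.along (fun _ => a) (S.along (fun _ => b) f) p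
      = fderivWithin ℝ (fderivWithin ℝ f S.exterior) S.exterior p a b := by
    rw [along_eq_fderivWithin_exterior hp,
      fderivWithin_congr (fun q hq => along_eq_fderivWithin_exterior hq)
        (along_eq_fderivWithin_exterior hp),
      fderivWithin_clm_apply (uniqueDiffOn_exterior p hp) hdiff (differentiableWithinAt_const _)]
    simp
  simp only [T, drIn]
  rw [hsnd, hsnd]
  exact hsymm.eq _ _

lemma T_Lbar (hf : S.IsSmooth f) (hp : p ∈ S.exterior) :
    S.T (S.Lbar f) p = S.Lbar (S.T f) p := by
  have h : S.T (S.Lbar f) p = S.T (fun q => -(S.D q.2 / 2) * S.drIn f q) p :=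
    along_congr (fun q _ => Lbar_eq f q) hp
  rw [h, T_radial_mul (contDiffOn_D.div_const 2).neg hf.drIn hp, T_drIn hf hp, Lbar_eq]

lemma T_L (hf : S.IsSmooth f) (hp : p ∈ S.exterior) : S.T (S.L f) p = S.L (S.T f) p := by
  have h : S.T (S.L f) p = S.T (fun q => S.T f q - S.Lbar f q) p :=
    along_congr (fun q _ => L_eq_T_sub_Lbar f q) hp
  rw [h, L_eq_T_sub_Lbar, ← T_Lbar hf hp]
  exact along_sub hf.T hf.Lbar hp

lemma Lbar_L (hf : S.IsSmooth f) (hp : p ∈ S.exterior) :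
    S.Lbar (S.L f) p = S.L (S.Lbar f) p := by
  have h : S.Lbar (S.L f) p = S.Lbar (fun q => S.T f q - S.Lbar f q) p :=
    along_congr (fun q _ => L_eq_T_sub_Lbar f q) hp
  rw [h, L_eq_T_sub_Lbar, T_Lbar hf hp]
  exact along_sub hf.T hf.Lbar hp

lemma Lbar_iterate_L (hf : S.IsSmooth f) (n : ℕ) (hp : p ∈ S.exterior) :
    S.Lbar (S.L^[n] f) p = S.L^[n] (S.Lbar f) p := by
  induction n generalizing p with
  | zero => rfl
  | succ n ih =>
    rw [Function.iterate_succ_apply', Lbar_L (hf.iterate_L n) hp, Function.iterate_succ_apply']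
    exact along_congr (fun q hq => ih hq) hp

lemma along_rad (hf : S.IsSmooth f) (hp : p ∈ S.exterior) :
    S.along X (rad f) p = (X p).2 * f p + p.2 * S.along X f p := by
  have h := along_radial_mul (X := X) contDiffOn_id hf hp (hasDerivAt_id _)
  rwa [mul_one] at h

lemma drIn_rad (hf : S.IsSmooth f) (hp : p ∈ S.exterior) :
    S.drIn (rad f) p = f p + p.2 * S.drIn f p := by
  rw [drIn, along_rad hf hp, one_mul]

lemma iterate_T_rad (hf : S.IsSmooth f) (n : ℕ) :
    EqOn (S.T^[n] (rad f)) (rad (S.T^[n] f)) S.exterior := by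
  induction n with
  | zero => exact fun _ _ => rfl
  | succ n ih =>
    intro p hp
    rw [Function.iterate_succ_apply', Function.iterate_succ_apply']
    exact (along_congr ih hp).trans (T_radial_mul contDiffOn_id (hf.iterate_T n) hp)

end Calculus

section Wave

/-! ### The radial wave equation -/

variable {S : Setting} {f : ℝ × ℝ → ℝ} {p : ℝ × ℝ}

variable (S) in
/-- The equation `∂_r (L ψ) = M r⁻³ ψ` outside the horizon. It is the wave equation `□φ = 0` of a
spherically symmetric `φ` in terms of its radiation field `ψ = r φ`, read as a transport equation
for `L ψ` along the ingoing cones. -/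
def IsWave (ψ : ℝ × ℝ → ℝ) : Prop :=
  ∀ p ∈ S.exterior, S.drIn (S.L ψ) p = S.M / p.2 ^ 3 * ψ p

lemma box_eq (hf : S.IsSmooth f) (hp : p ∈ S.exterior) :
    S.box f p = 2 * S.drIn (S.L f) p + 2 / p.2 * (S.L f p + S.D p.2 / 2 * S.drIn f p) := by
  have hr := (pos_of_mem hp).ne'
  have hsq : ContDiffOn ℝ ∞ (fun r : ℝ => r ^ 2) (Ioi (2 * S.M)) := contDiffOn_id.pow 2
  have hT : S.T (fun q => q.2 ^ 2 * S.drIn f q) p = p.2 ^ 2 * S.T (S.drIn f) p :=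
    T_radial_mul hsq hf.drIn hp
  have hin : S.drIn (fun q => q.2 ^ 2 * (S.T f q + S.D q.2 * S.drIn f q)) p
      = 2 * p.2 * (2 * S.L f p - S.T f p)
        + p.2 ^ 2 * (2 * S.drIn (S.L f) p - S.drIn (S.T f) p) := by
    have h : (fun q : ℝ × ℝ => q.2 ^ 2 * (S.T f q + S.D q.2 * S.drIn f q))
        = fun q => q.2 ^ 2 * (S.L f q + (S.L f q - S.T f q)) := by
      funext q; rw [L_eq]; ring
    rw [h, drIn_radial_mul hsq (hf.L.add (hf.L.sub hf.T)) hp (hasDerivAt_pow 2 p.2),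
      drIn_add hf.L (hf.L.sub hf.T) hp, drIn_sub hf.L hf.T hp]
    simp only [Nat.cast_ofNat, Nat.add_one_sub_one, pow_one]
    ring
  rw [box, hT, hin, T_drIn hf hp, L_eq]
  field_simp
  ring

lemma drIn_L_rad (hf : S.IsSmooth f) (hp : p ∈ S.exterior) :
    S.drIn (S.L (rad f)) p = p.2 / 2 * S.box f p + S.M / p.2 ^ 3 * rad f p := by
  have hr := (pos_of_mem hp).ne'
  have hD : HasDerivAt (fun r => S.D r / 2) (S.M / p.2 ^ 2) p.2 :=
    ((hasDerivAt_D hr).div_const 2).congr_deriv (by ring)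
  have hDs : ContDiffOn ℝ ∞ (fun r => S.D r / 2) (Ioi (2 * S.M)) := contDiffOn_D.div_const 2
  have h : S.drIn (S.L (rad f)) p = S.drIn (fun q => S.D q.2 / 2 * f q + rad (S.L f) q) p :=
    along_congr (fun q hq => along_rad hf hq) hp
  rw [h, drIn_add ((isSmooth_radial hDs).mul hf) hf.L.rad hp, drIn_radial_mul hDs hf hp hD,
    drIn_rad hf.L hp, box_eq hf hp, rad]
  field_simp
  ring

lemma isWave_rad (hf : S.IsSmooth f) (h : ∀ p ∈ S.exterior, S.box f p = 0) :
    S.IsWave (rad f) := fun p hp => by rw [drIn_L_rad hf hp, h p hp, mul_zero, zero_add]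

lemma IsWave.T (hf : S.IsSmooth f) (h : S.IsWave f) : S.IsWave (S.T f) := by
  intro p hp
  calc S.drIn (S.L (S.T f)) p
      = S.drIn (S.T (S.L f)) p := (along_congr (fun q hq => T_L hf hq) hp).symm
    _ = S.T (S.drIn (S.L f)) p := (T_drIn hf.L hp).symm
    _ = S.T (fun q => S.M / q.2 ^ 3 * f q) p := along_congr h hp
    _ = S.M / p.2 ^ 3 * S.T f p := T_radial_mul (contDiffOn_const_div_pow _ _) hf hp

lemma IsWave.iterate_T (hf : S.IsSmooth f) (h : S.IsWave f) (n : ℕ) : S.IsWave (S.T^[n] f) := by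
  induction n with
  | zero => exact h
  | succ n ih => rw [Function.iterate_succ_apply']; exact ih.T (hf.iterate_T n)

lemma IsWave.Lbar_L (h : S.IsWave f) (hp : p ∈ S.exterior) :
    S.Lbar (S.L f) p = -(S.D p.2 / 2 * (S.M / p.2 ^ 3)) * f p := by
  rw [Lbar_eq, h p hp]
  ring

lemma IsWave.drOut_Lbar (hf : S.IsSmooth f) (h : S.IsWave f) (hp : p ∈ S.exterior) :
    S.drOut (S.Lbar f) p = -(S.M / p.2 ^ 3) * f p := by
  have := (D_pos hp.2).ne'
  rw [drOut_eq_L hp, ← Setting.Lbar_L hf hp, h.Lbar_L hp]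
  field_simp

end Wave

section Tortoise

/-! ### The tortoise coordinate -/

variable {S : Setting} {r r₁ r₂ x : ℝ}

lemma two_M_lt_R : 2 * S.M < S.R := by linarith [S.lt_R, S.M_pos]

lemma R_pos : 0 < S.R := pos_of_two_M_lt two_M_lt_R

lemma hasDerivAt_add_log (hr : 2 * S.M < r) :
    HasDerivAt (fun x => x + 2 * S.M * Real.log (x - 2 * S.M)) (S.D r)⁻¹ r := by
  have hr0 := pos_of_two_M_lt hr
  have hsub : r - 2 * S.M ≠ 0 := by linarith
  have hD : S.D r = (r - 2 * S.M) / r := by rw [D]; field_simp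
  refine ((hasDerivAt_id r).add
    ((((hasDerivAt_id r).sub_const (2 * S.M)).log hsub).const_mul (2 * S.M))).congr_deriv ?_
  rw [hD, id]
  field_simp
  ring

lemma exists_rstar_eq_add_log (S : Setting) :
    ∃ c, ∀ r, 2 * S.M < r → S.rstar r = c + (r + 2 * S.M * Real.log (r - 2 * S.M)) := by
  refine ⟨S.vSigma S.R / 2 - (S.R + 2 * S.M * Real.log (S.R - 2 * S.M)), fun r hr => ?_⟩
  have hlt (x : ℝ) (hx : x ∈ uIcc S.R r) : 2 * S.M < x := (lt_min two_M_lt_R hr).trans_le hx.1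
  have hc : ContinuousOn (fun x => (S.D x)⁻¹) (uIcc S.R r) :=
    (contDiffOn_D.continuousOn.mono hlt).inv₀ fun x hx => (D_pos (hlt x hx)).ne'
  rw [rstar, intervalIntegral.integral_eq_sub_of_hasDerivAt
    (fun x hx => hasDerivAt_add_log (hlt x hx)) hc.intervalIntegrable]
  ring

lemma hasDerivAt_rstar (hr : 2 * S.M < r) : HasDerivAt S.rstar (S.D r)⁻¹ r := by
  obtain ⟨c, hc⟩ := exists_rstar_eq_add_log S
  refine ((hasDerivAt_add_log hr).const_add c).congr_of_eventuallyEq ?_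
  filter_upwards [Ioi_mem_nhds hr] with x hx using hc x hx

lemma continuousOn_rstar : ContinuousOn S.rstar (Ioi (2 * S.M)) := fun _ hr =>
  (hasDerivAt_rstar hr).continuousAt.continuousWithinAt

lemma strictMonoOn_rstar : StrictMonoOn S.rstar (Ioi (2 * S.M)) := by
  refine strictMonoOn_of_deriv_pos (convex_Ioi _) continuousOn_rstar fun r hr => ?_
  rw [interior_Ioi] at hr
  rw [(hasDerivAt_rstar hr).deriv]
  exact inv_pos.2 (D_pos hr)

lemma tendsto_rstar_atTop : Tendsto S.rstar atTop atTop := by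
  have hlog : Tendsto (fun r => Real.log (r - 2 * S.M)) atTop atTop :=
    Real.tendsto_log_atTop.comp (tendsto_atTop_add_const_right _ _ tendsto_id)
  obtain ⟨c, hc⟩ := exists_rstar_eq_add_log S
  refine (tendsto_atTop_add_const_left _ c (tendsto_id.atTop_add_atTop
    (hlog.const_mul_atTop (mul_pos two_pos S.M_pos)))).congr' ?_
  filter_upwards [Ioi_mem_atTop (2 * S.M)] with r hr using (hc r hr).symm

lemma tendsto_rstar_atBot : Tendsto S.rstar (𝓝[>] (2 * S.M)) atBot := by
  have hsub : Tendsto (fun r => r - 2 * S.M) (𝓝[>] (2 * S.M)) (𝓝[>] 0) := by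
    refine tendsto_nhdsWithin_iff.2 ⟨?_, ?_⟩
    · have h : Tendsto (fun r => r - 2 * S.M) (𝓝 (2 * S.M)) (𝓝 (2 * S.M - 2 * S.M)) :=
        tendsto_id.sub_const _
      rw [sub_self] at h
      exact h.mono_left nhdsWithin_le_nhds
    · filter_upwards [self_mem_nhdsWithin] with r hr using sub_pos.2 (mem_Ioi.1 hr)
  have hlog : Tendsto (fun r => 2 * S.M * Real.log (r - 2 * S.M)) (𝓝[>] (2 * S.M)) atBot :=
    (Real.tendsto_log_nhdsGT_zero.comp hsub).const_mul_atBot (mul_pos two_pos S.M_pos)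
  have hid : Tendsto (fun r : ℝ => r) (𝓝[>] (2 * S.M)) (𝓝 (2 * S.M)) := nhdsWithin_le_nhds
  obtain ⟨c, hc⟩ := exists_rstar_eq_add_log S
  refine ((tendsto_const_nhds (x := c)).add_atBot (hid.add_atBot hlog)).congr' ?_
  filter_upwards [self_mem_nhdsWithin] with r hr using (hc r hr).symm

lemma exists_rstar_eq (S : Setting) (x : ℝ) : ∃ r, 2 * S.M < r ∧ S.rstar r = x :=
  isPreconnected_Ioi.intermediate_value_Iii (l₁ := 𝓝[>] (2 * S.M)) inf_le_right
    (le_principal_iff.2 (Ioi_mem_atTop (2 * S.M))) continuousOn_rstar tendsto_rstar_atBot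
    tendsto_rstar_atTop (mem_univ x)

variable (S) in
/-- The inverse `r*⁻¹ : ℝ → (2M, ∞)` of the tortoise coordinate. -/
def radius (x : ℝ) : ℝ := (exists_rstar_eq S x).choose

lemma two_M_lt_radius (S : Setting) (x : ℝ) : 2 * S.M < S.radius x :=
  (exists_rstar_eq S x).choose_spec.1

@[simp] lemma rstar_radius (S : Setting) (x : ℝ) : S.rstar (S.radius x) = x :=
  (exists_rstar_eq S x).choose_spec.2

lemma radius_le_iff (hr : 2 * S.M < r) : S.radius x ≤ r ↔ x ≤ S.rstar r := by
  rw [← strictMonoOn_rstar.le_iff_le (two_M_lt_radius S x) hr, rstar_radius]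

lemma le_radius_iff (hr : 2 * S.M < r) : r ≤ S.radius x ↔ S.rstar r ≤ x := by
  rw [← strictMonoOn_rstar.le_iff_le hr (two_M_lt_radius S x), rstar_radius]

lemma rstar_le_rstar (h₁ : 2 * S.M < r₁) (h : r₁ ≤ r₂) : S.rstar r₁ ≤ S.rstar r₂ :=
  strictMonoOn_rstar.monotoneOn h₁ (h₁.trans_le h) h

lemma le_div_mul_of_two_M_le (c : ℝ) (hr : 2 * S.M ≤ r) : c ≤ |c| / (2 * S.M) * r := by
  have hM := S.M_pos
  calc c ≤ |c| := le_abs_self c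
    _ = |c| / (2 * S.M) * (2 * S.M) := by field_simp
    _ ≤ |c| / (2 * S.M) * r := by gcongr

lemma exists_rstar_le (S : Setting) : ∃ C, 0 ≤ C ∧ ∀ r, 2 * S.M < r → S.rstar r ≤ C * r := by
  have hM := S.M_pos
  obtain ⟨c, hc⟩ := exists_rstar_eq_add_log S
  refine ⟨|c| / (2 * S.M) + 1 + 2 * S.M, by positivity, fun r hr => ?_⟩
  have hlog : Real.log (r - 2 * S.M) ≤ r := by
    linarith [Real.log_le_sub_one_of_pos (x := r - 2 * S.M) (by linarith)]
  have hle : c ≤ |c| / (2 * S.M) * r := le_div_mul_of_two_M_le c hr.le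
  rw [hc r hr]
  nlinarith

end Tortoise

section Null

/-! ### Transport along the null cones -/

variable {S : Setting} {f : ℝ × ℝ → ℝ} {p : ℝ × ℝ} {B B' : ℝ → ℝ} {v w r r₁ r₂ x : ℝ}

variable (S) in
/-- The point of radius `r` on the outgoing cone `{u = w}`. -/
def outgoing (w r : ℝ) : ℝ × ℝ := (w + 2 * S.rstar r, r)

variable (S) in
/-- The radius at which the outgoing cone through `p` meets the initial cone `{v = v₀}`. -/
def initialRadius (p : ℝ × ℝ) : ℝ := S.radius ((S.v₀ - S.u p) / 2)

@[simp] lemma u_outgoing (w r : ℝ) : S.u (S.outgoing w r) = w := by rw [u, outgoing]; ring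

@[simp] lemma outgoing_u_snd (p : ℝ × ℝ) : S.outgoing (S.u p) p.2 = p := by
  ext <;> simp [outgoing, u]

@[simp] lemma outgoing_initialRadius (p : ℝ × ℝ) :
    S.outgoing (S.u p) (S.initialRadius p) = (S.v₀, S.initialRadius p) := by
  ext <;> simp [outgoing, initialRadius]; ring

lemma two_M_lt_initialRadius (p : ℝ × ℝ) : 2 * S.M < S.initialRadius p := two_M_lt_radius S _

lemma initialRadius_pos (p : ℝ × ℝ) : 0 < S.initialRadius p :=
  pos_of_two_M_lt (two_M_lt_initialRadius p)

lemma initialRadius_le (hp : p ∈ S.exterior) : S.initialRadius p ≤ p.2 := by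
  have hv : S.v₀ ≤ p.1 := hp.1
  refine (radius_le_iff hp.2).2 ?_
  simp only [u]
  linarith

lemma mk_mem_exterior_of_le (hp : (v, r₁) ∈ S.exterior) (h : r₁ ≤ r₂) : (v, r₂) ∈ S.exterior :=
  ⟨hp.1, lt_of_lt_of_le hp.2 h⟩

lemma outgoing_mem_exterior_of_le (h₁ : S.outgoing w r₁ ∈ S.exterior) (h : r₁ ≤ r₂) :
    S.outgoing w r₂ ∈ S.exterior := by
  have hr₁ : 2 * S.M < r₁ := h₁.2
  have hv₁ : S.v₀ ≤ w + 2 * S.rstar r₁ := h₁.1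
  have hv₂ : S.v₀ ≤ w + 2 * S.rstar r₂ := by linarith [rstar_le_rstar hr₁ h]
  exact ⟨hv₂, hr₁.trans_le h⟩

lemma hasDerivWithinAt_mk (hf : S.IsSmooth f) (hp : (v, x) ∈ S.exterior) :
    HasDerivWithinAt (fun y => f (v, y)) (S.drIn f (v, x)) (Ici x) x := by
  rw [drIn, along_eq_fderivWithin_exterior hp]
  exact (hf.differentiableWithinAt hp).hasFDerivWithinAt.comp_hasDerivWithinAt
    (f := fun y => (v, y)) x ((hasDerivWithinAt_const _ _ _).prodMk (hasDerivWithinAt_id _ _))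
    fun y hy => mk_mem_exterior_of_le hp hy

lemma hasDerivWithinAt_outgoing (hf : S.IsSmooth f) (hp : S.outgoing w x ∈ S.exterior) :
    HasDerivWithinAt (fun y => f (S.outgoing w y)) (S.drOut f (S.outgoing w x)) (Ici x) x := by
  rw [drOut, along_eq_fderivWithin_exterior hp]
  have hcurve : HasDerivWithinAt (S.outgoing w) (2 / S.D x, 1) (Ici x) x := by
    have h := ((hasDerivAt_rstar hp.2).const_mul 2).const_add w
    rw [div_eq_mul_inv]
    exact h.hasDerivWithinAt.prodMk (hasDerivWithinAt_id _ _)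
  exact (hf.differentiableWithinAt hp).hasFDerivWithinAt.comp_hasDerivWithinAt x hcurve
    fun y hy => outgoing_mem_exterior_of_le hp hy

lemma abs_sub_le_of_abs_drIn_le (hf : S.IsSmooth f) (h₁ : (v, r₁) ∈ S.exterior) (h₁₂ : r₁ ≤ r₂)
    (hB : ∀ x ∈ Icc r₁ r₂, HasDerivAt B (B' x) x)
    (h : ∀ x ∈ Icc r₁ r₂, |S.drIn f (v, x)| ≤ B' x) :
    |f (v, r₂) - f (v, r₁)| ≤ B r₂ - B r₁ :=
  abs_sub_le_of_abs_deriv_right_le h₁₂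
    (hf.continuousOn.comp (by fun_prop) fun _ hx => mk_mem_exterior_of_le h₁ hx.1)
    (fun _ hx => hasDerivWithinAt_mk hf (mk_mem_exterior_of_le h₁ hx.1)) hB h

lemma abs_sub_le_of_abs_drOut_le (hf : S.IsSmooth f) (h₁ : S.outgoing w r₁ ∈ S.exterior)
    (h₁₂ : r₁ ≤ r₂) (hB : ∀ x ∈ Icc r₁ r₂, HasDerivAt B (B' x) x)
    (h : ∀ x ∈ Icc r₁ r₂, |S.drOut f (S.outgoing w x)| ≤ B' x) :
    |f (S.outgoing w r₂) - f (S.outgoing w r₁)| ≤ B r₂ - B r₁ := by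
  have hcurve : ContinuousOn (S.outgoing w) (Icc r₁ r₂) :=
    (continuousOn_const.add (continuousOn_const.mul
      (continuousOn_rstar.mono fun _ hx => lt_of_lt_of_le h₁.2 hx.1))).prodMk continuousOn_id
  exact abs_sub_le_of_abs_deriv_right_le h₁₂
    (hf.continuousOn.comp hcurve fun _ hx => outgoing_mem_exterior_of_le h₁ hx.1)
    (fun _ hx => hasDerivWithinAt_outgoing hf (outgoing_mem_exterior_of_le h₁ hx.1)) hB h

lemma initialRadius_mem_exterior (p : ℝ × ℝ) :
    S.outgoing (S.u p) (S.initialRadius p) ∈ S.exterior := by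
  rw [outgoing_initialRadius]
  exact ⟨self_mem_Ici, two_M_lt_initialRadius p⟩

lemma outgoing_mem_exterior (hx : S.initialRadius p ≤ x) : S.outgoing (S.u p) x ∈ S.exterior :=
  outgoing_mem_exterior_of_le (initialRadius_mem_exterior p) hx

lemma abs_sub_initial_le (hf : S.IsSmooth f) (hp : p ∈ S.exterior)
    (hB : ∀ x ∈ Icc (S.initialRadius p) p.2, HasDerivAt B (B' x) x)
    (h : ∀ x ∈ Icc (S.initialRadius p) p.2, |S.drOut f (S.outgoing (S.u p) x)| ≤ B' x) :
    |f p - f (S.v₀, S.initialRadius p)| ≤ B p.2 - B (S.initialRadius p) := by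
  simpa using abs_sub_le_of_abs_drOut_le hf (initialRadius_mem_exterior p) (initialRadius_le hp)
    hB h

lemma abs_sub_initial_le_of_abs_L_le (hf : S.IsSmooth f) (hp : p ∈ S.exterior)
    (hB : ∀ v ∈ Icc S.v₀ p.1, HasDerivAt B (B' v) v)
    (h : ∀ q ∈ S.exterior, S.u q = S.u p → q.1 ≤ p.1 → |S.L f q| ≤ B' q.1) :
    |f p - f (S.v₀, S.initialRadius p)| ≤ B p.1 - B S.v₀ := by
  have hcone {x : ℝ} (hx : x ∈ Icc (S.initialRadius p) p.2) :
      S.outgoing (S.u p) x ∈ S.exterior ∧ (S.outgoing (S.u p) x).1 ≤ p.1 := by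
    have hmem := outgoing_mem_exterior hx.1
    refine ⟨hmem, ?_⟩
    calc (S.outgoing (S.u p) x).1 ≤ (S.outgoing (S.u p) p.2).1 := by
          simpa [outgoing] using rstar_le_rstar hmem.2 hx.2
      _ = p.1 := by rw [outgoing_u_snd]
  have key := abs_sub_initial_le (B := fun x => B (S.outgoing (S.u p) x).1)
    (B' := fun x => B' (S.outgoing (S.u p) x).1 * (2 / S.D x)) hf hp (fun x hx => ?_)
    fun x hx => ?_
  · simpa using key
  · have hx' := hcone hx
    have hv : HasDerivAt (fun x => (S.outgoing (S.u p) x).1) (2 / S.D x) x := by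
      simpa [outgoing, div_eq_mul_inv] using
        ((hasDerivAt_rstar hx'.1.2).const_mul 2).const_add (S.u p)
    exact (hB _ ⟨hx'.1.1, hx'.2⟩).comp x hv
  · have hx' := hcone hx
    have hD : 0 < 2 / S.D (S.outgoing (S.u p) x).2 := div_pos two_pos (D_pos hx'.1.2)
    rw [drOut_eq_L hx'.1, abs_mul, abs_of_pos hD, mul_comm]
    exact mul_le_mul_of_nonneg_right (h _ hx'.1 (u_outgoing _ _) hx'.2) hD.le

lemma abs_mul_div_pow_three_le {E y : ℝ} (hx : 0 < x) (hy : |y| ≤ E) :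
    |S.M / x ^ 3 * y| ≤ S.M * E / x ^ 3 := by
  have hM := S.M_pos
  rw [abs_mul, abs_of_pos (by positivity), mul_div_right_comm]
  gcongr

lemma IsWave.abs_L_sub_le {E : ℝ} (hf : S.IsSmooth f) (hw : S.IsWave f)
    (h₁ : (v, r₁) ∈ S.exterior) (h₁₂ : r₁ ≤ r₂) (h : ∀ x ∈ Icc r₁ r₂, |f (v, x)| ≤ E) :
    |S.L f (v, r₂) - S.L f (v, r₁)| ≤ S.M * E / (2 * r₁ ^ 2) := by
  have hM := S.M_pos
  have hr₁ := pos_of_mem h₁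
  have hE : 0 ≤ E := (abs_nonneg _).trans (h _ (left_mem_Icc.2 h₁₂))
  have key := abs_sub_le_of_abs_drIn_le hf.L h₁ h₁₂
    (fun x hx => hasDerivAt_neg_div_sq (S.M * E) (hr₁.trans_le hx.1).ne') fun x hx => by
      rw [hw _ (mk_mem_exterior_of_le h₁ hx.1)]
      exact abs_mul_div_pow_three_le (hr₁.trans_le hx.1) (h x hx)
  have hpos : 0 ≤ S.M * E / (2 * r₂ ^ 2) := by positivity
  linarith

lemma IsWave.abs_Lbar_sub_initial_le {E : ℝ} (hf : S.IsSmooth f) (hw : S.IsWave f)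
    (hp : p ∈ S.exterior)
    (h : ∀ x ∈ Icc (S.initialRadius p) p.2, |f (S.outgoing (S.u p) x)| ≤ E) :
    |S.Lbar f p - S.Lbar f (S.v₀, S.initialRadius p)|
      ≤ S.M * E / (2 * S.initialRadius p ^ 2) := by
  have hM := S.M_pos
  have hr₀ := initialRadius_pos (S := S) p
  have hE : 0 ≤ E := (abs_nonneg _).trans (h _ (left_mem_Icc.2 (initialRadius_le hp)))
  have key := abs_sub_initial_le hf.Lbar hp
    (fun x hx => hasDerivAt_neg_div_sq (S.M * E) (hr₀.trans_le hx.1).ne') fun x hx => by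
      rw [hw.drOut_Lbar hf (outgoing_mem_exterior hx.1), neg_mul, abs_neg]
      exact abs_mul_div_pow_three_le (hr₀.trans_le hx.1) (h x hx)
  have hpos : 0 ≤ S.M * E / (2 * p.2 ^ 2) := div_nonneg (by positivity) (by positivity)
  linarith

end Null

section Region

/-! ### The past of an outgoing cone -/

variable {S : Setting} {p : ℝ × ℝ} {u₁ v r r' x : ℝ}

variable (S) in
/-- The part of the exterior to the past of the outgoing cone `{u = u₁}`. -/
def region (u₁ : ℝ) : Set (ℝ × ℝ) := {p | p ∈ S.exterior ∧ S.u p ≤ u₁}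

variable (S) in
/-- One plus the retarded time that elapses between `p` and the cone `{u = u₁}`. In the past of that
cone it is at least `1`, and it tends to infinity towards past null infinity. -/
def delay (u₁ : ℝ) (p : ℝ × ℝ) : ℝ := 1 + (u₁ - S.u p)

variable (S) in
/-- The radius of the sphere `{u = u₁, v = v₀}`, the smallest one in `S.region u₁`. -/
def innerRadius (u₁ : ℝ) : ℝ := S.radius ((S.v₀ - u₁) / 2)

lemma two_M_lt_innerRadius : 2 * S.M < S.innerRadius u₁ := two_M_lt_radius S _

lemma innerRadius_pos : 0 < S.innerRadius u₁ := pos_of_two_M_lt two_M_lt_innerRadius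

lemma innerRadius_le (hp : p ∈ S.region u₁) : S.innerRadius u₁ ≤ p.2 := by
  have hv : S.v₀ ≤ p.1 := hp.1.1
  have hu := hp.2
  refine (radius_le_iff hp.1.2).2 ?_
  simp only [u] at hu
  linarith

lemma mk_v₀_mem_region_iff (hr : 2 * S.M < r) :
    (S.v₀, r) ∈ S.region u₁ ↔ S.innerRadius u₁ ≤ r := by
  refine ⟨innerRadius_le, fun h => ⟨⟨self_mem_Ici, hr⟩, ?_⟩⟩
  have h := (radius_le_iff hr).1 h
  simp only [u]
  linarith

lemma one_le_delay (hp : p ∈ S.region u₁) : 1 ≤ S.delay u₁ p := by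
  have hu := hp.2
  rw [delay]
  linarith

lemma delay_pos (hp : p ∈ S.region u₁) : 0 < S.delay u₁ p := one_pos.trans_le (one_le_delay hp)

lemma mk_mem_region_of_le (hp : (v, r) ∈ S.region u₁) (h : r ≤ r') : (v, r') ∈ S.region u₁ := by
  refine ⟨mk_mem_exterior_of_le hp.1 h, le_trans ?_ hp.2⟩
  simp only [u]
  linarith [rstar_le_rstar hp.1.2 h]

lemma outgoing_mem_region (hp : p ∈ S.region u₁) (hx : S.initialRadius p ≤ x) :
    S.outgoing (S.u p) x ∈ S.region u₁ :=
  ⟨outgoing_mem_exterior hx, by rw [u_outgoing]; exact hp.2⟩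

lemma initial_mem_region (hp : p ∈ S.region u₁) : (S.v₀, S.initialRadius p) ∈ S.region u₁ := by
  rw [← outgoing_initialRadius]
  exact outgoing_mem_region hp le_rfl

@[simp] lemma delay_outgoing (p : ℝ × ℝ) (x : ℝ) :
    S.delay u₁ (S.outgoing (S.u p) x) = S.delay u₁ p := by
  rw [delay, u_outgoing, delay]

lemma delay_initial (p : ℝ × ℝ) : S.delay u₁ (S.v₀, S.initialRadius p) = S.delay u₁ p := by
  rw [← outgoing_initialRadius, delay_outgoing]

lemma hasDerivAt_delay (hr : 2 * S.M < r) :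
    HasDerivAt (fun x => S.delay u₁ (v, x)) (2 / S.D r) r :=
  (((((hasDerivAt_rstar hr).const_mul 2).const_sub v).const_sub u₁).const_add 1).congr_deriv
    (by ring)

lemma tendsto_delay (S : Setting) (u₁ v : ℝ) :
    Tendsto (fun x => S.delay u₁ (v, x)) atTop atTop := by
  have h := tendsto_atTop_add_const_left atTop (1 + (u₁ - v))
    (tendsto_rstar_atTop (S := S).const_mul_atTop two_pos)
  refine h.congr fun x => ?_
  simp only [delay, u]
  ring

lemma exists_delay_le (S : Setting) (u₁ : ℝ) :
    ∃ κ, 0 ≤ κ ∧ ∀ p ∈ S.region u₁, S.delay u₁ p ≤ κ * p.2 := by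
  obtain ⟨C, hC, hrstar⟩ := exists_rstar_le S
  have hM := S.M_pos
  refine ⟨|1 + (u₁ - S.v₀)| / (2 * S.M) + 2 * C, by positivity, fun p hp => ?_⟩
  have hv : S.v₀ ≤ p.1 := hp.1.1
  have hconst : 1 + (u₁ - S.v₀) ≤ |1 + (u₁ - S.v₀)| / (2 * S.M) * p.2 :=
    le_div_mul_of_two_M_le _ (le_of_lt hp.1.2)
  have hr := hrstar p.2 hp.1.2
  simp only [delay, u]
  linarith

end Region

section Bounded

/-! ### Boundedness -/

variable {S : Setting} {f : ℝ × ℝ → ℝ} {a v : ℝ}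

lemma exists_abs_le_on_box (hf : S.IsSmooth f) (V b : ℝ) (ha : 2 * S.M < a) :
    ∃ B, 0 ≤ B ∧ ∀ p ∈ Icc S.v₀ V ×ˢ Icc a b, |f p| ≤ B := by
  obtain ⟨B, hB⟩ := (isCompact_Icc.prod isCompact_Icc).exists_bound_of_continuousOn
    (hf.continuousOn.mono (prod_mono Icc_subset_Ici_self fun x (hx : x ∈ Icc a b) =>
      ha.trans_le hx.1) : ContinuousOn f (Icc S.v₀ V ×ˢ Icc a b))
  exact ⟨max B 0, le_max_right _ _, fun p hp => (hB p hp).trans (le_max_left _ _)⟩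

lemma continuousOn_mk (hf : S.IsSmooth f) (hv : S.v₀ ≤ v) (ha : 2 * S.M < a) :
    ContinuousOn (fun r => f (v, r)) (Ici a) :=
  hf.continuousOn.comp (by fun_prop) fun _ hx => ⟨hv, ha.trans_le hx⟩

lemma exists_abs_le_on_ray (hf : S.IsSmooth f) (hv : S.v₀ ≤ v) (ha : 2 * S.M < a)
    (h : Tendsto (fun r => f (v, r)) atTop (𝓝 0)) : ∃ B, 0 ≤ B ∧ ∀ r ∈ Ici a, |f (v, r)| ≤ B := by
  simpa using exists_abs_le_mul_of_isBigO (G := fun _ => 1) (continuousOn_mk hf hv ha)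
    continuousOn_const (fun _ _ => one_pos) (h.isBigO_one ℝ)

lemma IsWave.exists_abs_L_le (hf : S.IsSmooth f) (hw : S.IsWave f) (u₁ V : ℝ) :
    ∃ C, 0 ≤ C ∧ ∀ p ∈ S.region u₁, p.1 ≤ V → ∀ E,
      (∀ x ≤ p.2, (p.1, x) ∈ S.region u₁ → |f (p.1, x)| ≤ E) →
      |S.L f p| ≤ C + S.M / (2 * S.innerRadius u₁ ^ 2) * E := by
  have hM := S.M_pos
  have ha := innerRadius_pos (S := S) (u₁ := u₁)
  obtain ⟨C, hC, hbox⟩ := exists_abs_le_on_box hf.L V (S.radius ((V - u₁) / 2))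
    (two_M_lt_innerRadius (u₁ := u₁))
  refine ⟨C, hC, ?_⟩
  rintro ⟨v, r⟩ hp hV E hE
  simp only at hV hE
  set r₁ := S.radius ((v - u₁) / 2) with hr₁
  have hu : v - 2 * S.rstar r ≤ u₁ := hp.2
  have hr₁r : r₁ ≤ r := (radius_le_iff hp.1.2).2 (by linarith)
  have hmem : (v, r₁) ∈ S.region u₁ := by
    refine ⟨⟨hp.1.1, two_M_lt_radius S _⟩, ?_⟩
    rw [u, hr₁, rstar_radius]; linarith
  have hE0 : 0 ≤ E := (abs_nonneg _).trans (hE r le_rfl hp)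
  have har₁ := innerRadius_le hmem
  have hbase : |S.L f (v, r₁)| ≤ C := by
    refine hbox _ ⟨⟨hp.1.1, hV⟩, har₁, (le_radius_iff hmem.1.2).2 ?_⟩
    simp only [hr₁, rstar_radius]
    linarith
  calc |S.L f (v, r)| ≤ |S.L f (v, r₁)| + |S.L f (v, r) - S.L f (v, r₁)| := by
        simpa using abs_add_le (S.L f (v, r₁)) (S.L f (v, r) - S.L f (v, r₁))
    _ ≤ C + S.M * E / (2 * r₁ ^ 2) := add_le_add hbase <| hw.abs_L_sub_le hf hmem.1 hr₁r
        fun x hx => hE x hx.2 (mk_mem_region_of_le hmem hx.1)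
    _ ≤ C + S.M * E / (2 * S.innerRadius u₁ ^ 2) := by gcongr
    _ = _ := by ring

lemma snd_le_of_u_eq {p q : ℝ × ℝ} (hp : p ∈ S.exterior) (hq : q ∈ S.exterior)
    (hu : S.u q = S.u p) (h : q.1 ≤ p.1) : q.2 ≤ p.2 := by
  refine (strictMonoOn_rstar.le_iff_le hq.2 hp.2).1 ?_
  simp only [u] at hu
  linarith

/-- Grönwall's inequality along the outgoing cones, in the form of a bootstrap with the weight
`exp (M (v - v₀) / a ^ 2)`. The cut-off at radius `ρ` makes the a priori bound available. -/
lemma IsWave.exists_abs_le_of_fst_le (hf : S.IsSmooth f) (hw : S.IsWave f)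
    (h₀ : Tendsto (fun r => f (S.v₀, r)) atTop (𝓝 0)) (u₁ V : ℝ) :
    ∃ B, ∀ p ∈ S.region u₁, p.1 ≤ V → |f p| ≤ B := by
  have hM := S.M_pos
  have ha := two_M_lt_innerRadius (S := S) (u₁ := u₁)
  obtain ⟨C₀, hC₀, hray⟩ := exists_abs_le_on_ray hf le_rfl ha h₀
  obtain ⟨C₁, hC₁, hL⟩ := hw.exists_abs_L_le hf u₁ V
  set l := S.M / S.innerRadius u₁ ^ 2 with hl
  have hl0 : 0 ≤ l := by positivity
  have hbound (ρ : ℝ) : ∀ p ∈ {p | p ∈ S.region u₁ ∧ p.1 ≤ V ∧ p.2 ≤ ρ},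
      |f p| ≤ 2 * (C₀ + C₁ * (V - S.v₀)) * Real.exp (l * (p.1 - S.v₀)) := by
    have hexp (p : ℝ × ℝ) (hp : p ∈ S.region u₁) : 1 ≤ Real.exp (l * (p.1 - S.v₀)) :=
      Real.one_le_exp (mul_nonneg hl0 (sub_nonneg.2 hp.1.1))
    obtain ⟨A, hA, hbox⟩ := exists_abs_le_on_box hf V ρ ha
    refine abs_le_of_bootstrap (fun _ _ => Real.exp_pos _) (A := A) ?_ ?_
    · rintro p ⟨hp, hV, hρ⟩
      exact (hbox p ⟨⟨hp.1.1, hV⟩, innerRadius_le hp, hρ⟩).trans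
        (le_mul_of_one_le_right hA (hexp p hp))
    · rintro B hB hfB p ⟨hp, hV, hρ⟩
      have hLf : ∀ q ∈ S.exterior, S.u q = S.u p → q.1 ≤ p.1 →
          |S.L f q| ≤ C₁ + l / 2 * (B * Real.exp (l * (q.1 - S.v₀))) := by
        intro q hq hu hqp
        have h := hL q ⟨hq, hu.trans_le hp.2⟩ (hqp.trans hV)
          (B * Real.exp (l * (q.1 - S.v₀))) fun x hx hm =>
          hfB (q.1, x) ⟨hm, hqp.trans hV, hx.trans ((snd_le_of_u_eq hp.1 hq hu hqp).trans hρ)⟩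
        convert h using 3
        rw [hl]; ring
      have hstep := abs_sub_initial_le_of_abs_L_le hf hp.1
        (B := fun v => C₁ * v + B / 2 * Real.exp (l * (v - S.v₀)))
        (B' := fun v => C₁ + l / 2 * (B * Real.exp (l * (v - S.v₀)))) (fun v _ =>
          (((hasDerivAt_id v).const_mul C₁).add ((((hasDerivAt_id v).sub_const S.v₀).const_mul
            l).exp.const_mul (B / 2))).congr_deriv (by simp only [id_eq]; ring)) hLf
      simp only [sub_self, mul_zero, Real.exp_zero, mul_one] at hstep
      have hinit : |f (S.v₀, S.initialRadius p)| ≤ C₀ :=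
        hray _ (innerRadius_le (initial_mem_region hp))
      have htri := abs_sub_abs_le_abs_sub (f p) (f (S.v₀, S.initialRadius p))
      have hv : S.v₀ ≤ p.1 := hp.1.1
      nlinarith [hexp p hp, mul_le_mul_of_nonneg_left hV hC₁, mul_le_mul_of_nonneg_left hv hC₁]
  refine ⟨2 * (C₀ + C₁ * (V - S.v₀)) * Real.exp (l * (V - S.v₀)), fun p hp hV => ?_⟩
  have hv : S.v₀ ≤ p.1 := hp.1.1
  have hVv : 0 ≤ V - S.v₀ := by linarith
  exact (hbound p.2 p ⟨hp, hV, le_rfl⟩).trans (by gcongr)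

end Bounded

section Decay

/-! ### Decay in the retarded time -/

variable {S : Setting} {f : ℝ × ℝ → ℝ} {p : ℝ × ℝ} {u₁ v r C I δ : ℝ}

/-- Integration from past null infinity: in terms of `y = delay`, `L̲` acts on functions of `y` at
fixed `v` as `-d/dy`. -/
lemma abs_sub_profile_le {g g' b b' : ℝ → ℝ} (hf : S.IsSmooth f)
    (h₀ : Tendsto (fun r => f (v, r)) atTop (𝓝 0)) (hp : (v, r) ∈ S.region u₁)
    (hg₀ : Tendsto g atTop (𝓝 0)) (hg : ∀ y, 1 ≤ y → HasDerivAt g (-g' y) y)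
    (hb₀ : ∀ y, 1 ≤ y → 0 ≤ b y) (hb : ∀ y, 1 ≤ y → HasDerivAt b (-b' y) y)
    (h : ∀ x, r ≤ x → |S.Lbar f (v, x) - g' (S.delay u₁ (v, x))| ≤ b' (S.delay u₁ (v, x))) :
    |f (v, r) - g (S.delay u₁ (v, r))| ≤ b (S.delay u₁ (v, r)) := by
  have hmem (x : ℝ) (hx : r ≤ x) : (v, x) ∈ S.region u₁ := mk_mem_region_of_le hp hx
  have hcomp {k k' : ℝ → ℝ} (hk : ∀ y, 1 ≤ y → HasDerivAt k (-k' y) y) (x : ℝ) (hx : r ≤ x) :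
      HasDerivAt (fun x => k (S.delay u₁ (v, x)))
        (-(2 / S.D x * k' (S.delay u₁ (v, x)))) x :=
    ((hk _ (one_le_delay (hmem x hx))).comp x (hasDerivAt_delay (hmem x hx).1.2)).congr_deriv
      (by ring)
  refine abs_le_of_tendsto_zero (f := fun x => f (v, x) - g (S.delay u₁ (v, x)))
    (b := fun x => b (S.delay u₁ (v, x)))
    (by simpa using h₀.sub (hg₀.comp (tendsto_delay S u₁ v)))
    (fun x hx => hb₀ _ (one_le_delay (hmem x hx))) fun r' hr' => ?_
  have key := abs_sub_le_of_abs_deriv_right_le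
    (f := fun x => f (v, x) - g (S.delay u₁ (v, x)))
    (B := fun x => -b (S.delay u₁ (v, x))) hr'
    ((continuousOn_mk hf hp.1.1 hp.1.2).mono Icc_subset_Ici_self |>.sub fun x hx =>
      (hcomp hg x hx.1).continuousAt.continuousWithinAt)
    (fun x hx => (hasDerivWithinAt_mk hf (hmem x hx.1).1).sub (hcomp hg x hx.1).hasDerivWithinAt)
    (fun x hx => (hcomp hb x hx.1).neg) fun x hx => by
      have hD : 0 < 2 / S.D x := div_pos two_pos (D_pos (hmem x hx.1).1.2)
      have hfactor : S.drIn f (v, x) - -(2 / S.D x * g' (S.delay u₁ (v, x)))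
          = -(2 / S.D x * (S.Lbar f (v, x) - g' (S.delay u₁ (v, x)))) := by
        rw [drIn_eq_Lbar (hmem x hx.1).1]; ring
      rw [hfactor, abs_neg, abs_mul, abs_of_pos hD, neg_neg]
      exact mul_le_mul_of_nonneg_left (h x hx.1) hD.le
  linarith

lemma abs_le_of_abs_Lbar_le {b b' : ℝ → ℝ} (hf : S.IsSmooth f)
    (h₀ : Tendsto (fun r => f (v, r)) atTop (𝓝 0)) (hp : (v, r) ∈ S.region u₁)
    (hb₀ : ∀ y, 1 ≤ y → 0 ≤ b y) (hb : ∀ y, 1 ≤ y → HasDerivAt b (-b' y) y)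
    (h : ∀ x, r ≤ x → |S.Lbar f (v, x)| ≤ b' (S.delay u₁ (v, x))) :
    |f (v, r)| ≤ b (S.delay u₁ (v, r)) := by
  simpa using abs_sub_profile_le (g := fun _ => 0) (g' := fun _ => 0) hf h₀ hp tendsto_const_nhds
    (fun y _ => by simpa using hasDerivAt_const y (0 : ℝ)) hb₀ hb (by simpa using h)

lemma IsWave.exists_abs_Lbar_sub_initial_le (hf : S.IsSmooth f) (hw : S.IsWave f) (u₁ : ℝ) :
    ∃ K, 0 ≤ K ∧ ∀ p ∈ S.region u₁, ∀ E,
      (∀ q ∈ S.region u₁, S.delay u₁ q = S.delay u₁ p → q.1 ≤ p.1 → |f q| ≤ E) →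
      |S.Lbar f p - S.Lbar f (S.v₀, S.initialRadius p)| ≤ K * E / S.delay u₁ p ^ 2 := by
  obtain ⟨κ, -, hdelay⟩ := exists_delay_le S u₁
  have hM := S.M_pos
  refine ⟨S.M * κ ^ 2 / 2, by positivity, fun p hp E hE => ?_⟩
  have hE₀ : 0 ≤ E := (abs_nonneg _).trans (hE p hp rfl le_rfl)
  have hd := delay_pos hp
  have hr₀ := initialRadius_pos (S := S) p
  have hdr : S.delay u₁ p ≤ κ * S.initialRadius p := by
    simpa [delay_initial] using hdelay _ (initial_mem_region hp)
  have hcone (x : ℝ) (hx : x ∈ Icc (S.initialRadius p) p.2) :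
      (S.outgoing (S.u p) x).1 ≤ p.1 := by
    have h := rstar_le_rstar ((two_M_lt_initialRadius p).trans_le hx.1) hx.2
    simp only [outgoing, u]
    linarith
  calc |S.Lbar f p - S.Lbar f (S.v₀, S.initialRadius p)|
      ≤ S.M * E / (2 * S.initialRadius p ^ 2) := hw.abs_Lbar_sub_initial_le hf hp.1 fun x hx =>
        hE _ (outgoing_mem_region hp hx.1) (delay_outgoing p x) (hcone x hx)
    _ = S.M / 2 * E * (S.delay u₁ p / S.initialRadius p) ^ 2 / S.delay u₁ p ^ 2 := by field_simp
    _ ≤ S.M / 2 * E * κ ^ 2 / S.delay u₁ p ^ 2 := by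
        gcongr
        exact (div_le_iff₀ hr₀).2 hdr
    _ = _ := by ring

lemma IsWave.exists_abs_Lbar_le (hf : S.IsSmooth f) (hw : S.IsWave f)
    (hdata : ∀ r, S.innerRadius u₁ ≤ r → |S.Lbar f (S.v₀, r)| ≤ C / S.delay u₁ (S.v₀, r) ^ 2) :
    ∃ K, 0 < K ∧ ∀ p ∈ S.region u₁, ∀ E,
      (∀ q ∈ S.region u₁, S.delay u₁ q = S.delay u₁ p → q.1 ≤ p.1 → |f q| ≤ E) →
      |S.Lbar f p| ≤ (C + K * E) / S.delay u₁ p ^ 2 := by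
  obtain ⟨K, hK, h⟩ := hw.exists_abs_Lbar_sub_initial_le hf u₁
  refine ⟨K + 1, by positivity, fun p hp E hE => ?_⟩
  have hE₀ : 0 ≤ E := (abs_nonneg _).trans (hE p hp rfl le_rfl)
  have hinit := hdata _ (innerRadius_le (initial_mem_region hp))
  rw [delay_initial] at hinit
  calc |S.Lbar f p| ≤ |S.Lbar f (S.v₀, S.initialRadius p)|
        + |S.Lbar f p - S.Lbar f (S.v₀, S.initialRadius p)| := by
        linarith [abs_sub_abs_le_abs_sub (S.Lbar f p) (S.Lbar f (S.v₀, S.initialRadius p))]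
    _ ≤ C / S.delay u₁ p ^ 2 + K * E / S.delay u₁ p ^ 2 := add_le_add hinit (h p hp E hE)
    _ = (C + K * E) / S.delay u₁ p ^ 2 := by ring
    _ ≤ _ := by gcongr; linarith

/-- Grönwall's inequality at fixed `v`, with the weight `exp (2 K / delay)`, which is bounded
uniformly in `v`. -/
lemma IsWave.exists_abs_le (hf : S.IsSmooth f) (hw : S.IsWave f)
    (h₀ : ∀ v, S.v₀ ≤ v → Tendsto (fun r => f (v, r)) atTop (𝓝 0)) (hC : 0 ≤ C)
    (hdata : ∀ r, S.innerRadius u₁ ≤ r → |S.Lbar f (S.v₀, r)| ≤ C / S.delay u₁ (S.v₀, r) ^ 2) :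
    ∃ B, 0 ≤ B ∧ ∀ p ∈ S.region u₁, |f p| ≤ B := by
  obtain ⟨K, hK, hLbar⟩ := hw.exists_abs_Lbar_le hf hdata
  have hne {y : ℝ} (hy : 1 ≤ y) : y ≠ 0 := by linarith
  have hexp {y : ℝ} (hy : 1 ≤ y) : 1 ≤ Real.exp (2 * K / y) := Real.one_le_exp (by positivity)
  have hbound (V : ℝ) : ∀ p ∈ {p | p ∈ S.region u₁ ∧ p.1 ≤ V},
      |f p| ≤ 2 * C * Real.exp (2 * K / S.delay u₁ p) := by
    obtain ⟨A, hA⟩ := hw.exists_abs_le_of_fst_le hf (h₀ _ le_rfl) u₁ V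
    refine abs_le_of_bootstrap (fun _ _ => Real.exp_pos _) (A := A) (fun p hp => ?_) ?_
    · exact (hA p hp.1 hp.2).trans (le_mul_of_one_le_right
        ((abs_nonneg _).trans (hA p hp.1 hp.2)) (hexp (one_le_delay hp.1)))
    · rintro B hB hfB ⟨v, r⟩ ⟨hp, hV⟩
      have hprofile := abs_le_of_abs_Lbar_le
        (b := fun y => C / y + B / 2 * (Real.exp (2 * K / y) - 1))
        (b' := fun y => (C + K * (B * Real.exp (2 * K / y))) / y ^ 2) hf (h₀ v hp.1.1) hp
        (fun y hy => add_nonneg (by positivity)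
          (mul_nonneg (by positivity) (sub_nonneg.2 (hexp hy))))
        (fun y hy => ((hasDerivAt_const_div C (hne hy)).add (((hasDerivAt_const_div
          (2 * K) (hne hy)).exp.sub_const 1).const_mul (B / 2))).congr_deriv (by ring))
        fun x hx => hLbar _ (mk_mem_region_of_le hp hx) _ fun q hq hd hqv => by
          rw [← hd]
          exact hfB q ⟨hq, hqv.trans hV⟩
      have hCd : C / S.delay u₁ (v, r) ≤ C := div_le_self hC (one_le_delay hp)
      nlinarith [hexp (one_le_delay hp)]
  refine ⟨2 * C * Real.exp (2 * K), by positivity, fun p hp => ?_⟩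
  refine (hbound p.1 p ⟨hp, le_rfl⟩).trans ?_
  gcongr
  exact div_le_self (by positivity) (one_le_delay hp)

lemma IsWave.exists_abs_le_div_delay (hf : S.IsSmooth f) (hw : S.IsWave f)
    (h₀ : ∀ v, S.v₀ ≤ v → Tendsto (fun r => f (v, r)) atTop (𝓝 0)) (hC : 0 ≤ C)
    (hdata : ∀ r, S.innerRadius u₁ ≤ r → |S.Lbar f (S.v₀, r)| ≤ C / S.delay u₁ (S.v₀, r) ^ 2) :
    ∃ B, 0 ≤ B ∧ ∀ p ∈ S.region u₁, |f p| ≤ B / S.delay u₁ p := by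
  obtain ⟨K, hK, hLbar⟩ := hw.exists_abs_Lbar_le hf hdata
  obtain ⟨E, hE₀, hE⟩ := hw.exists_abs_le hf h₀ hC hdata
  refine ⟨C + K * E, by positivity, fun p hp => ?_⟩
  exact abs_le_of_abs_Lbar_le (b := fun y => (C + K * E) / y) hf (h₀ _ hp.1.1) hp
    (fun y hy => by positivity) (fun y hy => hasDerivAt_const_div _ (by linarith))
    fun x hx => hLbar _ (mk_mem_region_of_le hp hx) E fun q hq _ _ => hE q hq

lemma abs_Lbar_initial_le (hC : 0 ≤ C) (hδ : 0 ≤ δ)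
    (hdata : ∀ r, S.innerRadius u₁ ≤ r →
      |S.Lbar f (S.v₀, r) - 2 * I / S.delay u₁ (S.v₀, r) ^ 2|
        ≤ C * S.delay u₁ (S.v₀, r) ^ (-2 - δ)) (hr : S.innerRadius u₁ ≤ r) :
    |S.Lbar f (S.v₀, r)| ≤ (C + |2 * I|) / S.delay u₁ (S.v₀, r) ^ 2 := by
  have hd := one_le_delay ((mk_v₀_mem_region_iff (two_M_lt_innerRadius.trans_le hr)).2 hr)
  have hdata := hdata r hr
  set d := S.delay u₁ (S.v₀, r)
  have hrpow : d ^ (-2 - δ) ≤ 1 / d ^ 2 := by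
    rw [one_div, ← Real.rpow_natCast, ← Real.rpow_neg (by linarith)]
    exact Real.rpow_le_rpow_of_exponent_le hd (by push_cast; linarith)
  calc |S.Lbar f (S.v₀, r)|
      ≤ |S.Lbar f (S.v₀, r) - 2 * I / d ^ 2| + |2 * I / d ^ 2| := by
        linarith [abs_sub_abs_le_abs_sub (S.Lbar f (S.v₀, r)) (2 * I / d ^ 2)]
    _ ≤ C * (1 / d ^ 2) + |2 * I| / d ^ 2 := by
        rw [abs_div, abs_of_nonneg (sq_nonneg d)]
        gcongr
        exact hdata.trans (by gcongr)
    _ = _ := by ring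

lemma IsWave.exists_abs_Lbar_sub_le_delay_rpow (hf : S.IsSmooth f) (hw : S.IsWave f)
    (h₀ : ∀ v, S.v₀ ≤ v → Tendsto (fun r => f (v, r)) atTop (𝓝 0)) (hC : 0 ≤ C)
    (hδ : 0 ≤ δ) (hδ1 : δ ≤ 1)
    (hdata : ∀ r, S.innerRadius u₁ ≤ r →
      |S.Lbar f (S.v₀, r) - 2 * I / S.delay u₁ (S.v₀, r) ^ 2|
        ≤ C * S.delay u₁ (S.v₀, r) ^ (-2 - δ)) :
    ∃ B, 0 ≤ B ∧ ∀ p ∈ S.region u₁,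
      |S.Lbar f p - 2 * I / S.delay u₁ p ^ 2| ≤ B * S.delay u₁ p ^ (-2 - δ) := by
  obtain ⟨B, hB₀, hB⟩ := hw.exists_abs_le_div_delay hf h₀ (by positivity)
    fun r => abs_Lbar_initial_le hC hδ hdata
  obtain ⟨K, hK, hLbar⟩ := hw.exists_abs_Lbar_sub_initial_le hf u₁
  refine ⟨K * B + C, by positivity, fun p hp => ?_⟩
  have hd := one_le_delay hp
  have hdiff := hLbar p hp (B / S.delay u₁ p) fun q hq h _ => h ▸ hB q hq
  have hinit := hdata _ (innerRadius_le (initial_mem_region hp))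
  rw [delay_initial] at hinit
  set d := S.delay u₁ p
  have hd₀ : 0 < d := by linarith
  calc |S.Lbar f p - 2 * I / d ^ 2|
      ≤ K * (B / d) / d ^ 2 + C * d ^ (-2 - δ) :=
        (abs_sub_le _ _ _).trans (add_le_add hdiff hinit)
    _ = K * B * d ^ (-3 : ℝ) + C * d ^ (-2 - δ) := by
        rw [Real.rpow_neg hd₀.le, show (3 : ℝ) = (3 : ℕ) by norm_num, Real.rpow_natCast]
        field_simp
    _ ≤ K * B * d ^ (-2 - δ) + C * d ^ (-2 - δ) := by gcongr; linarith
    _ = _ := by ring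

lemma IsWave.exists_abs_sub_le_delay_rpow (hf : S.IsSmooth f) (hw : S.IsWave f)
    (h₀ : ∀ v, S.v₀ ≤ v → Tendsto (fun r => f (v, r)) atTop (𝓝 0)) (hC : 0 ≤ C)
    (hδ : 0 ≤ δ) (hδ1 : δ ≤ 1)
    (hdata : ∀ r, S.innerRadius u₁ ≤ r →
      |S.Lbar f (S.v₀, r) - 2 * I / S.delay u₁ (S.v₀, r) ^ 2|
        ≤ C * S.delay u₁ (S.v₀, r) ^ (-2 - δ)) :
    ∃ B, 0 ≤ B ∧ ∀ p ∈ S.region u₁,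
      |f p - 2 * I / S.delay u₁ p| ≤ B * S.delay u₁ p ^ (-1 - δ) := by
  obtain ⟨B, hB₀, hLbar⟩ := hw.exists_abs_Lbar_sub_le_delay_rpow hf h₀ hC hδ hδ1 hdata
  refine ⟨B / (1 + δ), by positivity, fun p hp => ?_⟩
  exact abs_sub_profile_le (g := fun y => 2 * I / y) (g' := fun y => 2 * I / y ^ 2)
    (b := fun y => B / (1 + δ) * y ^ (-1 - δ)) (b' := fun y => B * y ^ (-2 - δ))
    hf (h₀ _ hp.1.1) hp (tendsto_id.const_div_atTop _)
    (fun y hy => hasDerivAt_const_div _ (by linarith))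
    (fun y hy => by positivity)
    (fun y hy => by
      have h := hasDerivAt_mul_rpow_neg B (by positivity : 1 + δ ≠ 0) (by linarith : y ≠ 0)
      rwa [neg_add', show -1 - δ - 1 = -2 - δ by ring] at h)
    fun x hx => hLbar _ (mk_mem_region_of_le hp hx)

end Decay

section Data

variable {S : Setting} {f : ℝ × ℝ → ℝ} {u₁ ε δ I : ℝ}

lemma BigOOnCone.isBigO_delay (hδε : δ ≤ ε) (hδ0 : 0 ≤ δ) (hδ1 : δ ≤ 1)
    (h : S.BigOOnCone 0 (2 + ε) fun p => S.Lbar f p - 2 * I / (1 + S.u p) ^ 2) (u₁ : ℝ) :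
    (fun r => S.Lbar f (S.v₀, r) - 2 * I / S.delay u₁ (S.v₀, r) ^ 2) =O[atTop]
      fun r => S.delay u₁ (S.v₀, r) ^ (-2 - δ) := by
  obtain ⟨C, hC⟩ := h
  set c := 2 + u₁ with hc
  refine Asymptotics.IsBigO.of_bound (|C| * 2 ^ (2 + ε) + |2 * I| * (12 * |c|)) ?_
  filter_upwards [Ioi_mem_atTop (2 * S.M), (tendsto_delay S u₁ S.v₀).eventually_ge_atTop
    (2 * |c| + 1)] with r hr hd
  set d := S.delay u₁ (S.v₀, r) with hd_def
  have hud : S.u (S.v₀, r) = c - 1 - d := by rw [hd_def, delay, hc]; ring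
  have hcd := le_abs_self c
  have hc₀ := abs_nonneg c
  have hd₀ : 0 < d := by linarith
  have hdata : |S.Lbar f (S.v₀, r) - 2 * I / (c - d) ^ 2| ≤ |C| * 2 ^ (2 + ε) * d ^ (-2 - δ) := by
    have h := hC 0 le_rfl r hr (by linarith) (by linarith)
    have hcd' : |c - d| = d - c := by rw [abs_sub_comm, abs_of_nonneg (by linarith)]
    simp only [Function.iterate_zero, id_eq, Nat.cast_zero, sub_zero, hud,
      show 1 + (c - 1 - d) = c - d by ring, hcd'] at h
    calc _ ≤ C * (d - c) ^ (-(2 + ε)) := h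
      _ ≤ |C| * (d / 2) ^ (-(2 + ε)) := by
          have hdc : 0 ≤ d - c := by linarith
          exact mul_le_mul (le_abs_self C) (Real.rpow_le_rpow_of_nonpos (by positivity)
            (by linarith) (by linarith)) (by positivity) (abs_nonneg C)
      _ = |C| * 2 ^ (2 + ε) * d ^ (-2 - ε) := by
          rw [Real.div_rpow hd₀.le two_pos.le, Real.rpow_neg two_pos.le, div_inv_eq_mul, neg_add']
          ring
      _ ≤ _ := by gcongr; linarith
  have hshift : |2 * I / (c - d) ^ 2 - 2 * I / d ^ 2| ≤ |2 * I| * (12 * |c|) * d ^ (-2 - δ) := by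
    calc |2 * I / (c - d) ^ 2 - 2 * I / d ^ 2| = |2 * I| * |1 / (c - d) ^ 2 - 1 / d ^ 2| := by
          rw [← abs_mul]; ring_nf
      _ ≤ |2 * I| * (12 * |c| / d ^ 3) := by
          gcongr; exact abs_one_div_sq_sub_le hd₀ (by linarith)
      _ = |2 * I| * (12 * |c|) * d ^ (-3 : ℝ) := by
          rw [Real.rpow_neg hd₀.le, show (3 : ℝ) = (3 : ℕ) by norm_num, Real.rpow_natCast]
          ring
      _ ≤ _ := by gcongr <;> linarith
  rw [Real.norm_eq_abs, Real.norm_of_nonneg (by positivity), add_mul]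
  exact (abs_sub_le _ _ _).trans (add_le_add hdata hshift)

lemma BigOOnCone.exists_abs_Lbar_sub_le (hf : S.IsSmooth f) (hδ0 : 0 ≤ δ) (hδε : δ ≤ ε)
    (hδ1 : δ ≤ 1) (h : S.BigOOnCone 0 (2 + ε) fun p => S.Lbar f p - 2 * I / (1 + S.u p) ^ 2)
    (u₁ : ℝ) :
    ∃ C, 0 ≤ C ∧ ∀ r, S.innerRadius u₁ ≤ r →
      |S.Lbar f (S.v₀, r) - 2 * I / S.delay u₁ (S.v₀, r) ^ 2|
        ≤ C * S.delay u₁ (S.v₀, r) ^ (-2 - δ) := by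
  have ha := two_M_lt_innerRadius (S := S) (u₁ := u₁)
  have hd (r : ℝ) (hr : S.innerRadius u₁ ≤ r) : 0 < S.delay u₁ (S.v₀, r) :=
    delay_pos ((mk_v₀_mem_region_iff (ha.trans_le hr)).2 hr)
  have hdc : ContinuousOn (fun r => S.delay u₁ (S.v₀, r)) (Ici (S.innerRadius u₁)) := fun r hr =>
    (hasDerivAt_delay (ha.trans_le hr)).continuousAt.continuousWithinAt
  exact exists_abs_le_mul_of_isBigO
    ((continuousOn_mk hf.Lbar le_rfl ha).sub (continuousOn_const.div (hdc.pow 2)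
      fun r hr => (pow_pos (hd r hr) 2).ne'))
    (hdc.rpow_const fun r hr => Or.inl (hd r hr).ne') (fun r hr => Real.rpow_pos_of_pos (hd r hr) _)
    (h.isBigO_delay hδε hδ0 hδ1 u₁)

end Data

section Symbol

/-! ### Symbol classes for the derivative `L` -/

variable {S : Setting} {Γ : Set (ℝ × ℝ)} {f g w w' : ℝ × ℝ → ℝ} {k l : ℕ} {p : ℝ × ℝ}

variable (S) in
/-- `f` is a symbol of order `k` and size `w` on `Γ`: each of the first `k` derivatives `L` gains
a power of `r`, that is, `L^j f = O(w r⁻ʲ)` for `j ≤ k`. -/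
def IsSymbol (Γ : Set (ℝ × ℝ)) (w : ℝ × ℝ → ℝ) (k : ℕ) (f : ℝ × ℝ → ℝ) : Prop :=
  ∀ j ≤ k, ∃ C, 0 ≤ C ∧ ∀ p ∈ Γ, |S.L^[j] f p| ≤ C * (w p / p.2 ^ j)

lemma iterate_L_congr (h : EqOn f g S.exterior) (k : ℕ) :
    EqOn (S.L^[k] f) (S.L^[k] g) S.exterior := by
  induction k with
  | zero => exact h
  | succ k ih =>
    rw [Function.iterate_succ_apply', Function.iterate_succ_apply']
    exact along_congr ih

lemma iterate_L_add (hf : S.IsSmooth f) (hg : S.IsSmooth g) (k : ℕ) :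
    EqOn (S.L^[k] fun q => f q + g q) (fun q => S.L^[k] f q + S.L^[k] g q) S.exterior := by
  induction k with
  | zero => exact fun _ _ => rfl
  | succ k ih =>
    intro p hp
    simp only [Function.iterate_succ_apply']
    rw [show S.L (S.L^[k] fun q => f q + g q) p = _ from along_congr ih hp]
    exact along_add (hf.iterate_L k) (hg.iterate_L k) hp

lemma IsSymbol.of_le (h : S.IsSymbol Γ w k f) (hl : l ≤ k) : S.IsSymbol Γ w l f :=
  fun j hj => h j (hj.trans hl)

lemma isSymbol_zero_iff :
    S.IsSymbol Γ w 0 f ↔ ∃ C, 0 ≤ C ∧ ∀ p ∈ Γ, |f p| ≤ C * w p := by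
  simp [IsSymbol]

lemma isSymbol_succ_iff : S.IsSymbol Γ w (k + 1) f ↔
    S.IsSymbol Γ w 0 f ∧ S.IsSymbol Γ (fun p => w p / p.2) k (S.L f) := by
  have shift (j : ℕ) (p : ℝ × ℝ) : w p / p.2 / p.2 ^ j = w p / p.2 ^ (j + 1) := by
    rw [div_div, pow_succ']
  refine ⟨fun h => ⟨h.of_le (Nat.zero_le _), fun j hj => ?_⟩, fun ⟨h₀, h₁⟩ j hj => ?_⟩
  · simpa only [shift, Function.iterate_succ_apply] using h (j + 1) (by omega)
  · rcases j with - | j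
    · exact h₀ 0 le_rfl
    · simpa only [shift, Function.iterate_succ_apply] using h₁ j (by omega)

lemma IsSymbol.congr (hΓ : Γ ⊆ S.exterior) (h : S.IsSymbol Γ w k f) (hfg : EqOn f g S.exterior) :
    S.IsSymbol Γ w k g := fun j hj => by
  obtain ⟨C, hC, hf⟩ := h j hj
  exact ⟨C, hC, fun p hp => by rw [← iterate_L_congr hfg j (hΓ hp)]; exact hf p hp⟩

lemma IsSymbol.mono (hΓ : Γ ⊆ S.exterior) {c : ℝ} (hc : 0 ≤ c) (hw : ∀ p ∈ Γ, w p ≤ c * w' p)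
    (h : S.IsSymbol Γ w k f) : S.IsSymbol Γ w' k f := fun j hj => by
  obtain ⟨C, hC, hf⟩ := h j hj
  refine ⟨C * c, by positivity, fun p hp => (hf p hp).trans ?_⟩
  have hr := pos_of_mem (hΓ hp)
  calc C * (w p / p.2 ^ j) ≤ C * (c * w' p / p.2 ^ j) := by gcongr; exact hw p hp
    _ = _ := by ring

lemma IsSymbol.add (hΓ : Γ ⊆ S.exterior) (hfs : S.IsSmooth f) (hgs : S.IsSmooth g)
    (hf : S.IsSymbol Γ w k f) (hg : S.IsSymbol Γ w k g) :
    S.IsSymbol Γ w k fun p => f p + g p := fun j hj => by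
  obtain ⟨C, hC, hf⟩ := hf j hj
  obtain ⟨C', hC', hg⟩ := hg j hj
  refine ⟨C + C', by positivity, fun p hp => ?_⟩
  rw [iterate_L_add hfs hgs j (hΓ hp), add_mul]
  exact (abs_add_le _ _).trans (add_le_add (hf p hp) (hg p hp))

lemma IsSmooth.const_div_pow_mul (hf : S.IsSmooth f) (c : ℝ) (n : ℕ) :
    S.IsSmooth fun p => c / p.2 ^ n * f p :=
  (isSmooth_radial (contDiffOn_const_div_pow c n)).mul hf

lemma L_const_div_pow_mul (hf : S.IsSmooth f) (c : ℝ) (n : ℕ) (hp : p ∈ S.exterior) :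
    S.L (fun p => c / p.2 ^ n * f p) p = c / p.2 ^ n * S.L f p
      + (-(n * c / 2) / p.2 ^ (n + 1) * f p + n * c * S.M / p.2 ^ (n + 2) * f p) := by
  have hr := (pos_of_mem hp).ne'
  have h : S.L (fun p => c / p.2 ^ n * f p) p = _ :=
    along_radial_mul (contDiffOn_const_div_pow c n) hf hp (hasDerivAt_const_div_pow c n hr)
  rw [h, ← L, D]
  field_simp
  ring

lemma IsSymbol.const_div_pow_mul (hΓ : Γ ⊆ S.exterior) (hw : ∀ p ∈ Γ, 0 ≤ w p)
    (hfs : S.IsSmooth f) (hf : S.IsSymbol Γ w k f) (c : ℝ) (n : ℕ) :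
    S.IsSymbol Γ (fun p => w p / p.2 ^ n) k fun p => c / p.2 ^ n * f p := by
  have base {f w} (hf : S.IsSymbol Γ w 0 f) (c : ℝ) (n : ℕ) :
      S.IsSymbol Γ (fun p => w p / p.2 ^ n) 0 fun p => c / p.2 ^ n * f p := by
    obtain ⟨C, hC, hf⟩ := isSymbol_zero_iff.1 hf
    refine isSymbol_zero_iff.2 ⟨|c| * C, by positivity, fun p hp => ?_⟩
    have hr := pos_of_mem (hΓ hp)
    rw [abs_mul, abs_div, abs_of_pos (by positivity : 0 < p.2 ^ n)]
    calc |c| / p.2 ^ n * |f p| ≤ |c| / p.2 ^ n * (C * w p) := by gcongr; exact hf p hp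
      _ = _ := by ring
  induction k generalizing f w c n with
  | zero => exact base hf c n
  | succ k ih =>
    obtain ⟨hf₀, hLf⟩ := isSymbol_succ_iff.1 hf
    have hf' := hf.of_le (Nat.le_succ k)
    have h₁ := ih (fun p hp => div_nonneg (hw p hp) (pos_of_mem (hΓ hp)).le) hfs.L hLf c n
    have h₂ := ih hw hfs hf' (-(n * c / 2)) (n + 1)
    have h₃ := ih hw hfs hf' (n * c * S.M) (n + 2)
    refine isSymbol_succ_iff.2 ⟨base hf₀ c n, ?_⟩
    have hM := S.M_pos
    refine (IsSymbol.add hΓ (hfs.L.const_div_pow_mul _ _)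
      ((hfs.const_div_pow_mul _ _).add (hfs.const_div_pow_mul _ _))
      (h₁.mono hΓ zero_le_one fun p _ => ?_)
      ((h₂.mono hΓ zero_le_one fun p _ => ?_).add hΓ (hfs.const_div_pow_mul _ _)
        (hfs.const_div_pow_mul _ _)
        (h₃.mono hΓ (by positivity : 0 ≤ (2 * S.M)⁻¹) fun p hp => ?_))).congr hΓ
      fun p hp => (L_const_div_pow_mul hfs c n hp).symm
    · rw [one_mul, div_right_comm]
    · rw [one_mul, pow_succ, div_div]
    · have h2M : 2 * S.M ≤ p.2 := le_of_lt (hΓ hp).2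
      have hr := pos_of_mem (hΓ hp)
      have hwp := hw p hp
      calc w p / p.2 ^ (n + 2) = p.2⁻¹ * (w p / p.2 ^ n / p.2) := by
            field_simp
            ring
        _ ≤ _ := by gcongr

lemma IsWave.isSymbol_Lbar_L (hψ : S.IsWave f) (hΓ : Γ ⊆ S.exterior) (hw : ∀ p ∈ Γ, 0 ≤ w p)
    (hfs : S.IsSmooth f) (hf : S.IsSymbol Γ w k f) :
    S.IsSymbol Γ (fun p => w p / p.2 ^ 3) k (S.Lbar (S.L f)) := by
  have hM := S.M_pos
  refine (IsSymbol.add hΓ (hfs.const_div_pow_mul _ _) (hfs.const_div_pow_mul _ _)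
    (hf.const_div_pow_mul hΓ hw hfs (-(S.M / 2)) 3)
    ((hf.const_div_pow_mul hΓ hw hfs (S.M ^ 2) 4).mono hΓ (by positivity : 0 ≤ (2 * S.M)⁻¹)
      fun p hp => ?_)).congr hΓ fun p hp => ?_
  · have h2M : 2 * S.M ≤ p.2 := le_of_lt (hΓ hp).2
    have hr := pos_of_mem (hΓ hp)
    have hw := hw p hp
    calc w p / p.2 ^ 4 = p.2⁻¹ * (w p / p.2 ^ 3) := by field_simp
      _ ≤ _ := by gcongr
  · have hr := (pos_of_mem hp).ne'
    rw [hψ.Lbar_L hp, D]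
    field_simp
    ring

end Symbol

section SymbolDecay

/-! ### Decay of `L`-derivatives -/

variable {S : Setting} {f : ℝ × ℝ → ℝ} {p : ℝ × ℝ} {u₁ v w x : ℝ}

lemma region_subset_exterior : S.region u₁ ⊆ S.exterior := fun _ hp => hp.1

lemma tendsto_radius_atTop : Tendsto S.radius atTop atTop :=
  tendsto_atTop.2 fun b => by
    have hb : 2 * S.M < max b (2 * S.M + 1) := (lt_add_one _).trans_le (le_max_right _ _)
    filter_upwards [Ici_mem_atTop (S.rstar (max b (2 * S.M + 1)))] with x hx
    exact (le_max_left _ _).trans ((le_radius_iff hb).2 hx)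

lemma monotone_radius : Monotone S.radius := fun x y h =>
  (radius_le_iff (two_M_lt_radius S y)).2 (by rwa [rstar_radius])

lemma hasDerivAt_radius (S : Setting) (x : ℝ) :
    HasDerivAt S.radius (S.D (S.radius x)) x := by
  have hr := two_M_lt_radius S x
  have hsurj : Ioi (2 * S.M) ⊆ S.radius '' univ := fun r hr =>
    ⟨S.rstar r, mem_univ _, le_antisymm ((radius_le_iff hr).2 le_rfl) ((le_radius_iff hr).2 le_rfl)⟩
  have hcont : ContinuousAt S.radius x :=
    continuousAt_of_monotoneOn_of_image_mem_nhds (monotone_radius.monotoneOn univ) univ_mem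
      (mem_of_superset (Ioi_mem_nhds hr) hsurj)
  simpa using (hasDerivAt_rstar hr).of_local_left_inverse hcont (inv_ne_zero (D_pos hr).ne')
    (Eventually.of_forall (rstar_radius S))

lemma hasDerivAt_comp_radius (hf : S.IsSmooth f) (w : ℝ) (hv : S.v₀ < v) :
    HasDerivAt (fun v => f (v, S.radius ((v - w) / 2))) (S.L f (v, S.radius ((v - w) / 2))) v := by
  set p := (v, S.radius ((v - w) / 2)) with hp_def
  have hr := two_M_lt_radius S ((v - w) / 2)
  have hp : p ∈ S.exterior := ⟨hv.le, hr⟩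
  have hnhds : S.exterior ∈ 𝓝 p := prod_mem_nhds (Ici_mem_nhds hv) (Ioi_mem_nhds hr)
  have hcurve : HasDerivAt (fun v => (v, S.radius ((v - w) / 2))) (1, S.D p.2 / 2) v :=
    (hasDerivAt_id v).prodMk (((hasDerivAt_radius S _).comp v
      (((hasDerivAt_id v).sub_const w).div_const 2)).congr_deriv
        (by simp only [hp_def, id]; ring))
  rw [L, along_eq_fderivWithin_exterior hp]
  exact ((hf.differentiableWithinAt hp).hasFDerivWithinAt.hasFDerivAt hnhds).comp_hasDerivAt v
    hcurve

lemma abs_sub_le_of_abs_drIn_le_div_sq {C r r' : ℝ} (hf : S.IsSmooth f)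
    (h : ∀ p ∈ S.region u₁, |S.drIn f p| ≤ C / p.2 ^ 2) (hp : (v, r) ∈ S.region u₁) (hr : r ≤ r') :
    |f (v, r') - f (v, r)| ≤ C / r - C / r' := by
  have := abs_sub_le_of_abs_drIn_le (B := fun x => -(C / x)) (B' := fun x => C / x ^ 2) hf hp.1 hr
    (fun x hx => (hasDerivAt_const_div C ((pos_of_mem hp.1).trans_le hx.1).ne').neg.congr_deriv
      (neg_neg _))
    (fun x hx => h _ (mk_mem_region_of_le hp hx.1))
  linarith

/-- Along the outgoing cones `{u = w}`, the function `f` tends to `0` as `w → -∞` while its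
`v`-derivative `L f` converges uniformly, so that the limit of `L f` is the derivative of `0`. -/
lemma tendsto_L_of_v₀_lt (hf : S.IsSmooth f)
    (h₀ : ∀ v, S.v₀ ≤ v → Tendsto (fun r => f (v, r)) atTop (𝓝 0)) {C : ℝ} (hC : 0 ≤ C)
    (h : ∀ p ∈ S.region u₁, |S.drIn (S.L f) p| ≤ C / p.2 ^ 2) (hv : S.v₀ < v) :
    Tendsto (fun r => S.L f (v, r)) atTop (𝓝 0) := by
  set a := S.radius ((v + 1 - u₁) / 2)
  have ha : 2 * S.M < a := two_M_lt_radius S _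
  have hreg (v') (hv' : v' ∈ Ioo S.v₀ (v + 1)) : (v', a) ∈ S.region u₁ := by
    refine ⟨⟨hv'.1.le, ha⟩, ?_⟩
    simp only [u, a, rstar_radius]
    linarith [hv'.2]
  have hlim (v') (hv' : v' ∈ Ioo S.v₀ (v + 1)) :
      ∃ l, Tendsto (fun r => S.L f (v', r)) atTop (𝓝 l) ∧
        ∀ r, a ≤ r → |S.L f (v', r) - l| ≤ C / r :=
    exists_tendsto_of_abs_sub_le (tendsto_id.const_div_atTop C) fun r r' hr hrr' =>
      abs_sub_le_of_abs_drIn_le_div_sq hf.L h (mk_mem_region_of_le (hreg v' hv') hr) hrr'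
  choose! l hl hle using hlim
  have hradius (v') : Tendsto (fun w => S.radius ((v' - w) / 2)) atBot atTop :=
    tendsto_radius_atTop.comp
      ((tendsto_atTop_add_const_left _ _ tendsto_neg_atBot_atTop).atTop_div_const two_pos)
  have hunif : TendstoUniformlyOn (fun w v' => S.L f (v', S.radius ((v' - w) / 2))) l atBot
      (Ioo S.v₀ (v + 1)) := by
    refine Metric.tendstoUniformlyOn_iff.2 fun ε hε => ?_
    filter_upwards [(hradius S.v₀).eventually_ge_atTop a,
      ((tendsto_id.const_div_atTop C).comp (hradius S.v₀)).eventually (gt_mem_nhds hε)]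
      with w hwa hwε v' hv'
    have hmono : S.radius ((S.v₀ - w) / 2) ≤ S.radius ((v' - w) / 2) :=
      monotone_radius (by linarith [hv'.1])
    have hpos := pos_of_two_M_lt (two_M_lt_radius S ((S.v₀ - w) / 2))
    rw [dist_comm, Real.dist_eq]
    calc _ ≤ C / S.radius ((v' - w) / 2) := hle v' hv' _ (hwa.trans hmono)
      _ ≤ C / S.radius ((S.v₀ - w) / 2) := by gcongr
      _ < ε := hwε
  have hderiv : HasDerivAt (fun _ => (0 : ℝ)) (l v) v :=
    hasDerivAt_of_tendstoUniformlyOn isOpen_Ioo hunif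
      (Eventually.of_forall fun w v' hv' => hasDerivAt_comp_radius hf w hv'.1)
      (fun v' hv' => (h₀ v' hv'.1.le).comp (hradius v')) ⟨hv, lt_add_one v⟩
  have hl₀ : l v = 0 := hderiv.unique (hasDerivAt_const v 0)
  exact hl₀ ▸ hl v ⟨hv, lt_add_one v⟩

lemma tendsto_L (hf : S.IsSmooth f)
    (h₀ : ∀ v, S.v₀ ≤ v → Tendsto (fun r => f (v, r)) atTop (𝓝 0)) {C : ℝ} (hC : 0 ≤ C)
    (h : ∀ p ∈ S.region u₁, |S.drIn (S.L f) p| ≤ C / p.2 ^ 2) (hv : S.v₀ ≤ v) :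
    Tendsto (fun r => S.L f (v, r)) atTop (𝓝 0) := by
  rcases hv.lt_or_eq with hv | rfl
  · exact tendsto_L_of_v₀_lt hf h₀ hC h hv
  have hbound {v r} (hv : S.v₀ < v) (hp : (v, r) ∈ S.region u₁) : |S.L f (v, r)| ≤ C / r := by
    have hr := pos_of_mem hp.1
    exact abs_le_of_tendsto_zero (b := fun r => C / r) (tendsto_L_of_v₀_lt hf h₀ hC h hv)
      (fun r' hr' => by have := hr.trans_le hr'; positivity)
      (fun r' hr' => abs_sub_le_of_abs_drIn_le_div_sq hf.L h hp hr')
  refine squeeze_zero_norm' ?_ (tendsto_id.const_div_atTop C)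
  filter_upwards [Ici_mem_atTop (S.radius ((S.v₀ + 1 - u₁) / 2))] with r hr
  have hr2M : 2 * S.M < r := (two_M_lt_radius S _).trans_le hr
  have hcont : ContinuousWithinAt (fun v => S.L f (v, r)) (Ioi S.v₀) S.v₀ :=
    (hf.L.continuousOn (S.v₀, r) ⟨self_mem_Ici, hr2M⟩).comp (f := fun v => (v, r)) (by fun_prop)
      fun v hv => ⟨(mem_Ioi.1 hv).le, hr2M⟩
  refine le_of_tendsto hcont.norm ?_
  filter_upwards [Ioo_mem_nhdsGT (lt_add_one S.v₀)] with v hv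
  refine hbound hv.1 ⟨⟨hv.1.le, hr2M⟩, ?_⟩
  have := (radius_le_iff hr2M).1 hr
  simp only [u]
  linarith [hv.2]

lemma exists_abs_le_of_abs_Lbar_le_delay_rpow (hf : S.IsSmooth f)
    (h₀ : ∀ v, S.v₀ ≤ v → Tendsto (fun r => f (v, r)) atTop (𝓝 0)) {C a q η : ℝ} (hC : 0 ≤ C)
    (hη : 0 < η) (ha : a ≤ 1 + η) (hq : 1 - a + η ≤ q)
    (h : ∀ p ∈ S.region u₁, |S.Lbar f p| ≤ C * (S.delay u₁ p ^ (-a) * p.2 ^ (-q))) :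
    ∃ B, 0 ≤ B ∧
      ∀ p ∈ S.region u₁, |f p| ≤ B * (S.delay u₁ p ^ (-η) * p.2 ^ (-q + (1 - a + η))) := by
  obtain ⟨κ, hκ, hdelay⟩ := exists_delay_le S u₁
  set s := 1 - a + η with hs
  have hs₀ : 0 ≤ s := by linarith
  refine ⟨C * κ ^ s / η, by positivity, ?_⟩
  rintro ⟨v, r⟩ hp
  have hr : 0 < r := pos_of_mem hp.1
  have hLbar (x) (hx : r ≤ x) : |S.Lbar f (v, x)| ≤
      C * r ^ (-q + s) * κ ^ s * S.delay u₁ (v, x) ^ (-η - 1) := by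
    have hm := mk_mem_region_of_le hp hx
    have hx₀ : 0 < x := hr.trans_le hx
    have hd := delay_pos hm
    have hκx : (S.delay u₁ (v, x)) ^ s ≤ κ ^ s * x ^ s := by
      rw [← Real.mul_rpow hκ hx₀.le]
      exact Real.rpow_le_rpow hd.le (hdelay _ hm) hs₀
    have hxs : x ^ (-s) ≤ κ ^ s * S.delay u₁ (v, x) ^ (-s) := by
      rw [Real.rpow_neg hx₀.le, Real.rpow_neg hd.le, ← div_eq_mul_inv, le_div_iff₀ (by positivity),
        inv_mul_le_iff₀ (by positivity), mul_comm]
      exact hκx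
    have hrx : x ^ (-q + s) ≤ r ^ (-q + s) := Real.rpow_le_rpow_of_nonpos hr hx (by linarith)
    calc |S.Lbar f (v, x)| ≤ C * (S.delay u₁ (v, x) ^ (-a) * x ^ (-q)) := h _ hm
      _ = C * (S.delay u₁ (v, x) ^ (-a) * (x ^ (-q + s) * x ^ (-s))) := by
        rw [← Real.rpow_add hx₀]; ring_nf
      _ ≤ C * (S.delay u₁ (v, x) ^ (-a) *
            (r ^ (-q + s) * (κ ^ s * S.delay u₁ (v, x) ^ (-s)))) := by gcongr
      _ = _ := by
        rw [show -η - 1 = -a + -s by rw [hs]; ring, Real.rpow_add hd]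
        ring
  calc |f (v, r)| ≤ C * r ^ (-q + s) * κ ^ s / η * S.delay u₁ (v, r) ^ (-η) :=
        abs_le_of_abs_Lbar_le (b := fun y => C * r ^ (-q + s) * κ ^ s / η * y ^ (-η))
          (b' := fun y => C * r ^ (-q + s) * κ ^ s * y ^ (-η - 1)) hf (h₀ v hp.1.1) hp
          (fun y hy => by positivity)
          (fun y hy => hasDerivAt_mul_rpow_neg _ hη.ne' (by linarith)) hLbar
    _ = _ := by ring

lemma exists_two_div_D_le {a : ℝ} (ha : 2 * S.M < a) :
    ∃ c, 0 < c ∧ ∀ r, a ≤ r → 2 / S.D r ≤ c := by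
  have hM := S.M_pos
  have hDa := D_pos ha
  have ha₀ := pos_of_two_M_lt ha
  refine ⟨2 / S.D a, by positivity, fun r hr => ?_⟩
  gcongr
  simp only [D]
  gcongr

lemma IsWave.exists_abs_Lbar_iterate_L_le (hf : S.IsSmooth f) (hw : S.IsWave f) {k : ℕ}
    (hsym : S.IsSymbol (S.region u₁) (fun p => (S.delay u₁ p)⁻¹) k f) :
    ∃ C, 0 ≤ C ∧ ∀ p ∈ S.region u₁,
      |S.Lbar (S.L^[k + 1] f) p| ≤ C * (S.delay u₁ p ^ (-1 : ℝ) * p.2 ^ (-(3 + k : ℝ))) := by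
  obtain ⟨C, hC, h⟩ := hw.isSymbol_Lbar_L region_subset_exterior
    (fun p hp => (inv_pos.2 (delay_pos hp)).le) hf hsym k le_rfl
  refine ⟨C, hC, fun p hp => ?_⟩
  rw [Function.iterate_succ_apply, Lbar_iterate_L hf.L k hp.1]
  have hr := pos_of_mem hp.1
  convert h p hp using 2
  rw [Real.rpow_neg_one, Real.rpow_neg hr.le, show (3 + k : ℝ) = (3 + k : ℕ) by push_cast; rfl,
    Real.rpow_natCast, pow_add, div_div, div_eq_mul_inv]

lemma IsWave.tendsto_iterate_L (hf : S.IsSmooth f) (hw : S.IsWave f) {k : ℕ}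
    (hsym : S.IsSymbol (S.region u₁) (fun p => (S.delay u₁ p)⁻¹) k f)
    (h : ∀ v, S.v₀ ≤ v → Tendsto (fun r => S.L^[k] f (v, r)) atTop (𝓝 0)) (hv : S.v₀ ≤ v) :
    Tendsto (fun r => S.L^[k + 1] f (v, r)) atTop (𝓝 0) := by
  have hM := S.M_pos
  obtain ⟨C, hC, hLbar⟩ := hw.exists_abs_Lbar_iterate_L_le hf hsym
  obtain ⟨c, hc, hcD⟩ := exists_two_div_D_le (two_M_lt_innerRadius (S := S) (u₁ := u₁))
  rw [Function.iterate_succ_apply'] at hLbar ⊢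
  refine tendsto_L (u₁ := u₁) (C := c * (C * (2 * S.M) ^ (-(3 + k : ℝ) - (-2)))) (hf.iterate_L k) h
    (by positivity) (fun p hp => ?_) hv
  have hr := pos_of_mem hp.1
  have hD := D_pos hp.1.2
  have hpow : p.2 ^ (-(3 + k : ℝ)) ≤ (2 * S.M) ^ (-(3 + k : ℝ) - (-2)) * p.2 ^ (-2 : ℝ) :=
    rpow_le_const_mul_rpow (by positivity) (le_of_lt hp.1.2) (by linarith [k.cast_nonneg (α := ℝ)])
  have hinv : S.delay u₁ p ^ (-1 : ℝ) ≤ 1 :=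
    Real.rpow_le_one_of_one_le_of_nonpos (one_le_delay hp) (by norm_num)
  rw [drIn_eq_Lbar hp.1, abs_mul, abs_neg, abs_of_pos (by positivity)]
  calc 2 / S.D p.2 * |S.Lbar (S.L (S.L^[k] f)) p|
      ≤ c * (C * (1 * ((2 * S.M) ^ (-(3 + k : ℝ) - (-2)) * p.2 ^ (-2 : ℝ)))) := by
        gcongr
        · exact hcD p.2 (innerRadius_le hp)
        · exact (hLbar p hp).trans (by gcongr)
    _ = _ := by
        rw [Real.rpow_neg hr.le, Real.rpow_ofNat]
        ring

lemma IsWave.isSymbol_inv_delay (hf : S.IsSmooth f) (hw : S.IsWave f)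
    (h₀ : ∀ v, S.v₀ ≤ v → Tendsto (fun r => f (v, r)) atTop (𝓝 0)) {B : ℝ} (hB₀ : 0 ≤ B)
    (hB : ∀ p ∈ S.region u₁, |f p| ≤ B / S.delay u₁ p) (k : ℕ) :
    S.IsSymbol (S.region u₁) (fun p => (S.delay u₁ p)⁻¹) k f ∧
      ∀ v, S.v₀ ≤ v → Tendsto (fun r => S.L^[k] f (v, r)) atTop (𝓝 0) := by
  induction k with
  | zero => exact ⟨isSymbol_zero_iff.2 ⟨B, hB₀, by simpa only [div_eq_mul_inv] using hB⟩, h₀⟩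
  | succ k ih =>
    obtain ⟨hsym, hlim⟩ := ih
    have hlim' (v) (hv : S.v₀ ≤ v) := hw.tendsto_iterate_L hf hsym hlim hv
    refine ⟨fun j hj => ?_, hlim'⟩
    rcases hj.lt_or_eq with hj | rfl
    · exact hsym j (by omega)
    have hM := S.M_pos
    obtain ⟨C, hC, hLbar⟩ := hw.exists_abs_Lbar_iterate_L_le hf hsym
    obtain ⟨C', hC', hL⟩ := exists_abs_le_of_abs_Lbar_le_delay_rpow (hf.iterate_L (k + 1)) hlim' hC
      one_pos (by norm_num) (by linarith [k.cast_nonneg (α := ℝ)]) hLbar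
    simp only [sub_self, zero_add] at hL
    refine ⟨C' * (2 * S.M) ^ (-(3 + k : ℝ) + 1 - (-(k + 1 : ℕ))), by positivity,
      fun p hp => (hL p hp).trans ?_⟩
    have hr := pos_of_mem hp.1
    have hd := delay_pos hp
    have hpow : p.2 ^ (-(3 + k : ℝ) + 1) ≤
        (2 * S.M) ^ (-(3 + k : ℝ) + 1 - (-(k + 1 : ℕ))) * p.2 ^ (-(k + 1 : ℕ) : ℝ) :=
      rpow_le_const_mul_rpow (by positivity) (le_of_lt hp.1.2) (by push_cast; linarith)
    rw [Real.rpow_neg hr.le ((k + 1 : ℕ) : ℝ), Real.rpow_natCast] at hpow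
    rw [Real.rpow_neg_one]
    calc _ ≤ C' * ((S.delay u₁ p)⁻¹ *
          ((2 * S.M) ^ (-(3 + k : ℝ) + 1 - (-(k + 1 : ℕ))) * (p.2 ^ (k + 1))⁻¹)) := by gcongr
      _ = _ := by ring

lemma IsWave.exists_abs_iterate_L_le (hf : S.IsSmooth f) (hw : S.IsWave f)
    (h₀ : ∀ v, S.v₀ ≤ v → Tendsto (fun r => f (v, r)) atTop (𝓝 0)) {B : ℝ} (hB₀ : 0 ≤ B)
    (hB : ∀ p ∈ S.region u₁, |f p| ≤ B / S.delay u₁ p) (k : ℕ) {η : ℝ} (hη : 0 < η)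
    (hηk : η ≤ 3 + k) :
    ∃ C, 0 ≤ C ∧ ∀ p ∈ S.region u₁,
      |S.L^[k + 1] f p| ≤ C * (S.delay u₁ p ^ (-η) * p.2 ^ (-(3 + k) + η : ℝ)) := by
  obtain ⟨C, hC, hLbar⟩ := hw.exists_abs_Lbar_iterate_L_le hf
    (hw.isSymbol_inv_delay hf h₀ hB₀ hB k).1
  simpa only [sub_self, zero_add] using
    exists_abs_le_of_abs_Lbar_le_delay_rpow (hf.iterate_L (k + 1))
      (hw.isSymbol_inv_delay hf h₀ hB₀ hB (k + 1)).2 hC hη (by linarith) (by linarith) hLbar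

end SymbolDecay

section Expansion

/-! ### The expansion along an outgoing cone -/

variable {S : Setting} {f : ℝ × ℝ → ℝ} {p : ℝ × ℝ} {B B' I P a β δ η r u₁ v w : ℝ}

lemma contDiffOn_rstar : ContDiffOn ℝ ∞ S.rstar (Ioi (2 * S.M)) := by
  obtain ⟨c, hc⟩ := exists_rstar_eq_add_log S
  have hlog : ContDiffOn ℝ ∞ (fun r => Real.log (r - 2 * S.M)) (Ioi (2 * S.M)) :=
    (contDiffOn_id.sub contDiffOn_const).log fun r hr => (sub_pos.2 hr).ne'
  exact (contDiffOn_const.add (contDiffOn_id.add (contDiffOn_const.mul hlog))).congr hc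

lemma isSmooth_two_mul_sub_delay (S : Setting) (u₁ : ℝ) :
    S.IsSmooth fun p => 2 * p.2 - S.delay u₁ p :=
  (contDiffOn_const.mul contDiffOn_snd).sub (contDiffOn_const.add (contDiffOn_const.sub
    (contDiffOn_fst.sub (contDiffOn_const.mul (isSmooth_radial contDiffOn_rstar)))))

lemma Lbar_two_mul_sub_delay (hp : p ∈ S.exterior) :
    S.Lbar (fun q => 2 * q.2 - S.delay u₁ q) p = 2 * S.M / p.2 := by
  have h : HasDerivWithinAt (fun x => 2 * x - S.delay u₁ (p.1, x)) (2 - 2 / S.D p.2) (Ici p.2)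
      p.2 :=
    ((((hasDerivAt_id p.2).const_mul 2).sub (hasDerivAt_delay hp.2)).congr_deriv
      (by ring)).hasDerivWithinAt
  have hD := (D_pos hp.2).ne'
  rw [Lbar_eq, (uniqueDiffOn_Ici p.2 p.2 self_mem_Ici).eq_deriv _
    (hasDerivWithinAt_mk (isSmooth_two_mul_sub_delay S u₁) hp) h]
  calc -(S.D p.2 / 2) * (2 - 2 / S.D p.2) = 1 - S.D p.2 := by field_simp; ring
    _ = 2 * S.M / p.2 := by rw [D]; ring

lemma IsWave.Lbar_L_L (hf : S.IsSmooth f) (hw : S.IsWave f) (hp : p ∈ S.exterior) :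
    S.Lbar (S.L (S.L f)) p = -(S.D p.2 / 2) *
      (S.M / p.2 ^ 3 * S.L f p + (4 * S.M ^ 2 / p.2 ^ 5 - 3 * S.M / 2 / p.2 ^ 4) * f p) := by
  have hLbar (q) (hq : q ∈ S.exterior) :
      S.Lbar (S.L f) q = -(S.M / 2) / q.2 ^ 3 * f q + S.M ^ 2 / q.2 ^ 4 * f q := by
    have hr := (pos_of_mem hq).ne'
    rw [hw.Lbar_L hq, D]
    field_simp
    ring
  have hr := (pos_of_mem hp).ne'
  rw [Setting.Lbar_L hf.L hp, show S.L (S.Lbar (S.L f)) p = _ from along_congr hLbar hp,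
    along_add (hf.const_div_pow_mul _ _) (hf.const_div_pow_mul _ _) hp, ← L,
    L_const_div_pow_mul hf _ _ hp, L_const_div_pow_mul hf _ _ hp, D]
  field_simp
  ring

variable (S) in
/-- Along the cone `{u = u₁}`, where `delay = 1`, this is `r⁻² ∂_r (r³ L f + M I log r)` up to a
multiple of `L (L f)`. The weight `2 r - delay` makes the leading terms of its derivative along
ingoing cones cancel when `f` is a solution with leading part `2 I / delay`. -/
def scaling (u₁ I : ℝ) (f : ℝ × ℝ → ℝ) (p : ℝ × ℝ) : ℝ :=
  3 * S.L f p + (2 * p.2 - S.delay u₁ p) * S.L (S.L f) p + S.M * I / p.2 ^ 3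

lemma isSmooth_const_div_pow (c : ℝ) (n : ℕ) : S.IsSmooth fun p => c / p.2 ^ n :=
  isSmooth_radial (contDiffOn_const_div_pow c n)

lemma IsSmooth.scaling (hf : S.IsSmooth f) : S.IsSmooth (S.scaling u₁ I f) :=
  ((contDiffOn_const.mul hf.L).add ((isSmooth_two_mul_sub_delay S u₁).mul hf.L.L)).add
    (isSmooth_const_div_pow _ _)

lemma IsWave.Lbar_scaling (hf : S.IsSmooth f) (hw : S.IsWave f) (hp : p ∈ S.exterior) :
    S.Lbar (S.scaling u₁ I f) p =
      -(S.D p.2 / 2) * (3 * S.M / 2 / p.2 ^ 4 * (S.delay u₁ p * f p - 2 * I)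
          + (2 * p.2 - S.delay u₁ p) * (4 * S.M ^ 2 / p.2 ^ 5 * f p + S.M / p.2 ^ 3 * S.L f p))
        + 2 * S.M / p.2 * S.L (S.L f) p := by
  have hr := (pos_of_mem hp).ne'
  have h3L : S.Lbar (fun q => 3 * S.L f q) p = 3 * S.Lbar (S.L f) p := by
    rw [Lbar, along_mul contDiffOn_const hf.L hp, ← Lbar]
    simp [along, Lbar]
  have hprod : S.Lbar (fun q => (2 * q.2 - S.delay u₁ q) * S.L (S.L f) q) p = _ :=
    along_mul (isSmooth_two_mul_sub_delay S u₁) hf.L.L hp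
  have hconst : S.Lbar (fun q => S.M * I / q.2 ^ 3) p = _ :=
    along_radial hp (hasDerivAt_const_div_pow (S.M * I) 3 hr)
  have hsum : S.Lbar (S.scaling u₁ I f) p = S.Lbar (fun q => 3 * S.L f q) p
      + S.Lbar (fun q => (2 * q.2 - S.delay u₁ q) * S.L (S.L f) q) p
      + S.Lbar (fun q => S.M * I / q.2 ^ 3) p := by
    have h3 : S.IsSmooth fun q => 3 * S.L f q := contDiffOn_const.mul hf.L
    have h2 := (isSmooth_two_mul_sub_delay S u₁).mul hf.L.L
    exact (along_add (h3.add h2) (isSmooth_const_div_pow _ _) hp).trans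
      (congrArg (· + _) (along_add h3 h2 hp))
  rw [hsum, h3L, hprod, hconst, ← Lbar, Lbar_two_mul_sub_delay hp, hw.Lbar_L hp,
    hw.Lbar_L_L hf hp]
  push_cast
  field_simp
  ring

lemma IsWave.abs_Lbar_scaling_le (hf : S.IsSmooth f) (hw : S.IsWave f) (hp : p ∈ S.exterior) :
    |S.Lbar (S.scaling u₁ I f) p| ≤
      3 * S.M / 2 / p.2 ^ 4 * |S.delay u₁ p * f p - 2 * I|
        + |2 * p.2 - S.delay u₁ p| * (4 * S.M ^ 2 / p.2 ^ 5 * |f p| + S.M / p.2 ^ 3 * |S.L f p|)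
        + 2 * S.M / p.2 * |S.L (S.L f) p| := by
  have hM := S.M_pos
  have hr := pos_of_mem hp
  have hD := D_pos hp.2
  have hD2 : S.D p.2 / 2 ≤ 1 := by linarith [D_le_one (S := S) hr]
  rw [hw.Lbar_scaling hf hp, neg_mul]
  refine (abs_add_le _ _).trans (add_le_add ?_ (abs_mul_of_pos_left (by positivity) _).le)
  rw [abs_neg, abs_mul_of_pos_left (by positivity)]
  refine (mul_le_of_le_one_left (abs_nonneg _) hD2).trans ((abs_add_le _ _).trans
    (add_le_add (abs_mul_of_pos_left (by positivity) _).le ?_))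
  rw [abs_mul]
  gcongr
  exact (abs_add_le _ _).trans_eq (congrArg₂ (· + ·) (abs_mul_of_pos_left (by positivity) _)
    (abs_mul_of_pos_left (by positivity) _))

lemma exists_abs_two_mul_sub_delay_le (S : Setting) (u₁ : ℝ) :
    ∃ c, 0 ≤ c ∧ ∀ p ∈ S.region u₁, |2 * p.2 - S.delay u₁ p| ≤ c * p.2 := by
  obtain ⟨κ, hκ, h⟩ := exists_delay_le S u₁
  refine ⟨2 + κ, by positivity, fun p hp => abs_le.2 ⟨?_, ?_⟩⟩ <;>
    nlinarith [h p hp, delay_pos hp, pos_of_mem hp.1]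

lemma IsWave.exists_abs_iterate_L_le_div_pow (hf : S.IsSmooth f) (hw : S.IsWave f)
    (h₀ : ∀ v, S.v₀ ≤ v → Tendsto (fun r => f (v, r)) atTop (𝓝 0)) (hB₀ : 0 ≤ B)
    (hB : ∀ p ∈ S.region u₁, |f p| ≤ B / S.delay u₁ p) (hδ : 0 < δ) (hδ1 : δ ≤ 1) (k : ℕ) :
    ∃ C, 0 ≤ C ∧ ∀ p ∈ S.region u₁,
      |S.L^[k + 1] f p| ≤ C * (S.delay u₁ p ^ (-δ) / p.2 ^ (k + 2)) := by
  have hM := S.M_pos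
  obtain ⟨C, hC, h⟩ := hw.exists_abs_iterate_L_le hf h₀ hB₀ hB k hδ
    (by linarith [k.cast_nonneg (α := ℝ)])
  refine ⟨C * (2 * S.M) ^ (-(3 + k : ℝ) + δ - (-(k + 2 : ℕ))), by positivity,
    fun p hp => (h p hp).trans ?_⟩
  have hd := delay_pos hp
  have hr := pos_of_mem hp.1
  have hpow := rpow_le_const_mul_rpow (q := -(3 + k : ℝ) + δ) (q' := -(k + 2 : ℕ))
    (by positivity) (le_of_lt hp.1.2) (by push_cast; linarith)
  rw [Real.rpow_neg hr.le (k + 2 : ℕ), Real.rpow_natCast] at hpow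
  calc _ ≤ C * (S.delay u₁ p ^ (-δ) *
        ((2 * S.M) ^ (-(3 + k : ℝ) + δ - (-(k + 2 : ℕ))) * (p.2 ^ (k + 2))⁻¹)) := by gcongr
    _ = _ := by ring

lemma IsWave.exists_abs_Lbar_scaling_le (hf : S.IsSmooth f) (hw : S.IsWave f)
    (h₀ : ∀ v, S.v₀ ≤ v → Tendsto (fun r => f (v, r)) atTop (𝓝 0)) (hB₀ : 0 ≤ B)
    (hB : ∀ p ∈ S.region u₁, |f p| ≤ B / S.delay u₁ p) (hB'₀ : 0 ≤ B')
    (hB' : ∀ p ∈ S.region u₁, |f p - 2 * I / S.delay u₁ p| ≤ B' * S.delay u₁ p ^ (-1 - δ))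
    (hδ : 0 < δ) (hδ1 : δ ≤ 1) :
    ∃ A, 0 ≤ A ∧ ∀ p ∈ S.region u₁,
      |S.Lbar (S.scaling u₁ I f) p| ≤ A * (S.delay u₁ p ^ (-δ) * p.2 ^ (-4 : ℝ)) := by
  have hM := S.M_pos
  obtain ⟨c, hc, hweight⟩ := exists_abs_two_mul_sub_delay_le S u₁
  obtain ⟨C₁, hC₁, hL⟩ := hw.exists_abs_iterate_L_le_div_pow hf h₀ hB₀ hB hδ hδ1 0
  obtain ⟨C₂, hC₂, hLL⟩ := hw.exists_abs_iterate_L_le_div_pow hf h₀ hB₀ hB hδ hδ1 1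
  refine ⟨3 * S.M / 2 * B' + c * (4 * S.M ^ 2 * B + S.M * C₁) + 2 * S.M * C₂, by positivity,
    fun p hp => ?_⟩
  have hd := delay_pos hp
  have hr := pos_of_mem hp.1
  have hprofile : |S.delay u₁ p * f p - 2 * I| ≤ B' * S.delay u₁ p ^ (-δ) := by
    calc |S.delay u₁ p * f p - 2 * I| = S.delay u₁ p * |f p - 2 * I / S.delay u₁ p| := by
          rw [← abs_of_pos hd, ← abs_mul, abs_of_pos hd, mul_sub, mul_div_cancel₀ _ hd.ne']
      _ ≤ S.delay u₁ p * (B' * S.delay u₁ p ^ (-1 - δ)) := by gcongr; exact hB' p hp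
      _ = _ := by rw [show -δ = 1 + (-1 - δ) by ring, Real.rpow_add hd, Real.rpow_one]; ring_nf
  have hf' : |f p| ≤ B * S.delay u₁ p ^ (-δ) := by
    refine (hB p hp).trans ?_
    rw [div_eq_mul_inv, ← Real.rpow_neg_one]
    gcongr
    · exact one_le_delay hp
  calc |S.Lbar (S.scaling u₁ I f) p| ≤ _ := hw.abs_Lbar_scaling_le hf hp.1
    _ ≤ 3 * S.M / 2 / p.2 ^ 4 * (B' * S.delay u₁ p ^ (-δ))
          + c * p.2 * (4 * S.M ^ 2 / p.2 ^ 5 * (B * S.delay u₁ p ^ (-δ))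
            + S.M / p.2 ^ 3 * (C₁ * (S.delay u₁ p ^ (-δ) / p.2 ^ 2)))
        + 2 * S.M / p.2 * (C₂ * (S.delay u₁ p ^ (-δ) / p.2 ^ 3)) := by
        gcongr
        · exact hweight p hp
        · exact hL p hp
        · exact hLL p hp
    _ = _ := by
        rw [Real.rpow_neg hr.le, Real.rpow_ofNat]
        field_simp

lemma eventually_mk_mem_region (hv : S.v₀ ≤ v) (u₁ : ℝ) : ∀ᶠ r in atTop, (v, r) ∈ S.region u₁ := by
  filter_upwards [Ioi_mem_atTop (2 * S.M), (tendsto_delay S u₁ v).eventually_ge_atTop 1]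
    with r hr hd
  rw [delay] at hd
  exact ⟨⟨hv, hr⟩, by linarith⟩

lemma IsWave.tendsto_scaling (hf : S.IsSmooth f) (hw : S.IsWave f)
    (h₀ : ∀ v, S.v₀ ≤ v → Tendsto (fun r => f (v, r)) atTop (𝓝 0)) (hB₀ : 0 ≤ B)
    (hB : ∀ p ∈ S.region u₁, |f p| ≤ B / S.delay u₁ p) (hv : S.v₀ ≤ v) :
    Tendsto (fun r => S.scaling u₁ I f (v, r)) atTop (𝓝 0) := by
  obtain ⟨c, hc, hweight⟩ := exists_abs_two_mul_sub_delay_le S u₁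
  obtain ⟨C, hC, hLL⟩ := (hw.isSymbol_inv_delay hf h₀ hB₀ hB 2).1 2 le_rfl
  have hL : Tendsto (fun r => S.L f (v, r)) atTop (𝓝 0) :=
    (hw.isSymbol_inv_delay hf h₀ hB₀ hB 1).2 v hv
  have hprod : Tendsto (fun r => (2 * r - S.delay u₁ (v, r)) * S.L (S.L f) (v, r)) atTop (𝓝 0) := by
    refine squeeze_zero_norm' ?_ (tendsto_id.const_div_atTop (c * C))
    filter_upwards [eventually_mk_mem_region hv u₁] with r hr
    have hr₀ : 0 < r := pos_of_mem hr.1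
    have hinv : (S.delay u₁ (v, r))⁻¹ ≤ 1 := inv_le_one_of_one_le₀ (one_le_delay hr)
    rw [norm_mul, Real.norm_eq_abs, Real.norm_eq_abs]
    calc _ ≤ c * r * (C * (1 / r ^ 2)) := by
          gcongr
          · exact hweight _ hr
          · exact (hLL _ hr).trans (by gcongr)
      _ = c * C / r := by field_simp
  have hconst : Tendsto (fun r : ℝ => S.M * I / r ^ 3) atTop (𝓝 0) :=
    (tendsto_pow_atTop three_ne_zero).const_div_atTop _
  simpa [scaling] using ((hL.const_mul 3).add hprod).add hconst

lemma IsWave.exists_abs_scaling_le (hf : S.IsSmooth f) (hw : S.IsWave f)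
    (h₀ : ∀ v, S.v₀ ≤ v → Tendsto (fun r => f (v, r)) atTop (𝓝 0)) (hB₀ : 0 ≤ B)
    (hB : ∀ p ∈ S.region u₁, |f p| ≤ B / S.delay u₁ p) (hB'₀ : 0 ≤ B')
    (hB' : ∀ p ∈ S.region u₁, |f p - 2 * I / S.delay u₁ p| ≤ B' * S.delay u₁ p ^ (-1 - δ))
    (hβ : 0 < β) (hβδ : β < δ) (hδ1 : δ ≤ 1) :
    ∃ P, 0 ≤ P ∧ ∀ p ∈ S.region u₁, S.u p = u₁ → |S.scaling u₁ I f p| ≤ P * p.2 ^ (-3 - β) := by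
  obtain ⟨A, hA, hLbar⟩ := hw.exists_abs_Lbar_scaling_le hf h₀ hB₀ hB hB'₀ hB' (hβ.trans hβδ) hδ1
  obtain ⟨P, hP, h⟩ := exists_abs_le_of_abs_Lbar_le_delay_rpow (η := δ - β) hf.scaling
    (fun v hv => hw.tendsto_scaling hf h₀ hB₀ hB hv) hA (by linarith) (by linarith) (by linarith)
    hLbar
  refine ⟨P, hP, fun p hp hu => (h p hp).trans_eq ?_⟩
  rw [delay, hu, sub_self, add_zero, Real.one_rpow, one_mul]
  ring_nf

lemma drOut_pow_mul_L_add_log (hf : S.IsSmooth f) (hp : p ∈ S.exterior) (hu : S.u p = u₁) (I : ℝ) :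
    S.drOut (fun q => q.2 ^ 3 * S.L f q + S.M * I * Real.log q.2) p
      = p.2 ^ 2 * S.scaling u₁ I f p + p.2 ^ 2 * (1 + 2 * S.M * (2 / S.D p.2)) * S.L (S.L f) p := by
  have hr := (pos_of_mem hp).ne'
  have hD := (D_pos hp.2).ne'
  have hpow : ContDiffOn ℝ ∞ (fun r : ℝ => r ^ 3) (Ioi (2 * S.M)) := by fun_prop
  have hlog : ContDiffOn ℝ ∞ (fun r => S.M * I * Real.log r) (Ioi (2 * S.M)) :=
    contDiffOn_const.mul (contDiffOn_id.log fun r hr => (pos_of_two_M_lt hr).ne')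
  have h₁ : S.drOut (fun q => q.2 ^ 3 * S.L f q) p = _ :=
    along_radial_mul hpow hf.L hp (hasDerivAt_pow 3 p.2)
  have h₂ : S.drOut (fun q => S.M * I * Real.log q.2) p = _ :=
    along_radial hp ((Real.hasDerivAt_log hr).const_mul (S.M * I))
  have hsum : S.drOut (fun q => q.2 ^ 3 * S.L f q + S.M * I * Real.log q.2) p = _ :=
    along_add ((isSmooth_radial hpow).mul hf.L) (isSmooth_radial hlog) hp
  rw [hsum, ← drOut, h₁, h₂, ← drOut, drOut_eq_L hp, scaling, delay, hu]
  have hDr : S.D p.2 * p.2 = p.2 - 2 * S.M := by rw [D]; field_simp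
  field_simp
  push_cast
  linear_combination (-2 * p.2 ^ 3 * S.L (S.L f) p) * hDr

lemma exists_tendsto_of_abs_drOut_le (hf : S.IsSmooth f) (ha : S.outgoing w a ∈ S.exterior)
    (hβ : 0 < β)
    (h : ∀ r, a ≤ r → |S.drOut f (S.outgoing w r)| ≤ P * r ^ (-1 - β)) :
    ∃ l, ∀ r, a ≤ r → |f (S.outgoing w r) - l| ≤ P / β * r ^ (-β) := by
  have ha₀ : 0 < a := pos_of_mem ha
  have hlim : Tendsto (fun r : ℝ => P / β * r ^ (-β)) atTop (𝓝 0) := by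
    simpa using (tendsto_rpow_neg_atTop hβ).const_mul (P / β)
  obtain ⟨l, -, hl⟩ := exists_tendsto_of_abs_sub_le (f := fun r => f (S.outgoing w r)) hlim
    fun x y hx hxy => by
      have key := abs_sub_le_of_abs_drOut_le (B := fun r => -(P / β * r ^ (-β)))
        (B' := fun r => P * r ^ (-1 - β)) hf (outgoing_mem_exterior_of_le ha hx) hxy
        (fun r hr => ((hasDerivAt_mul_rpow_neg P hβ.ne'
          (ha₀.trans_le (hx.trans hr.1)).ne').neg.congr_deriv (by ring_nf)))
        (fun r hr => h r (hx.trans hr.1))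
      linarith
  exact ⟨l, hl⟩

lemma innerRadius_mem_region (S : Setting) (u₁ : ℝ) :
    S.outgoing u₁ (S.innerRadius u₁) ∈ S.region u₁ := by
  have h : S.outgoing u₁ (S.innerRadius u₁) = (S.v₀, S.innerRadius u₁) := by
    ext <;> simp [outgoing, innerRadius]; ring
  rw [h, mk_v₀_mem_region_iff two_M_lt_innerRadius]

lemma outgoing_mem_region_of_innerRadius_le (hr : S.innerRadius u₁ ≤ r) :
    S.outgoing u₁ r ∈ S.region u₁ :=
  ⟨outgoing_mem_exterior_of_le (innerRadius_mem_region S u₁).1 hr, (u_outgoing _ _).le⟩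

lemma IsWave.exists_abs_iterate_L_outgoing_le (hf : S.IsSmooth f) (hw : S.IsWave f)
    (h₀ : ∀ v, S.v₀ ≤ v → Tendsto (fun r => f (v, r)) atTop (𝓝 0)) (hB₀ : 0 ≤ B)
    (hB : ∀ p ∈ S.region u₁, |f p| ≤ B / S.delay u₁ p) (k : ℕ) (hη : 0 < η) (hηk : η ≤ 3 + k) :
    ∃ C, 0 ≤ C ∧ ∀ r, S.innerRadius u₁ ≤ r →
      |S.L^[k + 1] f (S.outgoing u₁ r)| ≤ C * r ^ (-(3 + k) + η : ℝ) := by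
  obtain ⟨C, hC, h⟩ := hw.exists_abs_iterate_L_le hf h₀ hB₀ hB k hη hηk
  refine ⟨C, hC, fun r hr => ?_⟩
  have hd : S.delay u₁ (S.outgoing u₁ r) = 1 := by simp [delay, u_outgoing]
  have hLr := h _ (outgoing_mem_region_of_innerRadius_le hr)
  rwa [hd, Real.one_rpow, one_mul] at hLr

lemma IsWave.exists_expansion_L (hf : S.IsSmooth f) (hw : S.IsWave f)
    (h₀ : ∀ v, S.v₀ ≤ v → Tendsto (fun r => f (v, r)) atTop (𝓝 0)) (hB₀ : 0 ≤ B)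
    (hB : ∀ p ∈ S.region u₁, |f p| ≤ B / S.delay u₁ p) (hB'₀ : 0 ≤ B')
    (hB' : ∀ p ∈ S.region u₁, |f p - 2 * I / S.delay u₁ p| ≤ B' * S.delay u₁ p ^ (-1 - δ))
    (hβ : 0 < β) (hβδ : β < δ) (hδ1 : δ ≤ 1) :
    ∃ J P, 0 ≤ P ∧ ∀ r, S.innerRadius u₁ ≤ r →
      |r ^ 3 * S.L f (S.outgoing u₁ r) + S.M * I * Real.log r - J| ≤ P * r ^ (-β) := by
  have hM := S.M_pos
  obtain ⟨A, hA, hscaling⟩ :=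
    hw.exists_abs_scaling_le hf h₀ hB₀ hB hB'₀ hB' hβ hβδ hδ1
  obtain ⟨C, hC, hLL⟩ := hw.exists_abs_iterate_L_outgoing_le hf h₀ hB₀ hB 1
    (η := 1 - β) (by linarith) (by norm_num; linarith)
  obtain ⟨c, hc, hcD⟩ := exists_two_div_D_le (two_M_lt_innerRadius (S := S) (u₁ := u₁))
  have hsmooth : S.IsSmooth fun q => q.2 ^ 3 * S.L f q + S.M * I * Real.log q.2 :=
    ((contDiffOn_snd.pow 3).mul hf.L).add (contDiffOn_const.mul
      (contDiffOn_snd.log fun q hq => (pos_of_mem hq).ne'))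
  obtain ⟨J, hJ⟩ := exists_tendsto_of_abs_drOut_le (P := A + (1 + 2 * S.M * c) * C) hsmooth
    (innerRadius_mem_region S u₁).1 hβ fun r hr => by
      have hp := outgoing_mem_region_of_innerRadius_le hr
      have hr₀ : 0 < r := pos_of_mem hp.1
      have hD : 0 < S.D r := D_pos hp.1.2
      have hexp : (-(3 + (1 : ℕ)) + (1 - β) : ℝ) = -3 - β := by push_cast; ring
      have hLL' : |S.L (S.L f) (S.outgoing u₁ r)| ≤ C * r ^ (-3 - β) := hexp ▸ hLL r hr
      rw [drOut_pow_mul_L_add_log hf hp.1 (u_outgoing _ _)]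
      refine (abs_add_le _ _).trans ?_
      rw [show (S.outgoing u₁ r).2 = r from rfl, abs_mul_of_pos_left (by positivity),
        abs_mul_of_pos_left (by positivity)]
      calc r ^ 2 * |S.scaling u₁ I f (S.outgoing u₁ r)|
            + r ^ 2 * (1 + 2 * S.M * (2 / S.D r)) * |S.L (S.L f) (S.outgoing u₁ r)|
          ≤ r ^ 2 * (A * r ^ (-3 - β)) + r ^ 2 * (1 + 2 * S.M * c) * (C * r ^ (-3 - β)) := by
            gcongr
            · exact hscaling _ hp (u_outgoing _ _)
            · exact hcD r hr
        _ = (A + (1 + 2 * S.M * c) * C) * r ^ (-1 - β) := by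
            rw [show -1 - β = (2 : ℕ) + (-3 - β) by push_cast; ring, Real.rpow_add hr₀,
              Real.rpow_natCast]
            ring
  exact ⟨J, _, by positivity, hJ⟩

lemma IsWave.exists_expansion (hf : S.IsSmooth f) (hw : S.IsWave f)
    (h₀ : ∀ v, S.v₀ ≤ v → Tendsto (fun r => f (v, r)) atTop (𝓝 0)) (hB₀ : 0 ≤ B)
    (hB : ∀ p ∈ S.region u₁, |f p| ≤ B / S.delay u₁ p) (hB'₀ : 0 ≤ B')
    (hB' : ∀ p ∈ S.region u₁, |f p - 2 * I / S.delay u₁ p| ≤ B' * S.delay u₁ p ^ (-1 - δ))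
    (hβ : 0 < β) (hβδ : β < δ) (hδ1 : δ ≤ 1) :
    ∃ J P, 0 ≤ P ∧ ∀ r, S.innerRadius u₁ ≤ r →
      |r ^ 3 * S.drOut f (S.outgoing u₁ r) + 2 * S.M * I * Real.log r - J| ≤ P * r ^ (-β) := by
  have hM := S.M_pos
  obtain ⟨J, P, hP, hJ⟩ := hw.exists_expansion_L hf h₀ hB₀ hB hB'₀ hB' hβ hβδ hδ1
  obtain ⟨C, hC, hL⟩ := hw.exists_abs_iterate_L_outgoing_le hf h₀ hB₀ hB 0
    (η := 1 - β) (by linarith) (by norm_num; linarith)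
  obtain ⟨c, hc, hcD⟩ := exists_two_div_D_le (two_M_lt_innerRadius (S := S) (u₁ := u₁))
  refine ⟨2 * J, 2 * P + 2 * S.M * c * C, by positivity, fun r hr => ?_⟩
  have hp := outgoing_mem_region_of_innerRadius_le hr
  have hr₀ : 0 < r := pos_of_mem hp.1
  have hD : 0 < S.D r := D_pos hp.1.2
  have hexp : (-(3 + (0 : ℕ)) + (1 - β) : ℝ) = -2 - β := by push_cast; ring
  have hL' : |S.L f (S.outgoing u₁ r)| ≤ C * r ^ (-2 - β) := hexp ▸ hL r hr
  have hsplit : r ^ 3 * S.drOut f (S.outgoing u₁ r) + 2 * S.M * I * Real.log r - 2 * J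
      = 2 * (r ^ 3 * S.L f (S.outgoing u₁ r) + S.M * I * Real.log r - J)
        + 2 * S.M * (2 / S.D r) * r ^ 2 * S.L f (S.outgoing u₁ r) := by
    have hDr : S.D r * r = r - 2 * S.M := by rw [D]; field_simp
    rw [drOut_eq_L hp.1, outgoing]
    field_simp
    linear_combination (-(r ^ 2 * S.L f (u₁ + 2 * S.rstar r, r))) * hDr
  rw [hsplit]
  refine (abs_add_le _ _).trans ?_
  rw [abs_mul_of_pos_left two_pos, abs_mul_of_pos_left (by positivity)]
  calc _ ≤ 2 * (P * r ^ (-β)) + 2 * S.M * c * r ^ 2 * (C * r ^ (-2 - β)) := by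
        gcongr
        · exact hJ r hr
        · exact hcD r hr
    _ = _ := by
        rw [show -β = (2 : ℕ) + (-2 - β) by push_cast; ring, Real.rpow_add hr₀, Real.rpow_natCast]
        ring_nf

end Expansion

section Hypersurface

/-! ### The hypersurface `Σ₀` -/

variable {S : Setting} {r : ℝ}

lemma D_nonneg (hr : 2 * S.M ≤ r) : 0 ≤ S.D r :=
  sub_nonneg.2 (div_le_one_of_le₀ hr (pos_of_two_M_le hr).le)

lemma h_nonneg (hr : 2 * S.M ≤ r) : 0 ≤ S.h r := by
  rcases le_or_gt r S.rH with hrH | hrH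
  · exact (S.h_inner r hr hrH).ge
  rcases lt_or_ge r S.R with hR | hR
  · exact (S.h_spacelike r hrH hR).1.le
  · rw [S.h_outer r hR]
    exact div_nonneg zero_le_two (D_nonneg hr)

lemma D_mul_h_le (hr : 2 * S.M ≤ r) : S.D r * S.h r ≤ 2 := by
  rcases le_or_gt r S.rH with hrH | hrH
  · simp [S.h_inner r hr hrH]
  rcases lt_or_ge r S.R with hR | hR
  · exact (S.h_spacelike r hrH hR).2.le
  · rw [S.h_outer r hR]
    exact (mul_div_cancel₀ _ (D_pos (S.two_M_lt_rH.trans hrH)).ne').le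

lemma exists_h_le (S : Setting) : ∃ H, 0 < H ∧ ∀ r, 2 * S.M ≤ r → S.h r ≤ H := by
  obtain ⟨c, hc, hcD⟩ := exists_two_div_D_le S.two_M_lt_rH
  refine ⟨c, hc, fun r hr => ?_⟩
  rcases le_or_gt r S.rH with hrH | hrH
  · exact (S.h_inner r hr hrH).trans_le hc.le
  · refine le_trans ?_ (hcD r hrH.le)
    rw [le_div_iff₀' (D_pos (S.two_M_lt_rH.trans hrH))]
    exact D_mul_h_le hr

lemma aestronglyMeasurable_h (S : Setting) :
    AEStronglyMeasurable S.h (volume.restrict (Ici (2 * S.M))) := by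
  have hinner : AEStronglyMeasurable S.h (volume.restrict (Icc (2 * S.M) S.rH)) :=
    ((continuousOn_const (c := (0 : ℝ))).congr
      fun x hx => S.h_inner x hx.1 hx.2).aestronglyMeasurable measurableSet_Icc
  have houter : AEStronglyMeasurable S.h (volume.restrict (Ici S.R)) := by
    have h : ContinuousOn (fun x => 2 / S.D x) (Ici S.R) :=
      continuousOn_const.div (contDiffOn_D.continuousOn.mono fun x hx => two_M_lt_R.trans_le hx)
        fun x hx => (D_pos (two_M_lt_R.trans_le hx)).ne'
    exact (h.congr fun x hx => S.h_outer x hx).aestronglyMeasurable measurableSet_Ici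
  refine (aestronglyMeasurable_union_iff.2 ⟨aestronglyMeasurable_union_iff.2
    ⟨hinner, S.h_piecewise.aestronglyMeasurable⟩, houter⟩).mono_set fun x hx => ?_
  rcases le_or_gt x S.rH with hrH | hrH
  · exact Or.inl (Or.inl ⟨hx, hrH⟩)
  rcases lt_or_ge x S.R with hR | hR
  · exact Or.inl (Or.inr ⟨hrH, hR⟩)
  · exact Or.inr hR

lemma intervalIntegrable_h (hr : 2 * S.M ≤ r) : IntervalIntegrable S.h volume (2 * S.M) r := by
  obtain ⟨H, -, hH⟩ := exists_h_le S
  rw [intervalIntegrable_iff_integrableOn_Ioc_of_le hr]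
  refine IntegrableOn.of_bound (by simp)
    ((aestronglyMeasurable_h S).mono_set fun x hx => hx.1.le) H ?_
  filter_upwards [ae_restrict_mem measurableSet_Ioc] with x hx
  rw [Real.norm_of_nonneg (h_nonneg hx.1.le)]
  exact hH x hx.1.le

lemma vSigma_outer (hr : S.R ≤ r) : S.vSigma r = 2 * S.rstar r := by
  have hR : 2 * S.M < S.R := two_M_lt_R
  have hadd : S.vSigma r = S.vSigma S.R + ∫ s in S.R..r, S.h s := by
    have hi := intervalIntegrable_h hR.le
    rw [vSigma, vSigma, add_assoc, intervalIntegral.integral_add_adjacent_intervals hi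
      (hi.symm.trans (intervalIntegrable_h (hR.le.trans hr)))]
  have hslope : ∫ s in S.R..r, S.h s = ∫ s in S.R..r, 2 * (S.D s)⁻¹ :=
    intervalIntegral.integral_congr fun x hx =>
      (S.h_outer x (uIcc_of_le hr ▸ hx).1).trans (div_eq_mul_inv _ _)
  rw [hadd, hslope, intervalIntegral.integral_const_mul, rstar]
  ring

lemma le_vSigma (hr : 2 * S.M ≤ r) : S.v₀ ≤ S.vSigma r :=
  le_add_of_nonneg_right (intervalIntegral.integral_nonneg hr fun _ hx => h_nonneg hx.1)

lemma vSigma_le_of_le {b : ℝ} (hr : 2 * S.M ≤ r) (hb : r ≤ b) : S.vSigma r ≤ S.vSigma b := by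
  refine add_le_add_right (intervalIntegral.integral_mono_interval le_rfl hr hb ?_
    (intervalIntegrable_h (hr.trans hb))) _
  filter_upwards [ae_restrict_mem measurableSet_Ioc] with x hx using h_nonneg hx.1.le

variable (S) in
/-- The outgoing null part `{u = 0, r ≥ R}` of `Σ₀`. -/
def outgoingCone : Set (ℝ × ℝ) := {p | S.u p = 0 ∧ S.R ≤ p.2}

lemma vSigma_eq_outgoing (hr : S.R ≤ r) : (S.vSigma r, r) = S.outgoing 0 r := by
  rw [vSigma_outer hr, outgoing, zero_add]

lemma outgoing_mem_outgoingCone (hr : S.R ≤ r) : S.outgoing 0 r ∈ S.outgoingCone :=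
  ⟨u_outgoing _ _, hr⟩

lemma vSigma_mem_outgoingCone (hr : S.R ≤ r) : (S.vSigma r, r) ∈ S.outgoingCone :=
  vSigma_eq_outgoing hr ▸ outgoing_mem_outgoingCone hr

lemma outgoingCone_subset_region : S.outgoingCone ⊆ S.region 0 := by
  intro p ⟨hu, hr⟩
  have hp : (S.vSigma p.2, p.2) = p := by
    rw [vSigma_eq_outgoing hr, ← hu, outgoing_u_snd]
  have hv : S.v₀ ≤ p.1 := (le_vSigma (two_M_lt_R.le.trans hr)).trans_eq (congrArg Prod.fst hp)
  exact ⟨⟨hv, two_M_lt_R.trans_le hr⟩, hu.le⟩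

lemma outgoingCone_subset_exterior : S.outgoingCone ⊆ S.exterior :=
  outgoingCone_subset_region.trans region_subset_exterior

end Hypersurface

section Energy

/-! ### Finiteness of the energies -/

variable {S : Setting} {f g : ℝ × ℝ → ℝ} {X : ℝ × ℝ → ℝ × ℝ} {p : ℝ × ℝ} {r : ℝ}

lemma outerNorm_lt_top {q s C : ℝ} (hqs : q + 2 * s < -1)
    (h : ∀ p ∈ S.outgoingCone, |f p| ≤ C * p.2 ^ s) : S.outerNorm q f < ⊤ := by
  rw [outerNorm, setLIntegral_congr Ioi_ae_eq_Ici.symm]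
  refine lintegral_Ioi_ofReal_lt_top_of_le_rpow R_pos hqs (C := C ^ 2) fun r hr => ?_
  have hr₀ : 0 < r := R_pos.trans hr
  have hf : f (S.vSigma r, r) ^ 2 ≤ (C * r ^ s) ^ 2 :=
    sq_le_sq.2 ((h _ (vSigma_mem_outgoingCone (le_of_lt hr))).trans (le_abs_self _))
  calc _ ≤ r ^ q * (C * r ^ s) ^ 2 := by gcongr
    _ = C ^ 2 * (r ^ q * (r ^ s * r ^ s)) := by ring
    _ = _ := by rw [← Real.rpow_add hr₀, ← Real.rpow_add hr₀, two_mul]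

lemma emTensor_outer (hr : S.R ≤ r) :
    S.emTensor f (S.vSigma r, r) (S.Nv r, S.Nr r) (S.normal r)
      = S.D r / 2 * S.drOut f (S.vSigma r, r) ^ 2 := by
  have hD := (D_pos (S := S) (two_M_lt_R.trans_le hr)).ne'
  have hn : S.normal r = (2 / S.D r, 1) := by
    rw [normal, S.h_outer r hr, ← D, mul_div_cancel₀ _ hD]
    norm_num
  have hdn : fderivWithin ℝ f S.dom (S.vSigma r, r) (2 / S.D r, 1)
      = 2 / S.D r * S.T f (S.vSigma r, r) + S.drIn f (S.vSigma r, r) :=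
    (along_eq (S := S) (fun _ => (2 / S.D r, 1)) f (S.vSigma r, r)).trans (by simp only [one_mul])
  rw [emTensor, hn, (S.N_outer r hr).1, (S.N_outer r hr).2, hdn, metric, drOut, along_eq, T, along]
  field_simp
  ring

lemma continuousOn_emTensor (hf : ContDiffOn ℝ ∞ f S.dom) {α : Type*} [TopologicalSpace α]
    {s : Set α} {p X Y : α → ℝ × ℝ} (hps : MapsTo p s S.dom) (hp : ContinuousOn p s)
    (hX : ContinuousOn X s) (hY : ContinuousOn Y s) :
    ContinuousOn (fun a => S.emTensor f (p a) (X a) (Y a)) s := by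
  have hdf : ContinuousOn (fun a => fderivWithin ℝ f S.dom (p a)) s :=
    (hf.fderivWithin uniqueDiffOn_dom (m := ∞) (by simp)).continuousOn.comp hp hps
  have hD : ContinuousOn (fun a => S.D (p a).2) s :=
    continuousOn_const.sub (continuousOn_const.div hp.snd fun a ha =>
      (pos_of_two_M_le (hps ha).2).ne')
  have hT : ContinuousOn (fun a => S.T f (p a)) s := hdf.clm_apply continuousOn_const
  have hR : ContinuousOn (fun a => S.drIn f (p a)) s := hdf.clm_apply continuousOn_const
  have hdX := hdf.clm_apply hX
  have hdY := hdf.clm_apply hY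
  unfold emTensor metric
  fun_prop

lemma exists_emTensor_le (hf : ContDiffOn ℝ ∞ f S.dom) :
    ∃ B, 0 ≤ B ∧ ∀ r ∈ Icc (2 * S.M) S.R,
      S.emTensor f (S.vSigma r, r) (S.Nv r, S.Nr r) (S.normal r) ≤ B := by
  obtain ⟨H, -, hH⟩ := exists_h_le S
  let K := (Icc S.v₀ (S.vSigma S.R) ×ˢ Icc (2 * S.M) S.R) ×ˢ Icc 0 H
  have hK : MapsTo Prod.fst K S.dom := fun q hq => ⟨hq.1.1.1, hq.1.2.1⟩
  have hD : ContinuousOn (fun q : (ℝ × ℝ) × ℝ => S.D q.1.2) K :=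
    continuousOn_const.sub (continuousOn_const.div continuousOn_fst.snd fun q hq =>
      (pos_of_two_M_le (hK hq).2).ne')
  have hNv := S.Nv_smooth.continuous
  have hNr := S.Nr_smooth.continuous
  obtain ⟨B, hB⟩ := ((isCompact_Icc.prod isCompact_Icc).prod isCompact_Icc :
    IsCompact K).exists_bound_of_continuousOn <| continuousOn_emTensor hf hK continuousOn_fst
      (X := fun q => (S.Nv q.1.2, S.Nr q.1.2)) (Y := fun q => (q.2, S.D q.1.2 * q.2 - 1))
      (by fun_prop) (by fun_prop)
  refine ⟨max B 0, le_max_right _ _, fun r ⟨h2M, hR⟩ => ?_⟩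
  exact (le_abs_self _).trans ((hB ((S.vSigma r, r), S.h r) ⟨⟨⟨le_vSigma h2M,
    vSigma_le_of_le h2M hR⟩, h2M, hR⟩, h_nonneg h2M, hH r h2M⟩).trans (le_max_left _ _))

lemma fluxN_lt_top {C : ℝ} (hf : ContDiffOn ℝ ∞ f S.dom)
    (h : ∀ r, S.R < r → |S.drOut f (S.vSigma r, r)| ≤ C * r ^ (-2 : ℝ)) : S.fluxN f < ⊤ := by
  obtain ⟨B, hB₀, hB⟩ := exists_emTensor_le hf
  rw [fluxN, ← Icc_union_Ioi_eq_Ici two_M_lt_R.le]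
  refine (lintegral_union_le _ _ _).trans_lt (ENNReal.add_lt_top.2 ⟨?_, ?_⟩)
  · refine setLIntegral_lt_top_of_le_nnreal (by simp)
      ⟨(4 * Real.pi * S.R ^ 2 * B).toNNReal, fun r hr => ENNReal.ofReal_le_ofReal ?_⟩
    have hr₀ : 0 ≤ r := (pos_of_two_M_le hr.1).le
    calc _ ≤ 4 * Real.pi * r ^ 2 * B := by gcongr; exact hB r hr
      _ ≤ 4 * Real.pi * S.R ^ 2 * B := by gcongr; exact hr.2
  · refine lintegral_Ioi_ofReal_lt_top_of_le_rpow R_pos (s := -2) (C := 2 * Real.pi * C ^ 2)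
      (by norm_num) fun r hr => ?_
    have hr₀ : 0 < r := R_pos.trans hr
    have hdrOut : S.drOut f (S.vSigma r, r) ^ 2 ≤ (C * r ^ (-2 : ℝ)) ^ 2 :=
      sq_le_sq.2 ((h r hr).trans (le_abs_self _))
    rw [emTensor_outer (le_of_lt hr)]
    calc _ ≤ 4 * Real.pi * r ^ 2 * (1 / 2 * (C * r ^ (-2 : ℝ)) ^ 2) := by
          gcongr
          exact D_le_one hr₀
      _ = _ := by
        rw [Real.rpow_neg hr₀.le, Real.rpow_ofNat]
        field_simp
        ring

lemma contDiffOn_along (hX : ContDiffOn ℝ ∞ X S.dom) (hf : ContDiffOn ℝ ∞ f S.dom) :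
    ContDiffOn ℝ ∞ (S.along X f) S.dom :=
  (hf.fderivWithin uniqueDiffOn_dom (by simp)).clm_apply hX

lemma contDiffOn_N (hf : ContDiffOn ℝ ∞ f S.dom) : ContDiffOn ℝ ∞ (S.N f) S.dom :=
  contDiffOn_along ((S.Nv_smooth.comp contDiff_snd).contDiffOn.prodMk
    (S.Nr_smooth.comp contDiff_snd).contDiffOn) hf

lemma contDiffOn_iterate_T (hf : ContDiffOn ℝ ∞ f S.dom) (k : ℕ) :
    ContDiffOn ℝ ∞ (S.T^[k] f) S.dom := by
  induction k with
  | zero => exact hf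
  | succ k ih => rw [Function.iterate_succ_apply']; exact contDiffOn_along contDiffOn_const ih

lemma N_eq_T_outer (hp : S.R ≤ p.2) : S.N f p = S.T f p := by
  rw [N, along_eq, (S.N_outer p.2 hp).1, (S.N_outer p.2 hp).2, one_mul, zero_mul, add_zero]

lemma along_congr_outer (h : ∀ q : ℝ × ℝ, S.R < q.2 → f q = g q) (hp : S.R < p.2) :
    S.along X f p = S.along X g p := by
  have hfg : f =ᶠ[𝓝 p] g := by
    filter_upwards [continuous_snd.continuousAt.eventually (lt_mem_nhds hp)] with q hq using h q hq
  rw [along, along, hfg.fderivWithin_eq_of_nhds]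

end Energy

section OutgoingCone

variable {S : Setting} {f : ℝ × ℝ → ℝ} {w : ℝ × ℝ → ℝ} {p : ℝ × ℝ} {Γ : Set (ℝ × ℝ)} {η : ℝ}

lemma IsSymbol.exists_abs_drOut_le (h : S.IsSymbol S.outgoingCone w 0 (S.L f)) :
    ∃ C, 0 ≤ C ∧ ∀ p ∈ S.outgoingCone, |S.drOut f p| ≤ C * w p := by
  obtain ⟨C, hC, h⟩ := isSymbol_zero_iff.1 h
  obtain ⟨c, hc, hcD⟩ := exists_two_div_D_le (two_M_lt_R (S := S))
  refine ⟨c * C, by positivity, fun p hp => ?_⟩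
  have hpe := outgoingCone_subset_exterior hp
  have hD := D_pos hpe.2
  rw [drOut_eq_L hpe, abs_mul_of_pos_left (by positivity), mul_assoc]
  gcongr
  · exact hcD _ hp.2
  · exact h p hp

lemma drOut_drOut (hf : S.IsSmooth f) (hp : p ∈ S.exterior) :
    S.drOut (S.drOut f) p
      = -(S.M * (2 / S.D p.2) ^ 2 / p.2 ^ 2) * S.L f p + (2 / S.D p.2) ^ 2 * S.L (S.L f) p := by
  have hr := (pos_of_mem hp).ne'
  have hD := (D_pos hp.2).ne'
  have hcoeff : HasDerivAt (fun r => 2 / S.D r) (-(S.M * (2 / S.D p.2) ^ 2 / p.2 ^ 2)) p.2 :=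
    ((hasDerivAt_const p.2 2).div (hasDerivAt_D hr) hD).congr_deriv (by field_simp; ring)
  have hsmooth : ContDiffOn ℝ ∞ (fun r => 2 / S.D r) (Ioi (2 * S.M)) :=
    contDiffOn_const.div contDiffOn_D fun r hr => (D_pos hr).ne'
  have hprod : S.drOut (fun q => 2 / S.D q.2 * S.L f q) p = _ :=
    along_radial_mul hsmooth hf.L hp hcoeff
  rw [show S.drOut (S.drOut f) p = _ from along_congr (fun q hq => drOut_eq_L hq) hp, ← drOut,
    hprod, ← drOut, drOut_eq_L hp]
  ring

lemma IsSymbol.exists_abs_drOut_drOut_le (hf : S.IsSmooth f) (hw : ∀ p ∈ S.outgoingCone, 0 ≤ w p)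
    (h : S.IsSymbol S.outgoingCone w 1 (S.L f)) :
    ∃ C, 0 ≤ C ∧ ∀ p ∈ S.outgoingCone, |S.drOut (S.drOut f) p| ≤ C * (w p / p.2) := by
  have hM := S.M_pos
  obtain ⟨h₀, h₁⟩ := isSymbol_succ_iff.1 h
  obtain ⟨C₀, hC₀, h₀⟩ := isSymbol_zero_iff.1 h₀
  obtain ⟨C₁, hC₁, h₁⟩ := isSymbol_zero_iff.1 h₁
  obtain ⟨c, hc, hcD⟩ := exists_two_div_D_le (two_M_lt_R (S := S))
  refine ⟨c ^ 2 / 2 * C₀ + c ^ 2 * C₁, by positivity, fun p hp => ?_⟩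
  have hpe := outgoingCone_subset_exterior hp
  have hD := D_pos hpe.2
  have hr := pos_of_mem hpe
  have := hw p hp
  have h2M : 2 * S.M ≤ p.2 := le_of_lt hpe.2
  have hcp := hcD _ hp.2
  have hM2 : S.M / p.2 ^ 2 ≤ 1 / 2 / p.2 := by
    rw [div_le_div_iff₀ (by positivity) hr]
    nlinarith
  rw [drOut_drOut hf hpe]
  calc _ ≤ (2 / S.D p.2) ^ 2 * (S.M / p.2 ^ 2) * |S.L f p|
        + (2 / S.D p.2) ^ 2 * |S.L (S.L f) p| := by
        refine (abs_add_le _ _).trans_eq ?_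
        rw [neg_mul, abs_neg, abs_mul_of_pos_left (by positivity),
          abs_mul_of_pos_left (by positivity)]
        ring
    _ ≤ c ^ 2 * (1 / 2 / p.2) * (C₀ * w p) + c ^ 2 * (C₁ * (w p / p.2)) := by
        gcongr
        · exact h₀ p hp
        · exact h₁ p hp
    _ = _ := by ring

lemma exists_abs_le_on_outgoingCone (hf : S.IsSmooth f) (hη : η < 2)
    (h : S.IsSymbol S.outgoingCone (fun p => p.2 ^ (-3 + η)) 0 (S.L f)) :
    ∃ C, 0 ≤ C ∧ ∀ p ∈ S.outgoingCone, |f p| ≤ C := by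
  obtain ⟨P, hP, h⟩ := h.exists_abs_drOut_le
  have hR : 0 < S.R := R_pos
  have hexp : -3 + η = -1 - (2 - η) := by ring
  obtain ⟨l, hl⟩ := exists_tendsto_of_abs_drOut_le (w := 0) (a := S.R) (β := 2 - η) (P := P) hf
    (outgoingCone_subset_exterior (outgoing_mem_outgoingCone le_rfl)) (by linarith)
    fun r hr => hexp ▸ h _ (outgoing_mem_outgoingCone hr)
  have : 0 < 2 - η := by linarith
  refine ⟨|l| + P / (2 - η) * S.R ^ (-(2 - η)), by positivity, fun p hp => ?_⟩
  have hpow : p.2 ^ (-(2 - η)) ≤ S.R ^ (-(2 - η)) :=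
    Real.rpow_le_rpow_of_nonpos hR hp.2 (by linarith)
  have hfl := hl p.2 hp.2
  rw [← hp.1, outgoing_u_snd] at hfl
  calc |f p| ≤ |l| + |f p - l| := by linarith [abs_sub_abs_le_abs_sub (f p) l]
    _ ≤ |l| + P / (2 - η) * p.2 ^ (-(2 - η)) := by gcongr
    _ ≤ _ := by gcongr

lemma IsSymbol.mono_rpow (hΓ : Γ ⊆ S.exterior) {k : ℕ} {q q' : ℝ} (hq : q ≤ q')
    (h : S.IsSymbol Γ (fun p => p.2 ^ q) k f) : S.IsSymbol Γ (fun p => p.2 ^ q') k f := by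
  have hM := S.M_pos
  exact h.mono hΓ (by positivity) fun p hp =>
    rpow_le_const_mul_rpow (by positivity) (le_of_lt (hΓ hp).2) hq

lemma IsWave.isSymbol_L_T (hf : S.IsSmooth f) (hw : S.IsWave f) (hΓ : Γ ⊆ S.exterior)
    (hη0 : 0 ≤ η) (hη1 : η ≤ 2) (hb : ∃ C, 0 ≤ C ∧ ∀ p ∈ Γ, |f p| ≤ C)
    (h : ∀ k, S.IsSymbol Γ (fun p => p.2 ^ (-3 + η)) k (S.L f)) (k : ℕ) :
    S.IsSymbol Γ (fun p => p.2 ^ (-3 + η)) k (S.L (S.T f)) := by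
  have hf_symbol : S.IsSymbol Γ (fun _ => 1) k f := by
    refine IsSymbol.of_le (isSymbol_succ_iff.2 ⟨isSymbol_zero_iff.2 ?_, ?_⟩) (Nat.le_succ k)
    · simpa only [mul_one] using hb
    · simpa only [Real.rpow_neg_one, one_div] using (h k).mono_rpow hΓ (q' := -1) (by linarith)
  have hLbarL : S.IsSymbol Γ (fun p => p.2 ^ (-3 + η)) k (S.Lbar (S.L f)) := by
    refine IsSymbol.mono_rpow hΓ (q := -3) (by linarith) ?_
    refine (hw.isSymbol_Lbar_L hΓ (fun _ _ => zero_le_one) hf hf_symbol).mono hΓ zero_le_one ?_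
    intro p hp
    rw [one_mul, one_div, Real.rpow_neg (pos_of_mem (hΓ hp)).le, Real.rpow_ofNat]
  have hLL : S.IsSymbol Γ (fun p => p.2 ^ (-3 + η)) k (S.L (S.L f)) := by
    refine IsSymbol.mono_rpow hΓ (q := -3 + η - 1) (by linarith) ?_
    refine (isSymbol_succ_iff.1 (h (k + 1))).2.mono hΓ zero_le_one fun p hp => ?_
    rw [one_mul, Real.rpow_sub_one (pos_of_mem (hΓ hp)).ne']
  refine (hLL.add hΓ hf.L.L hf.L.Lbar hLbarL).congr hΓ fun p hp => ?_
  rw [Setting.Lbar_L hf hp]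
  exact ((along_congr (fun q _ => T_eq_L_add_Lbar f q) hp).trans
    (along_add hf.L hf.Lbar hp)).symm

lemma IsWave.isSymbol_L_iterate_T (hf : S.IsSmooth f) (hw : S.IsWave f) (hη0 : 0 ≤ η) (hη : η < 2)
    (h : ∀ k, S.IsSymbol S.outgoingCone (fun p => p.2 ^ (-3 + η)) k (S.L f)) (i : ℕ) :
    ∀ k, S.IsSymbol S.outgoingCone (fun p => p.2 ^ (-3 + η)) k (S.L (S.T^[i] f)) := by
  induction i with
  | zero => exact h
  | succ i ih =>
    rw [Function.iterate_succ_apply']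
    exact (hw.iterate_T hf i).isSymbol_L_T (hf.iterate_T i) outgoingCone_subset_exterior hη0 hη.le
      (exists_abs_le_on_outgoingCone (hf.iterate_T i) hη (ih 0)) ih

lemma exists_abs_drOut_le_of_rad (hf : S.IsSmooth f) (hη : η < 2)
    (h : S.IsSymbol S.outgoingCone (fun p => p.2 ^ (-3 + η)) 0 (S.L (rad f))) :
    ∃ C, ∀ p ∈ S.outgoingCone, |S.drOut f p| ≤ C * p.2 ^ (-2 : ℝ) := by
  obtain ⟨C₁, -, hdrOut⟩ :=
    (h.mono_rpow outgoingCone_subset_exterior (q' := -1) (by linarith)).exists_abs_drOut_le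
  obtain ⟨C₂, -, hrad⟩ := exists_abs_le_on_outgoingCone hf.rad hη h
  refine ⟨C₁ + C₂, fun p hp => ?_⟩
  have hpe := outgoingCone_subset_exterior hp
  have hr := pos_of_mem hpe
  have hleibniz : S.drOut f p = p.2⁻¹ * S.drOut (rad f) p - (p.2 ^ 2)⁻¹ * rad f p := by
    rw [show S.drOut (rad f) p = 1 * f p + p.2 * S.drOut f p from along_rad hf hpe, rad]
    field_simp
    ring
  calc |S.drOut f p| ≤ p.2⁻¹ * |S.drOut (rad f) p| + (p.2 ^ 2)⁻¹ * |rad f p| := by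
        rw [hleibniz]
        refine (abs_sub _ _).trans_eq ?_
        rw [abs_mul_of_pos_left (by positivity), abs_mul_of_pos_left (by positivity)]
    _ ≤ p.2⁻¹ * (C₁ * p.2 ^ (-1 : ℝ)) + (p.2 ^ 2)⁻¹ * C₂ := by
        gcongr
        · exact hdrOut p hp
        · exact hrad p hp
    _ = _ := by
        rw [Real.rpow_neg_one, Real.rpow_neg hr.le, Real.rpow_ofNat]
        ring

lemma IsWave.isSymbol_L_outgoingCone {B : ℝ} (hf : S.IsSmooth f) (hw : S.IsWave f)
    (h₀ : ∀ v, S.v₀ ≤ v → Tendsto (fun r => f (v, r)) atTop (𝓝 0)) (hB₀ : 0 ≤ B)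
    (hB : ∀ p ∈ S.region 0, |f p| ≤ B / S.delay 0 p) (hη0 : 0 < η) (hη : η ≤ 3) (k : ℕ) :
    S.IsSymbol S.outgoingCone (fun p => p.2 ^ (-3 + η)) k (S.L f) := by
  intro j _
  obtain ⟨C, hC, h⟩ := hw.exists_abs_iterate_L_le hf h₀ hB₀ hB j hη0 (by linarith)
  refine ⟨C, hC, fun p hp => ?_⟩
  have hr := pos_of_mem (outgoingCone_subset_exterior hp)
  have hdelay : S.delay 0 p = 1 := by rw [delay, hp.1, sub_zero, add_zero]
  have hjp := h p (outgoingCone_subset_region hp)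
  rwa [hdelay, Real.one_rpow, one_mul, show -(3 + j : ℝ) + η = -3 + η - j by ring,
    Real.rpow_sub_natCast hr.ne', Function.iterate_succ_apply] at hjp

end OutgoingCone

section RadiationField

/-! ### Radiation fields without incoming radiation -/

variable {S : Setting} {φ ψ : ℝ × ℝ → ℝ} {I ε η : ℝ} {u₁ v : ℝ}

variable (S) in
/-- `ψ` is a radiation field without incoming radiation from past null infinity, with
`∂_u ψ = 2 I / (1 + u)² + O(|1 + u|^{-2-ε})` on the cone `{v = v₀}`. As opposed to
`IsScatteringSolution`, nothing is assumed at the horizon or on higher derivatives of the data. -/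
structure IsRadiationField (ψ : ℝ × ℝ → ℝ) (I ε : ℝ) : Prop where
  smooth : S.IsSmooth ψ
  wave : S.IsWave ψ
  data : S.BigOOnCone 0 (2 + ε) fun p => S.Lbar ψ p - 2 * I / (1 + S.u p) ^ 2
  noIncoming : ∀ v, S.v₀ ≤ v → Tendsto (fun r => ψ (v, r)) atTop (𝓝 0)

lemma IsRadiationField.exists_abs_le_div_delay (hψ : S.IsRadiationField ψ I ε) (hε : 0 ≤ ε)
    (u₁ : ℝ) : ∃ B, 0 ≤ B ∧ ∀ p ∈ S.region u₁, |ψ p| ≤ B / S.delay u₁ p := by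
  obtain ⟨C, hC, hdata⟩ :=
    hψ.data.exists_abs_Lbar_sub_le hψ.smooth le_rfl hε zero_le_one u₁
  exact hψ.wave.exists_abs_le_div_delay hψ.smooth hψ.noIncoming (by positivity)
    fun r => abs_Lbar_initial_le hC le_rfl hdata

lemma IsRadiationField.exists_expansion (hψ : S.IsRadiationField ψ I ε) {β : ℝ} (hβ : 0 < β)
    (hβε : β < ε) (hβ1 : β < 1) (u₁ : ℝ) :
    ∃ J P, 0 ≤ P ∧ ∀ r, S.innerRadius u₁ ≤ r →
      |r ^ 3 * S.drOut ψ (S.outgoing u₁ r) + 2 * S.M * I * Real.log r - J| ≤ P * r ^ (-β) := by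
  have hδ : β < min ε 1 := lt_min hβε hβ1
  obtain ⟨B, hB₀, hB⟩ := hψ.exists_abs_le_div_delay (hβ.trans hβε).le u₁
  obtain ⟨C, hC, hdata⟩ := hψ.data.exists_abs_Lbar_sub_le hψ.smooth (hβ.trans hδ).le
    (min_le_left _ _) (min_le_right _ _) u₁
  obtain ⟨B', hB'₀, hB'⟩ := hψ.wave.exists_abs_sub_le_delay_rpow hψ.smooth hψ.noIncoming hC
    (hβ.trans hδ).le (min_le_right _ _) hdata
  exact hψ.wave.exists_expansion hψ.smooth hψ.noIncoming hB₀ hB hB'₀ hB' hβ hδ (min_le_right _ _)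

lemma tendsto_D : Tendsto S.D atTop (𝓝 1) := by
  have h := (tendsto_const_nhds.div_atTop (a := 2 * S.M) tendsto_id).const_sub 1
  rwa [sub_zero] at h

lemma tendsto_rstar_div : Tendsto (fun r => S.rstar r / r) atTop (𝓝 1) := by
  obtain ⟨c, hc⟩ := exists_rstar_eq_add_log S
  have hlog : Tendsto (fun r => Real.log (r - 2 * S.M) / r) atTop (𝓝 0) := by
    have h := (Real.tendsto_pow_log_div_mul_add_atTop 1 (2 * S.M) 1 one_ne_zero).comp
      (tendsto_atTop_add_const_right atTop (-(2 * S.M)) tendsto_id)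
    simpa [Function.comp_def, sub_eq_add_neg] using h
  have h := (tendsto_const_nhds.div_atTop (a := c) tendsto_id).add
    ((hlog.const_mul (2 * S.M)).const_add 1)
  rw [mul_zero, add_zero, zero_add] at h
  refine h.congr' ?_
  filter_upwards [Ioi_mem_atTop (2 * S.M)] with r hr
  have := (pos_of_two_M_lt hr).ne'
  rw [hc r hr, id]
  field_simp

lemma tendsto_div_delay (u₁ v : ℝ) :
    Tendsto (fun r => r / S.delay u₁ (v, r)) atTop (𝓝 (1 / 2)) := by
  have h := ((tendsto_const_nhds.div_atTop (a := 1 + (u₁ - v)) tendsto_id).add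
    (tendsto_rstar_div (S := S).const_mul 2)).inv₀ (by norm_num)
  rw [zero_add, mul_one, ← one_div] at h
  refine h.congr' ?_
  filter_upwards [Ioi_mem_atTop 0] with r hr
  have : r ≠ 0 := ne_of_gt hr
  rw [id, delay, u, ← inv_div]
  field_simp
  ring

lemma IsRadiationField.tendsto_sq_mul_drIn (hψ : S.IsRadiationField ψ I ε) (hε : 0 < ε)
    (hv : S.v₀ ≤ v) : Tendsto (fun r => r ^ 2 * S.drIn ψ (v, r)) atTop (𝓝 (-I)) := by
  let δ := min ε 1
  have hδ : 0 < δ := lt_min hε one_pos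
  obtain ⟨C, hC, hdata⟩ := hψ.data.exists_abs_Lbar_sub_le hψ.smooth hδ.le
    (min_le_left _ _) (min_le_right _ _) 0
  obtain ⟨B, -, hB⟩ := hψ.wave.exists_abs_Lbar_sub_le_delay_rpow hψ.smooth hψ.noIncoming hC
    hδ.le (min_le_right _ _) hdata
  have hq := tendsto_div_delay (S := S) 0 v
  have herr : Tendsto (fun r => r ^ 2 * (S.Lbar ψ (v, r) - 2 * I / S.delay 0 (v, r) ^ 2))
      atTop (𝓝 0) := by
    have h := ((hq.pow 2).const_mul B).mul
      ((tendsto_rpow_neg_atTop hδ).comp (tendsto_delay S 0 v))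
    rw [mul_zero] at h
    refine squeeze_zero_norm' ?_ h
    filter_upwards [eventually_mk_mem_region hv 0] with r hr
    have hd := delay_pos hr
    rw [norm_mul, Real.norm_of_nonneg (sq_nonneg r), Real.norm_eq_abs]
    calc _ ≤ r ^ 2 * (B * S.delay 0 (v, r) ^ (-2 - δ)) := by gcongr; exact hB _ hr
      _ = _ := by
        rw [show -2 - δ = -δ - (2 : ℕ) by push_cast; ring, Real.rpow_sub_natCast hd.ne',
          Function.comp_apply]
        ring
  have hmain := ((tendsto_const_nhds (x := (2 : ℝ))).div (tendsto_D (S := S)) one_ne_zero).mul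
    (herr.add ((hq.pow 2).const_mul (2 * I))) |>.neg
  rw [show -(2 / 1 * (0 + 2 * I * (1 / 2) ^ 2)) = -I by ring] at hmain
  refine hmain.congr' ?_
  filter_upwards [eventually_mk_mem_region hv 0] with r hr
  rw [drIn_eq_Lbar hr.1, Pi.div_apply]
  ring

lemma IsRadiationField.hasNPConstant (hφ : S.IsRadiationField (rad φ) I ε) (hε : 0 < ε) (u₁ : ℝ) :
    S.HasNPConstant (fun r => r ^ 3 / Real.log r) φ u₁ (-2 * S.M * I) := by
  obtain ⟨β, hβ, hβ'⟩ := exists_between (lt_min hε one_pos)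
  obtain ⟨J, P, -, hJ⟩ :=
    hφ.exists_expansion hβ (lt_min_iff.1 hβ').1 (lt_min_iff.1 hβ').2 u₁
  have hbound : Tendsto (fun r : ℝ => (|J| + P * r ^ (-β)) / Real.log r) atTop (𝓝 0) :=
    ((tendsto_rpow_neg_atTop hβ).const_mul P).const_add |J| |>.div_atTop Real.tendsto_log_atTop
  refine tendsto_iff_norm_sub_tendsto_zero.2 <|
    squeeze_zero' (Eventually.of_forall fun _ => norm_nonneg _) ?_ hbound
  filter_upwards [Ici_mem_atTop (S.innerRadius u₁), Ioi_mem_atTop 1] with r hr hr1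
  have hlog : 0 < Real.log r := Real.log_pos hr1
  have hJr := hJ r hr
  rw [outgoing] at hJr
  set G := r ^ 3 * S.drOut (rad φ) (u₁ + 2 * S.rstar r, r) + 2 * S.M * I * Real.log r with hG
  have hquot : r ^ 3 / Real.log r * S.drOut (rad φ) (u₁ + 2 * S.rstar r, r) - -2 * S.M * I
      = G / Real.log r := by rw [hG]; field_simp; ring
  rw [hquot, Real.norm_eq_abs, abs_div, abs_of_pos hlog]
  gcongr
  linarith [abs_sub_abs_le_abs_sub G J]

lemma IsRadiationField.exists_expansion_vSigma (hψ : S.IsRadiationField ψ I ε) (hε : 0 < ε) :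
    ∃ J P β : ℝ, 0 < P ∧ 0 < β ∧ β < ε ∧ β < 1 ∧ ∀ r, S.R ≤ r →
      |S.drOut ψ (S.vSigma r, r) - (-2 * S.M * I) * (Real.log r / r ^ 3) - J / r ^ 3|
        ≤ P * r ^ (-3 - β) := by
  obtain ⟨β, hβ, hβ'⟩ := exists_between (lt_min hε one_pos)
  obtain ⟨hβε, hβ1⟩ := lt_min_iff.1 hβ'
  obtain ⟨J, P, hP, hJ⟩ := hψ.exists_expansion hβ hβε hβ1 0
  refine ⟨J, P + 1, β, by positivity, hβ, hβε, hβ1, fun r hr => ?_⟩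
  have hr₀ : 0 < r := R_pos.trans_le hr
  have hJr := hJ r (innerRadius_le (outgoingCone_subset_region (vSigma_mem_outgoingCone hr)))
  rw [vSigma_eq_outgoing hr]
  calc _ = |r ^ 3 * S.drOut ψ (S.outgoing 0 r) + 2 * S.M * I * Real.log r - J| / r ^ 3 := by
        rw [← abs_of_pos (pow_pos hr₀ 3), ← abs_div, abs_of_pos (pow_pos hr₀ 3)]
        congr 1
        field_simp
        ring
    _ ≤ (P + 1) * r ^ (-β) / r ^ 3 := by
        gcongr
        exact hJr.trans (by gcongr; linarith)
    _ = _ := by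
        rw [show -3 - β = -β - (3 : ℕ) by push_cast; ring, Real.rpow_sub_natCast hr₀.ne',
          mul_div_assoc]

lemma IsRadiationField.isSymbol_L_iterate_T (hψ : S.IsRadiationField ψ I ε) (hε : 0 ≤ ε)
    (hη₀ : 0 < η) (hη : η < 2) (i k : ℕ) :
    S.IsSymbol S.outgoingCone (fun p => p.2 ^ (-3 + η)) k (S.L (S.T^[i] ψ)) := by
  obtain ⟨B, hB₀, hB⟩ := hψ.exists_abs_le_div_delay hε 0
  exact hψ.wave.isSymbol_L_iterate_T hψ.smooth hη₀.le hη
    (hψ.wave.isSymbol_L_outgoingCone hψ.smooth hψ.noIncoming hB₀ hB hη₀ (by linarith)) i k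

lemma IsRadiationField.outerNorm_drOut_lt_top (hψ : S.IsRadiationField ψ I ε) (hε : 0 ≤ ε) {q : ℝ}
    (hq : q < 5) (i : ℕ) : S.outerNorm q (S.drOut (S.T^[i] ψ)) < ⊤ := by
  obtain ⟨η, hη₀, hη⟩ := exists_between (lt_min (half_pos (sub_pos.2 hq)) two_pos)
  obtain ⟨hηq, hη2⟩ := lt_min_iff.1 hη
  obtain ⟨C, -, h⟩ := (hψ.isSymbol_L_iterate_T hε hη₀ hη2 i 0).exists_abs_drOut_le
  exact outerNorm_lt_top (by linarith) h

lemma IsRadiationField.outerNorm_drOut_drOut_lt_top (hψ : S.IsRadiationField ψ I ε) (hε : 0 ≤ ε)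
    {q : ℝ} (hq : q < 7) (i : ℕ) : S.outerNorm q (S.drOut (S.drOut (S.T^[i] ψ))) < ⊤ := by
  obtain ⟨η, hη₀, hη⟩ := exists_between (lt_min (half_pos (sub_pos.2 hq)) two_pos)
  obtain ⟨hηq, hη2⟩ := lt_min_iff.1 hη
  have hpos (p : ℝ × ℝ) (hp : p ∈ S.outgoingCone) : 0 < p.2 :=
    pos_of_mem (outgoingCone_subset_exterior hp)
  obtain ⟨C, -, h⟩ := (hψ.isSymbol_L_iterate_T hε hη₀ hη2 i 1).exists_abs_drOut_drOut_le
    (hψ.smooth.iterate_T i) fun p hp => Real.rpow_nonneg (hpos p hp).le _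
  refine outerNorm_lt_top (s := -3 + η - 1) (C := C) (by linarith) fun p hp => ?_
  rw [Real.rpow_sub_one (hpos p hp).ne']
  exact h p hp

lemma IsRadiationField.fluxN_lt_top (hs : S.IsSmooth φ) (hφ : S.IsRadiationField (rad φ) I ε)
    (hε : 0 ≤ ε) {F : ℝ × ℝ → ℝ} (hF : ContDiffOn ℝ ∞ F S.dom) {i : ℕ}
    (hFT : ∀ q : ℝ × ℝ, S.R < q.2 → F q = S.T^[i] φ q) : S.fluxN F < ⊤ := by
  have hsymbol := (hφ.isSymbol_L_iterate_T hε one_pos one_lt_two i 0).congr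
    outgoingCone_subset_exterior (along_congr (iterate_T_rad hs i))
  obtain ⟨C, hC⟩ := exists_abs_drOut_le_of_rad (hs.iterate_T i) one_lt_two hsymbol
  refine Setting.fluxN_lt_top hF (C := C) fun r hr => ?_
  rw [show S.drOut F (S.vSigma r, r) = S.drOut (S.T^[i] φ) (S.vSigma r, r) from
    along_congr_outer hFT hr]
  exact hC _ (vSigma_mem_outgoingCone hr.le)

lemma IsRadiationField.energy_lt_top (hs : ContDiffOn ℝ ∞ φ S.dom)
    (hφ : S.IsRadiationField (rad φ) I ε) (hε : 0 ≤ ε) {ε' : ℝ} (hε' : 0 < ε') :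
    S.energy ε' 1 φ < ⊤ := by
  have hX (i : ℕ) {q : ℝ} (hq : q < 5) := hφ.outerNorm_drOut_lt_top hε hq i
  have hXX (i : ℕ) {q : ℝ} (hq : q < 7) := hφ.outerNorm_drOut_drOut_lt_top hε hq i
  simp only [energy, ENNReal.add_lt_top, ENNReal.sum_lt_top]
  refine ⟨⟨⟨?_, hXX 0 (by push_cast; linarith)⟩, fun i _ => ?_⟩, fun m hm i _ => ?_⟩
  · exact ENNReal.sum_lt_top.2 fun i _ =>
      hφ.fluxN_lt_top (hs.mono exterior_subset_dom) hε (contDiffOn_iterate_T hs i) fun _ _ => rfl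
  · exact ⟨⟨⟨⟨hX _ (by linarith), hX _ (by linarith)⟩, hX _ (by linarith)⟩, hX _ (by norm_num)⟩,
      hX _ (by norm_num)⟩
  · have hm2 : m < 2 := Finset.mem_range.1 hm
    interval_cases m
    · exact hX i (by push_cast; linarith)
    · exact hXX i (by push_cast; linarith)

lemma IsRadiationField.energyTilde_add_fluxN_lt_top (hs : ContDiffOn ℝ ∞ φ S.dom)
    (hφ : S.IsRadiationField (rad φ) I ε) (hε : 0 ≤ ε) {ε' : ℝ} (hε' : 0 < ε') :
    S.energyTilde ε' 1 φ + S.fluxN (S.N (S.N φ)) < ⊤ := by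
  have he := hs.mono exterior_subset_dom
  have hNT (i : ℕ) : S.fluxN (S.N (S.T^[i] φ)) < ⊤ :=
    hφ.fluxN_lt_top he hε (i := i + 1) (contDiffOn_N (contDiffOn_iterate_T hs i)) fun q hq => by
      rw [N_eq_T_outer hq.le, Function.iterate_succ_apply']
  have hNN : S.fluxN (S.N (S.N φ)) < ⊤ :=
    hφ.fluxN_lt_top he hε (i := 2) (contDiffOn_N (contDiffOn_N hs)) fun q hq =>
      (N_eq_T_outer hq.le).trans (along_congr_outer (fun _ h => N_eq_T_outer h.le) hq)
  exact ENNReal.add_lt_top.2 ⟨ENNReal.add_lt_top.2 ⟨hφ.energy_lt_top hs hε hε',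
    ENNReal.sum_lt_top.2 fun i _ => hNT i⟩, hNN⟩

end RadiationField

end Setting

end

end Schwarzschild

theorem theorem7p1_general (S : Schwarzschild.Setting) (φ : ℝ × ℝ → ℝ) (I εφ : ℝ) (hεφ : 0 < εφ)
    (hs : ContDiffOn ℝ ∞ φ S.dom) (hwave : ∀ p ∈ S.dom, S.box φ p = 0)
    (hdata : S.BigOOnCone 0 (2 + εφ) fun p =>
      S.Lbar (Schwarzschild.rad φ) p - 2 * I / (1 + S.u p) ^ 2)
    (h₀ : ∀ v, S.v₀ ≤ v → Tendsto (fun r => Schwarzschild.rad φ (v, r)) atTop (𝓝 0)) :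
    (∀ v, S.v₀ ≤ v →
      Tendsto (fun r => r ^ 2 * S.drIn (Schwarzschild.rad φ) (v, r)) atTop (𝓝 (-I))) ∧
    (∀ u₁, S.HasNPConstant (fun r => r ^ 3 / Real.log r) φ u₁ (-2 * S.M * I)) ∧
    (∃ J P β : ℝ, 0 < P ∧ 0 < β ∧ β < εφ ∧ β < 1 ∧
      ∀ r, S.R ≤ r →
        |S.drOut (Schwarzschild.rad φ) (S.vSigma r, r)
            - (-2 * S.M * I) * (Real.log r / r ^ 3) - J / r ^ 3|
          ≤ P * r ^ (-3 - β)) ∧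
    (∀ ε : ℝ, 0 < ε → S.energyTilde ε 1 φ + S.fluxN (S.N (S.N φ)) < ⊤) := by
  have he : S.IsSmooth φ := hs.mono Schwarzschild.Setting.exterior_subset_dom
  have hψ : S.IsRadiationField (Schwarzschild.rad φ) I εφ :=
    ⟨he.rad, Schwarzschild.Setting.isWave_rad he fun p hp =>
      hwave p (Schwarzschild.Setting.exterior_subset_dom hp), hdata, h₀⟩
  exact ⟨fun v hv => hψ.tendsto_sq_mul_drIn hεφ hv, hψ.hasNPConstant hεφ,
    hψ.exists_expansion_vSigma hεφ, fun ε hε => hψ.energyTilde_add_fluxN_lt_top hs hεφ.le hε⟩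

theorem theorem7p1 (S : Schwarzschild.Setting) (φ : ℝ × ℝ → ℝ) (I εφ : ℝ) (hεφ : 0 < εφ)
    (hφ : S.IsScatteringSolution φ I εφ) :
    (∀ v, S.v₀ ≤ v → Tendsto (fun r => r ^ 2 * S.drIn (Schwarzschild.rad φ) (v, r)) atTop (𝓝 (-I))) ∧
    (∀ u₁, S.HasNPConstant (fun r => r ^ 3 / Real.log r) φ u₁ (-2 * S.M * I)) ∧
    (∃ J P β : ℝ, 0 < P ∧ 0 < β ∧ β < εφ ∧ β < 1 ∧
      ∀ r, S.R ≤ r →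
        |S.drOut (Schwarzschild.rad φ) (S.vSigma r, r)
            - (-2 * S.M * I) * (Real.log r / r ^ 3) - J / r ^ 3|
          ≤ P * r ^ (-3 - β)) ∧
    (∀ ε : ℝ, 0 < ε → S.energyTilde ε 1 φ + S.fluxN (S.N (S.N φ)) < ⊤) :=
  have ⟨C, hC⟩ := hφ.data
  theorem7p1_general S φ I εφ hεφ hφ.smooth hφ.wave
    ⟨C, fun j hj => hC j (hj.trans (Nat.zero_le 4))⟩ hφ.noIncoming
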